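/- **Setting.** Let $f_\theta(y)=\exp\{y\theta-b(\theta)+c(y)\}$ on a fixed set and $f_\theta(y)=0$ off that set, $\theta\in\mathbb R$, be an exponential family of densities on $\mathbb R$ with respect to $\nu$, which is either Lebesgue measure or counting measure; $u_\theta(y)=\partial\log f_\theta(y)/\partial\theta$. For each $n$ let $t_i=t_{n,i}\in[0,1]$ be fixed and $Y_i=Y_{n,i}$ ($1\le i\le n$) be independent with density $f_{g_0(t_i)}$, where $g_0:[0,1]\to\mathbb R$. For $\alpha>0$ put $l_\alpha(y,\theta)=\int f_\theta^{1+\alpha}\,d\nu-(1+1/\alpha)f_\theta^\alpha(y)$. Let $m\ge 1$, $p>m$, let $0=x_0<x_1<\dots<x_K<x_{K+1}=1$ be knots ($K=K_n$, $x_i=x_{n,i}$), and let $S_K^p$ be the space of splines of order $p$ on $[0,1]$ with these knots ($C^{p-2}$ functions that are polynomials of degree at most $p-1$ on each $[x_i,x_{i+1}]$). For $\lambda=\lambda_n\ge 0$ and a random tuning parameter $\widehat\alpha_n$ consider $$L_n(g)=\frac1n\sum_{i=1}^n l_{\widehat\alpha_n}(Y_i,g(t_i))+\lambda\int_0^1|g^{(m)}(t)|^2dt,\qquad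 g\in S_K^p. \tag{1}$$ Write $\|\cdot\|$ for the $L^2([0,1])$ norm and read $\lambda^{-e}=\infty$ if $\lambda=0$ ($e>0$). **Assumptions.** * (A1) The support $\mathcal Y=\overline{\{y:f_\theta(y)>0\}}$ does not depend on $\theta$. * (A2) $\widehat\alpha_n\to\alpha_0$ in probability for some $\alpha_0>0$. * (A3) The densities are uniformly bounded in $(\theta,y)$, and there are $\delta>0$, $M<\infty$ such that, for all $t\in[0,1]$ and $|u|<\delta$, $\theta\mapsto f_\theta(y)$ is twice differentiable at $g_0(t)+u$ for every $y\in\mathcal Y$, and $\left|\frac{\partial f^\alpha_\theta(y)}{\partial\theta}\big|_{\theta=g_0(t)+u}\log f_{g_0(t)+u}(y)\right|\le M$ for all $t\in[0,1]$, $|\alpha-\alpha_0|<\delta$, $|u|<\delta$, $y\in\mathcal Y$. * (A4) Let $m_t(u,\alpha)=\int_{\mathcal Y}\frac{\partial^2 f_\theta^{1+\alpha}(y)}{\partial\theta^2}\big|_{\theta=g_0(t)+u}d\nu(y)$ and $n_t(u,\alpha,y)=\frac{\partial^2 f_\theta^{\alpha}(y)}{\partial\theta^2}\big|_{\theta=g_0(t)+u}$.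 For all $|\alpha-\alpha_0|<\delta$ and $y\in\mathcal Y$ the families of functions of $u$, $\{m_t(\cdot,\alpha)\}_{t\in[0,1]}$ and $\{n_t(\cdot,\alpha,y)\}_{t\in[0,1]}$, are equicontinuous at $u=0$, and $\sup_{t\in[0,1]}\sup_{|\alpha-\alpha_0|<\delta,|u|<\delta}\{|m_t(u,\alpha)|+\sup_{y\in\mathcal Y}|n_t(u,\alpha,y)|\}<\infty$. * (A5) There are $0<c_0\le C_0<\infty$ with $c_0\le \mathbb E\{f_{g_0(t_i)}^\alpha(Y_i)\,|u_{g_0(t_i)}(Y_i)|^2\}\le C_0$ for all $n$, all $i\le n$ and all $|\alpha-\alpha_0|<\delta$. * (B6) $K\to\infty$ and $n^{\delta'-1}K^2\to0$ for some $\delta'>0$. * (B7) With $h_i=x_i-x_{i-1}$, $\max_i|h_{i+1}-h_i|=o(K^{-1})$, and $\max_i h_i/\min_i h_i$ is bounded uniformly in $n$. * (B8) There is a distribution function $Q$ on $[0,1]$ with Lebesgue density bounded away from zero and infinity such that the empirical distribution function $Q_n$ of $t_1,\dots,t_n$ satisfies $\sup_{t\in[0,1]}|Q_n(t)-Q(t)|=o(K^{-1})$.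 **Theorem 2.** Assume (A1)–(A5) and (B6)–(B8), and let $\lambda\to0$ in such a way that, as $n\to\infty$, $$K\min\{\lambda^2K^{2m},\lambda\}\to0,\qquad n\max\{K^{-1},\lambda^{1/(2m)}\}\exp[-\min\{K^2,\lambda^{-1/m}\}]\to0 .$$ If $g_0\in C^j([0,1])$ with $m\le j\le p$, then $$\lim_{D\to\infty}\liminf_{n\to\infty}\Pr\Big[\text{there is a local minimizer }\widehat g_n\in S_K^p\text{ of (1) with }\|\widehat g_n-g_0\|^2\le D\big(n^{-1}\min\{K,\lambda^{-1/(2m)}\}+\min\{\lambda^2K^{2m},\lambda\}+K^{-2j}\big)\Big]=1 .$$ (If the event is not known to be measurable, $\Pr$ is inner probability.) -/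

import Mathlib

open MeasureTheory ProbabilityTheory Filter Topology Set

/-- A (dispersion-free) exponential family on `ℝ` with canonical parameter `θ ∈ ℝ`.  The reference
measure is Lebesgue measure or counting measure.  The density is `exp (y θ - b θ + c y)` on `carrier`
and `0` off `carrier` (i.e. `c = -∞` there), and it integrates to one for every `θ`. -/
structure ExpFamily where
  ν : Measure ℝ
  ν_eq : ν = volume ∨ ν = Measure.count
  carrier : Set ℝ
  measurableSet_carrier : MeasurableSet carrier
  b : ℝ → ℝ
  c : ℝ → ℝ
  measurable_c : Measurable c
  lintegral_eq_one : ∀ θ : ℝ, ∫⁻ y,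
    ENNReal.ofReal (carrier.indicator (fun y => Real.exp (y * θ - b θ + c y)) y) ∂ν = 1

namespace ExpFamily

/-- The density `f_θ(y)`. -/
noncomputable def density (F : ExpFamily) (θ y : ℝ) : ℝ :=
  F.carrier.indicator (fun y => Real.exp (y * θ - F.b θ + F.c y)) y

/-- The distribution `F_θ`. -/
noncomputable def law (F : ExpFamily) (θ : ℝ) : Measure ℝ :=
  F.ν.withDensity fun y => ENNReal.ofReal (F.density θ y)

/-- The score `u_θ(y) = ∂ log f_θ(y) / ∂θ`. -/
noncomputable def score (F : ExpFamily) (θ y : ℝ) : ℝ :=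
  deriv (fun η => Real.log (F.density η y)) θ

/-- The density power divergence loss
`l_α(y, θ) = ∫ f_θ^{1+α} dν - (1 + 1/α) f_θ(y)^α`, for `α > 0`. -/
noncomputable def dpdLoss (F : ExpFamily) (α y θ : ℝ) : ℝ :=
  (∫ x, F.density θ x ^ (1 + α) ∂F.ν) - (1 + 1 / α) * F.density θ y ^ α

/-- `∂f_θ(y)^α / ∂θ`. -/
noncomputable def dPow (F : ExpFamily) (α y θ : ℝ) : ℝ :=
  deriv (fun η => F.density η y ^ α) θ

/-- `∂²f_θ(y)^α / ∂θ²`. -/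
noncomputable def d2Pow (F : ExpFamily) (α y θ : ℝ) : ℝ :=
  iteratedDeriv 2 (fun η => F.density η y ^ α) θ

end ExpFamily

/-- `min {a, lam^{-e}}` for `lam ≥ 0`, with the convention `0^{-e} = ∞`. -/
noncomputable def minNegPow (a lam e : ℝ) : ℝ :=
  if lam = 0 then a else min a (lam ^ (-e))

/-- `x 0 = 0 < x 1 < ... < x K < x (K + 1) = 1`; the values of `x` beyond `K + 1` are irrelevant. -/
def IsKnotSeq (K : ℕ) (x : ℕ → ℝ) : Prop :=
  x 0 = 0 ∧ x (K + 1) = 1 ∧ ∀ i ≤ K, x i < x (i + 1)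

/-- Splines of order `p ≥ 2` on `[0, 1]` with `K` interior knots `x 1, ..., x K`: functions that are
`C^{p-2}` on `[0, 1]` and a polynomial of degree at most `p - 1` on every `[x i, x (i + 1)]`.  Only the
values on `[0, 1]` matter. -/
def IsSpline (p K : ℕ) (x : ℕ → ℝ) (s : ℝ → ℝ) : Prop :=
  ContDiffOn ℝ ((p - 2 : ℕ) : WithTop ℕ∞) s (Icc 0 1) ∧
    ∀ i ≤ K, ∃ q : Polynomial ℝ, q.natDegree ≤ p - 1 ∧
      ∀ t ∈ Icc (x i) (x (i + 1)), s t = q.eval t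

/-- The squared `L²([0, 1])` norm. -/
noncomputable def sqNorm (g : ℝ → ℝ) : ℝ := ∫ t in (0 : ℝ)..1, g t ^ 2

/-- The penalized objective
`n⁻¹ ∑ l_α(Y_i, g(t_i)) + lam ∫_0^1 |g^{(m)}|²`.  For a spline of order `p > m` the derivative
exists off the knots, and the integral does not see the knots. -/
noncomputable def objective (F : ExpFamily) (m n : ℕ) (lam α : ℝ) (t y : Fin n → ℝ)
    (g : ℝ → ℝ) : ℝ :=
  (n : ℝ)⁻¹ * ∑ i, F.dpdLoss α (y i) (g (t i)) + lam * sqNorm (iteratedDeriv m g)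

/-- `g` is a local minimizer of `L` over the finite-dimensional spline space, with respect to the
`L²([0, 1])` distance (all norms on that space define the same local minimizers). -/
def IsLocalSplineMinimizer (p K : ℕ) (x : ℕ → ℝ) (L : (ℝ → ℝ) → ℝ) (g : ℝ → ℝ) : Prop :=
  IsSpline p K x g ∧
    ∃ r > 0, ∀ h, IsSpline p K x h → sqNorm (fun t => h t - g t) < r → L g ≤ L h

/-- The empirical distribution function of the design points. -/
noncomputable def empiricalCDF {n : ℕ} (t : Fin n → ℝ) (s : ℝ) : ℝ :=
  (n : ℝ)⁻¹ * (Nat.card {i : Fin n // t i ≤ s} : ℝ)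

/-- Inner probability of an event under a probability measure; it equals `P A` for measurable `A`
and is at most `P A` always. -/
noncomputable def innerProb {Ω : Type*} [MeasurableSpace Ω] (P : Measure Ω) (A : Set Ω) : ENNReal :=
  1 - P Aᶜ

/-! ### Polynomial inequalities on intervals -/

/-! The theorem is a sphere argument around a good spline approximation. By `exists_spline_approx`
there is a spline `s` with `|s - g₀|` of order `K^{-j}` and with `∫ |s^{(m)}|²` bounded. The spline
space is identified with a Euclidean space through a family orthonormal for the penalized inner
product `∫ f h + lam ∫ f^{(m)} h^{(m)}` (`exists_spline_orthonormal`). Write `r` for the rate. If on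
the sphere `‖β‖ = H √r` the objective at `s + linComb φ β` lies strictly above its value at `s`,
then a minimizer over the closed ball is interior, hence a local minimizer
(`exists_localSplineMinimizer`), and its squared distance to `g₀` is of order `r`. No convexity of
the loss enters.

The increment of the objective is bounded below by a sum of four pieces (`le_average_increment`).
(i) A linear form in the derivatives of the loss at `g₀(t_i)`. These are centered for every tuning
parameter, and the form has squared norm of order `R / n` in probability. Here `R`, of order `min
{K, lam^{-1/(2m)}}`, bounds the squared norm of point evaluation in the penalized norm
(`exists_spline_eval_bound`). The random tuning parameter is handled by a bound uniform in `α`,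
obtained from the derivative in `α` (`exists_uniform_sq_bound`). (ii) An approximation error of
order `sup |s - g₀|` times `‖β‖`. (iii) A quadratic form in the second derivatives of the loss. Only
their means are positive, at least `(1 + α₀) c₀`. The centered part has squared Frobenius norm of
order `R² / n ≤ const * K² / n → 0`. Empirical and `L²` norms of splines are comparable by the
design condition (`exists_spline_empirical_bound`). (iv) The penalty, whose square supplies the
missing part of `‖β‖²` and whose cross term is of order `√(min {lam² K^{2m}, lam}) ‖β‖`
(`exists_penalty_cross_bound`). The linear terms are thus of order `√r ‖β‖`, and the quadratic gain
`c ‖β‖²` beats them once `H` is large. The expansion is legitimate because splines on the sphere are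
uniformly small: their squared supremum is at most `R H² r`, and `K r → 0`.

All regularity of the loss comes from the exponential form. The function `b` is a cumulant
generating function, finite everywhere, hence analytic. Bounded densities together with a shift of
`θ` by `±1` force `f_θ(y) ≤ C exp(-|y|)` for bounded `θ`, so powers of `f_θ` dominate all polynomial
and logarithmic factors. -/

/-- Equivalence of norms in finite dimension: the integral is a positive definite quadratic form `Q`
in the coefficients, so it has a positive minimum on the unit sphere of the sup norm, and
homogeneity does the rest. -/
lemma exists_coeff_bound (d : ℕ) : ∃ C : ℝ, 0 < C ∧ ∀ q : Polynomial ℝ, q.natDegree ≤ d →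
    ∀ i, q.coeff i ^ 2 ≤ C * ∫ s in (0 : ℝ)..1, q.eval s ^ 2 := by
  classical
  let P : (Fin (d + 1) → ℝ) → ℝ → ℝ := fun a s => ∑ i, a i * s ^ (i : ℕ)
  let Q : (Fin (d + 1) → ℝ) → ℝ := fun a => ∫ s in (0 : ℝ)..1, P a s ^ 2
  have hPc : ∀ a, Continuous (P a) := fun a => by fun_prop
  have hQ : ∀ a, Q a = ∑ i : Fin (d + 1), ∑ k : Fin (d + 1),
      a i * a k * ∫ s in (0 : ℝ)..1, s ^ (i : ℕ) * s ^ (k : ℕ) := by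
    intro a
    have : ∀ s, P a s ^ 2 = ∑ i : Fin (d + 1), ∑ k : Fin (d + 1),
        a i * a k * (s ^ (i : ℕ) * s ^ (k : ℕ)) := by
      intro s
      simp only [P, sq, Finset.sum_mul_sum]
      refine Finset.sum_congr rfl fun i _ => Finset.sum_congr rfl fun k _ => by ring
    simp only [Q, this]
    rw [intervalIntegral.integral_finsetSum]
    · refine Finset.sum_congr rfl fun i _ => ?_
      rw [intervalIntegral.integral_finsetSum]
      · refine Finset.sum_congr rfl fun k _ => ?_
        rw [intervalIntegral.integral_const_mul]
      · intro k _
        exact Continuous.intervalIntegrable (by fun_prop) _ _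
    · intro k _
      exact Continuous.intervalIntegrable (by fun_prop) _ _
  have hQc : Continuous Q := by
    have : Q = fun a => ∑ i : Fin (d + 1), ∑ k : Fin (d + 1),
      a i * a k * ∫ s in (0 : ℝ)..1, s ^ (i : ℕ) * s ^ (k : ℕ) := funext hQ
    rw [this]
    fun_prop
  have hpos : ∀ a, a ≠ 0 → 0 < Q a := by
    intro a ha
    refine intervalIntegral.integral_pos one_pos (by fun_prop) (fun _ _ => sq_nonneg _) ?_
    by_contra! hcon
    have hz : ∀ s ∈ Icc (0 : ℝ) 1, P a s = 0 := fun s hs =>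
      pow_eq_zero_iff (two_ne_zero) |>.1 (le_antisymm (hcon s hs) (sq_nonneg _))
    let q : Polynomial ℝ := ∑ i : Fin (d + 1), Polynomial.C (a i) * Polynomial.X ^ (i : ℕ)
    have hq : q = 0 := by
      refine Polynomial.eq_zero_of_infinite_isRoot q ?_
      refine Set.Infinite.mono (s := Icc (0 : ℝ) 1) ?_ (Icc_infinite one_pos)
      intro s hs
      have := hz s hs
      simpa [Polynomial.IsRoot, q, Polynomial.eval_finsetSum, P] using this
    apply ha
    funext i
    have := congrArg (fun r => r.coeff (i : ℕ)) hq
    simp only [q, Polynomial.finsetSum_coeff, Polynomial.coeff_C_mul, Polynomial.coeff_X_pow,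
      Polynomial.coeff_zero] at this
    rw [Finset.sum_eq_single i] at this
    · simpa using this
    · intro k _ hk
      have : (i : ℕ) ≠ k := fun h => hk (Fin.ext h.symm)
      simp [this]
    · simp
  obtain ⟨c, hc, hcQ⟩ : ∃ c > 0, ∀ a : Fin (d + 1) → ℝ, ‖a‖ = 1 → c ≤ Q a := by
    have hcomp : IsCompact (Metric.sphere (0 : Fin (d + 1) → ℝ) 1) := isCompact_sphere _ _
    obtain ⟨a, ha, hmin⟩ := hcomp.exists_isMinOn (NormedSpace.sphere_nonempty.2 zero_le_one)
      hQc.continuousOn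
    refine ⟨Q a, hpos a ?_, fun a' ha' => hmin (by simpa using ha')⟩
    rintro rfl
    simp at ha
  refine ⟨c⁻¹, inv_pos.2 hc, fun q hq i => ?_⟩
  let a : Fin (d + 1) → ℝ := fun i => q.coeff i
  have hPa : ∀ s, P a s = q.eval s := by
    intro s
    rw [Polynomial.eval_eq_sum_range' (Nat.lt_succ_of_le hq), ← Fin.sum_univ_eq_sum_range
      (fun i => q.coeff i * s ^ i)]
  have hQa : Q a = ∫ s in (0 : ℝ)..1, q.eval s ^ 2 := by simp only [Q, hPa]
  have hQ0 : 0 ≤ Q a :=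
    intervalIntegral.integral_nonneg zero_le_one fun _ _ => sq_nonneg _
  have hmain : ‖a‖ ^ 2 ≤ c⁻¹ * Q a := by
    by_cases ha : a = 0
    · rw [ha, norm_zero]
      rw [ha] at hQ0
      simpa using mul_nonneg (inv_pos.2 hc).le hQ0
    · have hn : 0 < ‖a‖ := norm_pos_iff.2 ha
      have h1 := hcQ (‖a‖⁻¹ • a) (by rw [norm_smul, norm_inv, norm_norm, inv_mul_cancel₀ hn.ne'])
      have h2 : Q (‖a‖⁻¹ • a) = (‖a‖⁻¹) ^ 2 * Q a := by
        simp only [hQ, Finset.mul_sum, Pi.smul_apply, smul_eq_mul]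
        refine Finset.sum_congr rfl fun i _ => Finset.sum_congr rfl fun k _ => by ring
      rw [h2, inv_pow, inv_mul_eq_div, le_div_iff₀ (by positivity)] at h1
      rw [inv_mul_eq_div, le_div_iff₀ hc]
      linarith
  rw [← hQa]
  refine le_trans ?_ hmain
  by_cases hi : i < d + 1
  · have := norm_le_pi_norm a ⟨i, hi⟩
    rw [← sq_abs]
    exact pow_le_pow_left₀ (abs_nonneg _) this 2
  · rw [Polynomial.coeff_eq_zero_of_natDegree_lt (by omega)]
    simp only [ne_eq, OfNat.ofNat_ne_zero, not_false_eq_true, zero_pow]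
    positivity

lemma Polynomial.eval_sq_le_of_coeff_sq_le {d : ℕ} {q : Polynomial ℝ} (hq : q.natDegree ≤ d)
    {A : ℝ} (hA : ∀ i, q.coeff i ^ 2 ≤ A) {s : ℝ} (hs : s ∈ Icc (0 : ℝ) 1) :
    q.eval s ^ 2 ≤ (d + 1) ^ 2 * A := by
  have hA0 : 0 ≤ A := (sq_nonneg _).trans (hA 0)
  have h1 : |q.eval s| ≤ (d + 1) * √A := by
    rw [Polynomial.eval_eq_sum_range' (Nat.lt_succ_of_le hq)]
    refine (Finset.abs_sum_le_sum_abs _ _).trans ?_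
    refine (Finset.sum_le_sum (g := fun _ => √A) fun i _ => ?_).trans (by simp)
    rw [abs_mul, abs_of_nonneg (pow_nonneg hs.1 i)]
    refine (mul_le_of_le_one_right (abs_nonneg _) (pow_le_one₀ hs.1 hs.2)).trans ?_
    exact Real.abs_le_sqrt (hA i)
  calc q.eval s ^ 2 = |q.eval s| ^ 2 := (sq_abs _).symm
    _ ≤ ((d + 1) * √A) ^ 2 := pow_le_pow_left₀ (abs_nonneg _) h1 2
    _ = _ := by rw [mul_pow, Real.sq_sqrt hA0]

/-- Nikolskii and Markov type inequalities for polynomials of bounded degree on `[u, v]`. -/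
lemma exists_polynomial_bound (d : ℕ) : ∃ C : ℝ, 0 < C ∧ ∀ q : Polynomial ℝ, q.natDegree ≤ d →
    ∀ u v : ℝ, u < v →
      (∀ t ∈ Icc u v, q.eval t ^ 2 * (v - u) ≤ C * ∫ s in u..v, q.eval s ^ 2) ∧
      (∫ s in u..v, q.derivative.eval s ^ 2) * (v - u) ^ 2 ≤ C * ∫ s in u..v, q.eval s ^ 2 := by
  obtain ⟨C, hC, hCb⟩ := exists_coeff_bound d
  -- One factor `(d + 1)²` comes from evaluating a polynomial with bounded coefficients; the other
  -- comes from differentiating the coefficients, and the first claim does not need it.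
  refine ⟨(d + 1) ^ 4 * C, by positivity, fun q hq u v huv => ?_⟩
  have hvu : 0 < v - u := sub_pos.2 huv
  -- Rescaling to `[0, 1]`; the powers of `v - u` in the claims are those of the affine change of
  -- variable.
  let Q : Polynomial ℝ := q.comp (Polynomial.C (v - u) * Polynomial.X + Polynomial.C u)
  have hQe : ∀ s, Q.eval s = q.eval ((v - u) * s + u) := fun s => by simp [Q]
  have hQ'e : ∀ s, Q.derivative.eval s = (v - u) * q.derivative.eval ((v - u) * s + u) := fun s => by
    simp [Q, Polynomial.derivative_comp]
  have hQd : Q.natDegree ≤ d := by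
    refine Polynomial.natDegree_comp_le.trans ?_
    have : (Polynomial.C (v - u) * Polynomial.X + Polynomial.C u).natDegree ≤ 1 :=
      Polynomial.natDegree_linear_le
    calc _ ≤ d * 1 := Nat.mul_le_mul hq this
      _ = d := mul_one d
  have hsub : ∀ f : ℝ → ℝ, (v - u) * ∫ s in (0 : ℝ)..1, f ((v - u) * s + u) = ∫ s in u..v, f s := by
    intro f
    simp
  have hI : (v - u) * ∫ s in (0 : ℝ)..1, Q.eval s ^ 2 = ∫ s in u..v, q.eval s ^ 2 := by
    simp only [hQe]
    exact hsub fun s => q.eval s ^ 2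
  have hI0 : 0 ≤ ∫ s in (0 : ℝ)..1, Q.eval s ^ 2 :=
    intervalIntegral.integral_nonneg zero_le_one fun _ _ => sq_nonneg _
  have hd1 : (1 : ℝ) ≤ (d + 1) ^ 2 := one_le_pow₀ (by linarith [Nat.cast_nonneg (α := ℝ) d])
  have hcoef := hCb Q hQd
  constructor
  · intro t ht
    have hs : (t - u) / (v - u) ∈ Icc (0 : ℝ) 1 :=
      ⟨div_nonneg (by linarith [ht.1]) hvu.le, (div_le_one hvu).2 (by linarith [ht.2])⟩
    have h1 := Polynomial.eval_sq_le_of_coeff_sq_le hQd hcoef hs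
    rw [hQe, mul_div_cancel₀ _ hvu.ne', sub_add_cancel] at h1
    rw [← hI]
    calc q.eval t ^ 2 * (v - u)
        ≤ ((d + 1) ^ 2 * (C * ∫ s in (0 : ℝ)..1, Q.eval s ^ 2)) * (v - u) := by gcongr
      _ ≤ ((d + 1) ^ 2 * (d + 1) ^ 2 * (C * ∫ s in (0 : ℝ)..1, Q.eval s ^ 2)) * (v - u) := by
          have : 0 ≤ C * ∫ s in (0 : ℝ)..1, Q.eval s ^ 2 := by positivity
          gcongr
          nlinarith
      _ = _ := by ring
  · have hQ'd : Q.derivative.natDegree ≤ d := (Polynomial.natDegree_derivative_le Q).trans (by omega)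
    have hcoef' : ∀ i, Q.derivative.coeff i ^ 2 ≤
        (d + 1) ^ 2 * (C * ∫ s in (0 : ℝ)..1, Q.eval s ^ 2) := by
      intro i
      have h0 : 0 ≤ C * ∫ s in (0 : ℝ)..1, Q.eval s ^ 2 := by positivity
      rw [Polynomial.coeff_derivative, mul_pow, mul_comm]
      by_cases hi : i ≤ d
      · have : (i : ℝ) ≤ d := by exact_mod_cast hi
        gcongr
        exact hcoef _
      · rw [Polynomial.coeff_eq_zero_of_natDegree_lt (by omega)]
        simp only [ne_eq, OfNat.ofNat_ne_zero, not_false_eq_true, zero_pow, mul_zero]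
        positivity
    have h2 : ∫ s in (0 : ℝ)..1, Q.derivative.eval s ^ 2 ≤
        (d + 1) ^ 2 * ((d + 1) ^ 2 * (C * ∫ s in (0 : ℝ)..1, Q.eval s ^ 2)) := by
      calc _ ≤ ∫ _ in (0 : ℝ)..1, (d + 1 : ℝ) ^ 2 * ((d + 1) ^ 2 *
            (C * ∫ s in (0 : ℝ)..1, Q.eval s ^ 2)) := by
            refine intervalIntegral.integral_mono_on zero_le_one
              (Continuous.intervalIntegrable (by fun_prop) _ _) (by simp) fun s hs => ?_
            exact Polynomial.eval_sq_le_of_coeff_sq_le hQ'd hcoef' hs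
        _ = _ := by simp
    have h3 : (∫ s in u..v, q.derivative.eval s ^ 2) * (v - u) ^ 2 =
        (v - u) * ∫ s in (0 : ℝ)..1, Q.derivative.eval s ^ 2 := by
      rw [← hsub fun s => q.derivative.eval s ^ 2]
      simp only [hQ'e, mul_pow, intervalIntegral.integral_const_mul]
      ring
    rw [h3, ← hI]
    calc _ ≤ (v - u) * ((d + 1) ^ 2 * ((d + 1) ^ 2 * (C * ∫ s in (0 : ℝ)..1, Q.eval s ^ 2))) := by
          gcongr
      _ = _ := by ring

/-- Iterated version of the Markov inequality. -/
lemma exists_polynomial_iterate_derivative_bound (d r : ℕ) : ∃ C : ℝ, 0 < C ∧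
    ∀ q : Polynomial ℝ, q.natDegree ≤ d → ∀ u v : ℝ, u < v →
      (∫ s in u..v, (Polynomial.derivative^[r] q).eval s ^ 2) * (v - u) ^ (2 * r) ≤
        C * ∫ s in u..v, q.eval s ^ 2 := by
  obtain ⟨C, hC, hCb⟩ := exists_polynomial_bound d
  refine ⟨C ^ r, by positivity, fun q hq u v huv => ?_⟩
  have hvu : 0 < v - u := sub_pos.2 huv
  induction r with
  | zero => simp
  | succ r ih =>
    rw [Function.iterate_succ_apply']
    have hd : (Polynomial.derivative^[r] q).natDegree ≤ d :=
      (Polynomial.natDegree_iterate_derivative q r).trans (by omega)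
    have h1 := (hCb _ hd u v huv).2
    calc _ = ((∫ s in u..v, (Polynomial.derivative (Polynomial.derivative^[r] q)).eval s ^ 2) *
          (v - u) ^ 2) * (v - u) ^ (2 * r) := by ring
      _ ≤ (C * ∫ s in u..v, (Polynomial.derivative^[r] q).eval s ^ 2) * (v - u) ^ (2 * r) := by
          gcongr
      _ = C * ((∫ s in u..v, (Polynomial.derivative^[r] q).eval s ^ 2) * (v - u) ^ (2 * r)) := by
          ring
      _ ≤ C * (C ^ r * ∫ s in u..v, q.eval s ^ 2) := by gcongr
      _ = _ := by ring

/-! ### Piecewise polynomials and splines -/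

namespace IsKnotSeq

variable {K : ℕ} {x : ℕ → ℝ}

lemma mono (hx : IsKnotSeq K x) {i k : ℕ} (hik : i ≤ k) (hk : k ≤ K + 1) : x i ≤ x k := by
  induction k, hik using Nat.le_induction with
  | base => exact le_rfl
  | succ k _ ih => exact (ih (by omega)).trans (hx.2.2 k (by omega)).le

lemma mem_Icc (hx : IsKnotSeq K x) {i : ℕ} (hi : i ≤ K + 1) : x i ∈ Icc (0 : ℝ) 1 :=
  ⟨hx.1 ▸ hx.mono (Nat.zero_le i) hi, hx.2.1 ▸ hx.mono hi le_rfl⟩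

lemma Icc_subset (hx : IsKnotSeq K x) {i : ℕ} (hi : i ≤ K) :
    Icc (x i) (x (i + 1)) ⊆ Icc (0 : ℝ) 1 :=
  Icc_subset_Icc (hx.mem_Icc (by omega)).1 (hx.mem_Icc (by omega)).2

lemma exists_mem_Icc (hx : IsKnotSeq K x) {t : ℝ} (ht : t ∈ Icc (0 : ℝ) 1) :
    ∃ i ≤ K, t ∈ Icc (x i) (x (i + 1)) := by
  have h : ∀ k ≤ K, t ≤ x (k + 1) → ∃ i ≤ K, t ∈ Icc (x i) (x (i + 1)) := by
    intro k
    induction k with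
    | zero => exact fun _ h => ⟨0, Nat.zero_le _, by rw [hx.1]; exact ht.1, h⟩
    | succ k ih =>
      intro hk h
      by_cases hkt : t ≤ x (k + 1)
      · exact ih (by omega) hkt
      · exact ⟨k + 1, hk, (not_le.1 hkt).le, h⟩
  exact h K le_rfl (hx.2.1 ▸ ht.2)

lemma exists_mem_Ioo (hx : IsKnotSeq K x) {t : ℝ} (ht : t ∈ Icc (0 : ℝ) 1) (htx : t ∉ range x) :
    ∃ i ≤ K, t ∈ Ioo (x i) (x (i + 1)) := by
  obtain ⟨i, hi, h⟩ := hx.exists_mem_Icc ht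
  exact ⟨i, hi, h.1.lt_of_ne fun h' => htx ⟨i, h'⟩, h.2.lt_of_ne fun h' => htx ⟨i + 1, h'.symm⟩⟩

lemma integral_congr (hx : IsKnotSeq K x) {f g : ℝ → ℝ}
    (h : ∀ i ≤ K, ∀ t ∈ Ioo (x i) (x (i + 1)), f t = g t) :
    ∫ t in (0 : ℝ)..1, f t = ∫ t in (0 : ℝ)..1, g t := by
  refine intervalIntegral.integral_congr_ae ?_
  -- The range also contains the irrelevant values beyond `K + 1`; being countable, it is null all
  -- the same.
  have : ∀ᵐ t : ℝ, t ∉ range x := (countable_range x).ae_notMem _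
  filter_upwards [this] with t ht htI
  rw [uIoc_of_le zero_le_one] at htI
  obtain ⟨i, hi, hti⟩ := hx.exists_mem_Ioo ⟨htI.1.le, htI.2⟩ ht
  exact h i hi t hti

lemma sum_sub (hx : IsKnotSeq K x) : ∑ i ∈ Finset.range (K + 1), (x (i + 1) - x i) = 1 := by
  rw [Finset.sum_range_sub, hx.1, hx.2.1, sub_zero]

/-- The `K + 1` mesh widths sum to `1` and are comparable up to `M`, so each has order `1 / (K +
1)`; here the lower bound, in `mesh_le` the upper one. -/
lemma one_le_mesh (hx : IsKnotSeq K x) {M : ℝ}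
    (hM : ∀ i ≤ K, ∀ k ≤ K, x (i + 1) - x i ≤ M * (x (k + 1) - x k)) {k : ℕ} (hk : k ≤ K) :
    1 ≤ M * (K + 1) * (x (k + 1) - x k) := by
  calc (1 : ℝ) = ∑ i ∈ Finset.range (K + 1), (x (i + 1) - x i) := hx.sum_sub.symm
    _ ≤ ∑ i ∈ Finset.range (K + 1), M * (x (k + 1) - x k) :=
        Finset.sum_le_sum fun i hi => hM i (Nat.lt_succ_iff.1 (Finset.mem_range.1 hi)) k hk
    _ = _ := by rw [Finset.sum_const, Finset.card_range, nsmul_eq_mul]; push_cast; ring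

lemma mesh_le (hx : IsKnotSeq K x) {M : ℝ}
    (hM : ∀ i ≤ K, ∀ k ≤ K, x (i + 1) - x i ≤ M * (x (k + 1) - x k)) {k : ℕ} (hk : k ≤ K) :
    (K + 1) * (x (k + 1) - x k) ≤ M := by
  calc (K + 1) * (x (k + 1) - x k) = ∑ i ∈ Finset.range (K + 1), (x (k + 1) - x k) := by
        rw [Finset.sum_const, Finset.card_range, nsmul_eq_mul]; push_cast; ring
    _ ≤ ∑ i ∈ Finset.range (K + 1), M * (x (i + 1) - x i) :=
        Finset.sum_le_sum fun i hi => hM k hk i (Nat.lt_succ_iff.1 (Finset.mem_range.1 hi))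
    _ = M := by rw [← Finset.mul_sum, hx.sum_sub, mul_one]

lemma one_le_ratio (hx : IsKnotSeq K x) {M : ℝ}
    (hM : ∀ i ≤ K, ∀ k ≤ K, x (i + 1) - x i ≤ M * (x (k + 1) - x k)) : 1 ≤ M := by
  have h0 := hx.2.2 0 (Nat.zero_le _)
  have h := hM 0 (Nat.zero_le _) 0 (Nat.zero_le _)
  by_contra! hlt
  nlinarith

end IsKnotSeq

/-- Functions that agree with a polynomial strictly between consecutive knots. -/
def IsPiecewisePoly (K : ℕ) (x : ℕ → ℝ) (f : ℝ → ℝ) : Prop :=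
  ∀ i ≤ K, ∃ q : Polynomial ℝ, ∀ t ∈ Ioo (x i) (x (i + 1)), f t = q.eval t

namespace IsPiecewisePoly

variable {K : ℕ} {x : ℕ → ℝ} {f g : ℝ → ℝ}

lemma mul (hf : IsPiecewisePoly K x f) (hg : IsPiecewisePoly K x g) :
    IsPiecewisePoly K x fun t => f t * g t := by
  intro i hi
  obtain ⟨q, hq⟩ := hf i hi
  obtain ⟨r, hr⟩ := hg i hi
  exact ⟨q * r, fun t ht => by simp only [hq t ht, hr t ht, Polynomial.eval_mul]⟩

lemma sq (hf : IsPiecewisePoly K x f) : IsPiecewisePoly K x fun t => f t ^ 2 := by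
  simpa only [pow_two] using hf.mul hf

lemma intervalIntegrable_piece (hf : IsPiecewisePoly K x f) (hx : IsKnotSeq K x) {i : ℕ}
    (hi : i ≤ K) : IntervalIntegrable f volume (x i) (x (i + 1)) := by
  obtain ⟨q, hq⟩ := hf i hi
  have h1 : IntervalIntegrable (fun t => q.eval t) volume (x i) (x (i + 1)) :=
    Continuous.intervalIntegrable (by fun_prop) _ _
  rw [intervalIntegrable_iff_integrableOn_Ioo_of_le (hx.2.2 i hi).le] at h1 ⊢
  exact h1.congr_fun (fun t ht => (hq t ht).symm) measurableSet_Ioo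

lemma intervalIntegrable (hf : IsPiecewisePoly K x f) (hx : IsKnotSeq K x) :
    IntervalIntegrable f volume 0 1 := by
  have := IntervalIntegrable.trans_iterate (a := x) (n := K + 1) (f := f) (μ := volume)
    fun i hi => hf.intervalIntegrable_piece hx (Nat.lt_succ_iff.1 hi)
  rwa [hx.1, hx.2.1] at this

lemma integral_eq_sum (hf : IsPiecewisePoly K x f) (hx : IsKnotSeq K x) :
    ∫ t in (0 : ℝ)..1, f t = ∑ i ∈ Finset.range (K + 1), ∫ t in (x i)..(x (i + 1)), f t := by
  rw [intervalIntegral.sum_integral_adjacent_intervals (a := x)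
    fun i hi => hf.intervalIntegrable_piece hx (Nat.lt_succ_iff.1 hi), hx.1, hx.2.1]

end IsPiecewisePoly

lemma intervalIntegral_congr_Ioo {f g : ℝ → ℝ} {a b : ℝ} (hab : a ≤ b)
    (h : ∀ t ∈ Ioo a b, f t = g t) : ∫ t in a..b, f t = ∫ t in a..b, g t := by
  rw [intervalIntegral.integral_of_le hab, intervalIntegral.integral_of_le hab,
    integral_Ioc_eq_integral_Ioo, integral_Ioc_eq_integral_Ioo]
  exact setIntegral_congr_fun measurableSet_Ioo h

lemma sqNorm_nonneg (g : ℝ → ℝ) : 0 ≤ sqNorm g :=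
  intervalIntegral.integral_nonneg zero_le_one fun _ _ => sq_nonneg _

lemma Polynomial.iteratedDeriv_eval (q : Polynomial ℝ) (r : ℕ) :
    iteratedDeriv r (fun t => q.eval t) = fun t => (Polynomial.derivative^[r] q).eval t := by
  induction r with
  | zero => simp
  | succ r ih =>
    rw [iteratedDeriv_succ, ih, Function.iterate_succ_apply']
    funext t
    exact Polynomial.deriv _

lemma contDiff_polynomial_eval (q : Polynomial ℝ) {n : WithTop ℕ∞} :
    ContDiff ℝ n fun t => q.eval t := by
  simpa using q.contDiff_aeval (𝕜 := ℝ) n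

namespace IsSpline

variable {p K : ℕ} {x : ℕ → ℝ} {s h : ℝ → ℝ}

/-- Derivatives are compared on open pieces only: at knots they may not exist, and outside `[0, 1]`
a spline is arbitrary. -/
lemma exists_piece (hs : IsSpline p K x s) {i : ℕ} (hi : i ≤ K) :
    ∃ q : Polynomial ℝ, q.natDegree ≤ p - 1 ∧ (∀ t ∈ Icc (x i) (x (i + 1)), s t = q.eval t) ∧
      ∀ r, ∀ t ∈ Ioo (x i) (x (i + 1)),
        iteratedDeriv r s t = (Polynomial.derivative^[r] q).eval t := by
  obtain ⟨q, hq, hqs⟩ := hs.2 i hi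
  refine ⟨q, hq, hqs, fun r t ht => ?_⟩
  have : s =ᶠ[𝓝 t] fun t => q.eval t := by
    filter_upwards [isOpen_Ioo.mem_nhds ht] with t' ht'
    exact hqs t' (Ioo_subset_Icc_self ht')
  rw [(this.iteratedDeriv_eq r), Polynomial.iteratedDeriv_eval]

lemma isPiecewisePoly_iteratedDeriv (hs : IsSpline p K x s) (r : ℕ) :
    IsPiecewisePoly K x (iteratedDeriv r s) := by
  intro i hi
  obtain ⟨q, -, -, hq⟩ := hs.exists_piece hi
  exact ⟨_, hq r⟩

lemma isPiecewisePoly (hs : IsSpline p K x s) : IsPiecewisePoly K x s := by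
  simpa using hs.isPiecewisePoly_iteratedDeriv 0

lemma contDiffAt (hs : IsSpline p K x s) {i : ℕ} (hi : i ≤ K) {t : ℝ}
    (ht : t ∈ Ioo (x i) (x (i + 1))) (n : WithTop ℕ∞) : ContDiffAt ℝ n s t := by
  obtain ⟨q, -, hqs⟩ := hs.2 i hi
  have : s =ᶠ[𝓝 t] fun t => q.eval t := by
    filter_upwards [isOpen_Ioo.mem_nhds ht] with t' ht'
    exact hqs t' (Ioo_subset_Icc_self ht')
  exact ContDiffAt.congr_of_eventuallyEq (contDiff_polynomial_eval q).contDiffAt this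

lemma congr (hs : IsSpline p K x s) (hx : IsKnotSeq K x) (hsh : ∀ t ∈ Icc (0 : ℝ) 1, h t = s t) :
    IsSpline p K x h := by
  refine ⟨hs.1.congr hsh, fun i hi => ?_⟩
  obtain ⟨q, hq, hqs⟩ := hs.2 i hi
  exact ⟨q, hq, fun t ht => (hsh t (hx.Icc_subset hi ht)).trans (hqs t ht)⟩

lemma add (hs : IsSpline p K x s) (hh : IsSpline p K x h) :
    IsSpline p K x fun t => s t + h t := by
  refine ⟨hs.1.add hh.1, fun i hi => ?_⟩
  obtain ⟨q, hq, hqs⟩ := hs.2 i hi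
  obtain ⟨r, hr, hrs⟩ := hh.2 i hi
  refine ⟨q + r, (Polynomial.natDegree_add_le _ _).trans (max_le hq hr), fun t ht => ?_⟩
  simp only [hqs t ht, hrs t ht, Polynomial.eval_add]

lemma const_mul (hs : IsSpline p K x s) (c : ℝ) : IsSpline p K x fun t => c * s t := by
  refine ⟨contDiffOn_const.mul hs.1, fun i hi => ?_⟩
  obtain ⟨q, hq, hqs⟩ := hs.2 i hi
  refine ⟨Polynomial.C c * q, (Polynomial.natDegree_C_mul_le _ _).trans hq, fun t ht => ?_⟩
  simp only [hqs t ht, Polynomial.eval_mul, Polynomial.eval_C]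

lemma of_polynomial (q : Polynomial ℝ) (hq : q.natDegree ≤ p - 1) :
    IsSpline p K x fun t => q.eval t :=
  ⟨(contDiff_polynomial_eval q).contDiffOn, fun _ _ => ⟨q, hq, fun _ _ => rfl⟩⟩

lemma zero : IsSpline p K x fun _ => 0 := by
  simpa using of_polynomial (p := p) (K := K) (x := x) 0 (by simp)

lemma sum {ι : Type*} (I : Finset ι) {f : ι → ℝ → ℝ} (hf : ∀ i ∈ I, IsSpline p K x (f i)) :
    IsSpline p K x fun t => ∑ i ∈ I, f i t := by
  classical
  induction I using Finset.induction_on with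
  | empty => simpa using zero
  | insert a I ha ih =>
    simp only [Finset.sum_insert ha]
    exact (hf a (by simp)).add (ih fun i hi => hf i (by simp [hi]))

lemma iteratedDeriv_add (hs : IsSpline p K x s) (hh : IsSpline p K x h) (r : ℕ) {i : ℕ}
    (hi : i ≤ K) {t : ℝ} (ht : t ∈ Ioo (x i) (x (i + 1))) :
    iteratedDeriv r (fun t => s t + h t) t = iteratedDeriv r s t + iteratedDeriv r h t :=
  iteratedDeriv_fun_add (hs.contDiffAt hi ht _) (hh.contDiffAt hi ht _)

lemma iteratedDeriv_const_mul (hs : IsSpline p K x s) (c : ℝ) (r : ℕ) {i : ℕ}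
    (hi : i ≤ K) {t : ℝ} (ht : t ∈ Ioo (x i) (x (i + 1))) :
    iteratedDeriv r (fun t => c * s t) t = c * iteratedDeriv r s t :=
  _root_.iteratedDeriv_const_mul c (hs.contDiffAt hi ht _)

lemma iteratedDeriv_congr (hx : IsKnotSeq K x) (hsh : ∀ t ∈ Icc (0 : ℝ) 1, s t = h t) (r : ℕ) {i : ℕ}
    (hi : i ≤ K) {t : ℝ} (ht : t ∈ Ioo (x i) (x (i + 1))) :
    iteratedDeriv r s t = iteratedDeriv r h t := by
  refine Filter.EventuallyEq.iteratedDeriv_eq r ?_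
  filter_upwards [isOpen_Ioo.mem_nhds ht] with t' ht'
  exact hsh t' (hx.Icc_subset hi (Ioo_subset_Icc_self ht'))

end IsSpline

/-! ### Supremum and inverse inequalities for splines. -/

/-- The polynomial inequality on the piece containing `t` loses one inverse mesh width, which is at
most `M (K + 1)`. The maximum with `1` only keeps the constant positive when `M < 1`, where no knot
sequence qualifies. -/
lemma exists_spline_sup_bound (p : ℕ) (M : ℝ) : ∃ C : ℝ, 0 < C ∧ ∀ (K : ℕ) (x : ℕ → ℝ),
    IsKnotSeq K x → (∀ i ≤ K, ∀ k ≤ K, x (i + 1) - x i ≤ M * (x (k + 1) - x k)) →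
    ∀ h, IsSpline p K x h → ∀ t ∈ Icc (0 : ℝ) 1, h t ^ 2 ≤ C * (K + 1) * sqNorm h := by
  obtain ⟨C, hC, hCb⟩ := exists_polynomial_bound (p - 1)
  refine ⟨C * max M 1, by positivity, fun K x hx hM h hh t ht => ?_⟩
  have hM1 := hx.one_le_ratio hM
  rw [max_eq_left hM1]
  obtain ⟨i, hi, hti⟩ := hx.exists_mem_Icc ht
  obtain ⟨q, hq, hqh⟩ := hh.2 i hi
  have h1 := (hCb q hq _ _ (hx.2.2 i hi)).1 t hti
  have e1 := intervalIntegral_congr_Ioo (f := fun s => h s ^ 2) (g := fun s => q.eval s ^ 2)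
    (hx.2.2 i hi).le (fun s hs => by rw [hqh s (Ioo_subset_Icc_self hs)])
  rw [← hqh t hti, ← e1] at h1
  have h2 : ∫ s in (x i)..(x (i + 1)), h s ^ 2 ≤ sqNorm h := by
    rw [sqNorm, hh.isPiecewisePoly.sq.integral_eq_sum hx]
    refine Finset.single_le_sum (f := fun i => ∫ s in (x i)..(x (i + 1)), h s ^ 2)
      (fun k hk => ?_) (Finset.mem_range.2 (Nat.lt_succ_iff.2 hi))
    exact intervalIntegral.integral_nonneg (hx.2.2 k (Nat.lt_succ_iff.1 (Finset.mem_range.1 hk))).le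
      fun _ _ => sq_nonneg _
  have h3 := hx.one_le_mesh hM hi
  have h4 : 0 < x (i + 1) - x i := sub_pos.2 (hx.2.2 i hi)
  calc h t ^ 2 ≤ h t ^ 2 * (M * (K + 1) * (x (i + 1) - x i)) :=
        le_mul_of_one_le_right (sq_nonneg _) h3
    _ = M * (K + 1) * (h t ^ 2 * (x (i + 1) - x i)) := by ring
    _ ≤ M * (K + 1) * (C * sqNorm h) := by
        have hM0 : 0 ≤ M := by linarith
        exact mul_le_mul_of_nonneg_left (h1.trans (mul_le_mul_of_nonneg_left h2 hC.le))
          (by positivity)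
    _ = _ := by ring

/-- The iterated Markov inequality on every piece, summed; each derivative costs one factor of order
`K + 1`. -/
lemma exists_spline_deriv_bound (p r : ℕ) (M : ℝ) : ∃ C : ℝ, 0 < C ∧ ∀ (K : ℕ) (x : ℕ → ℝ),
    IsKnotSeq K x → (∀ i ≤ K, ∀ k ≤ K, x (i + 1) - x i ≤ M * (x (k + 1) - x k)) →
    ∀ h, IsSpline p K x h → sqNorm (iteratedDeriv r h) ≤ C * (K + 1) ^ (2 * r) * sqNorm h := by
  obtain ⟨C, hC, hCb⟩ := exists_polynomial_iterate_derivative_bound (p - 1) r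
  refine ⟨C * (max M 1) ^ (2 * r), by positivity, fun K x hx hM h hh => ?_⟩
  have hM1 := hx.one_le_ratio hM
  rw [max_eq_left hM1, sqNorm, sqNorm, hh.isPiecewisePoly.sq.integral_eq_sum hx,
    (hh.isPiecewisePoly_iteratedDeriv r).sq.integral_eq_sum hx, Finset.mul_sum]
  refine Finset.sum_le_sum fun i hi => ?_
  replace hi := Nat.lt_succ_iff.1 (Finset.mem_range.1 hi)
  obtain ⟨q, hq, hqh, hqd⟩ := hh.exists_piece hi
  have h1 := hCb q hq _ _ (hx.2.2 i hi)
  have e1 := intervalIntegral_congr_Ioo (f := fun s => h s ^ 2) (g := fun s => q.eval s ^ 2)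
    (hx.2.2 i hi).le (fun s hs => by rw [hqh s (Ioo_subset_Icc_self hs)])
  have e2 := intervalIntegral_congr_Ioo (f := fun s => iteratedDeriv r h s ^ 2)
    (g := fun s => (Polynomial.derivative^[r] q).eval s ^ 2)
    (hx.2.2 i hi).le (fun s hs => by rw [hqd r s hs])
  rw [← e1, ← e2] at h1
  have h3 := hx.one_le_mesh hM hi
  have h4 : 0 < x (i + 1) - x i := sub_pos.2 (hx.2.2 i hi)
  have h5 : 0 ≤ ∫ s in (x i)..(x (i + 1)), iteratedDeriv r h s ^ 2 :=
    intervalIntegral.integral_nonneg (hx.2.2 i hi).le fun _ _ => sq_nonneg _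
  calc ∫ s in (x i)..(x (i + 1)), iteratedDeriv r h s ^ 2
      ≤ (∫ s in (x i)..(x (i + 1)), iteratedDeriv r h s ^ 2) *
        (M * (K + 1) * (x (i + 1) - x i)) ^ (2 * r) :=
        le_mul_of_one_le_right h5 (one_le_pow₀ h3)
    _ = (M * (K + 1)) ^ (2 * r) * ((∫ s in (x i)..(x (i + 1)), iteratedDeriv r h s ^ 2) *
        (x (i + 1) - x i) ^ (2 * r)) := by rw [mul_pow _ (x (i + 1) - x i)]; ring
    _ ≤ (M * (K + 1)) ^ (2 * r) * (C * ∫ s in (x i)..(x (i + 1)), h s ^ 2) := by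
        gcongr
    _ = _ := by rw [mul_pow]; ring

/-! ### Taylor expansion and Sobolev inequality -/

/-- Induction with the mean value inequality: the derivative of the Taylor remainder of `F 0` is the
remainder of the shifted family. A family `F` in place of iterated derivatives makes the shift
immediate. The bound uses the oscillation of the top derivative, not a further derivative, because
the next derivative of a spline is controlled only in `L²`. -/
lemma abs_sub_taylor_le {a b : ℝ} (k : ℕ) : ∀ {F : ℕ → ℝ → ℝ},
    (∀ l < k, ∀ t ∈ Icc a b, HasDerivWithinAt (F l) (F (l + 1) t) (Icc a b) t) →
    ∀ {τ : ℝ}, τ ∈ Icc a b → ∀ {ε : ℝ}, (∀ t ∈ Icc a b, |F k t - F k τ| ≤ ε) →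
    ∀ t ∈ Icc a b,
      |F 0 t - ∑ l ∈ Finset.range (k + 1), F l τ * ((t - τ) ^ l / l.factorial)| ≤
        ε * |t - τ| ^ k := by
  induction k with
  | zero => intro F _ τ _ ε hε t ht; simpa using hε t ht
  | succ k ih =>
    intro F hF τ hτ ε hε t ht
    have hε0 : 0 ≤ ε := (abs_nonneg _).trans (hε t ht)
    have h1 := ih (F := fun l => F (l + 1)) (fun l hl => hF (l + 1) (by omega)) hτ hε
    have hsub : uIcc τ t ⊆ Icc a b := (ordConnected_Icc).uIcc_subset hτ ht
    let G : ℝ → ℝ := fun s =>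
      F 0 s - ∑ l ∈ Finset.range (k + 2), F l τ * ((s - τ) ^ l / l.factorial)
    have hG : ∀ s ∈ uIcc τ t, HasDerivWithinAt G
        (F 1 s - ∑ l ∈ Finset.range (k + 1), F (l + 1) τ * ((s - τ) ^ l / l.factorial))
        (uIcc τ t) s := by
      intro s hs
      refine ((hF 0 (by omega) s (hsub hs)).mono hsub).sub ?_
      have h2 : (fun s => ∑ l ∈ Finset.range (k + 2), F l τ * ((s - τ) ^ l / l.factorial)) =
          fun s => ∑ l ∈ Finset.range (k + 1),
            F (l + 1) τ * ((s - τ) ^ (l + 1) / (l + 1).factorial) + F 0 τ := by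
        funext s
        rw [Finset.sum_range_succ']
        simp
      rw [h2]
      refine (HasDerivAt.add_const _ (HasDerivAt.fun_sum fun l _ => ?_)).hasDerivWithinAt
      have h3 : HasDerivAt (fun s : ℝ => (s - τ) ^ (l + 1)) ((l + 1) * (s - τ) ^ l) s := by
        simpa using ((hasDerivAt_id s).sub_const τ).fun_pow (l + 1)
      refine ((h3.div_const ((l + 1).factorial : ℝ)).const_mul (F (l + 1) τ)).congr_deriv ?_
      rw [Nat.factorial_succ]
      push_cast
      field_simp
    have hG0 : G τ = 0 := by
      simp only [G]
      rw [Finset.sum_range_succ']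
      simp
    have h4 := Convex.norm_image_sub_le_of_norm_hasDerivWithin_le (C := ε * |t - τ| ^ k) hG
      (fun s hs => by
        rw [Real.norm_eq_abs]
        refine (h1 s (hsub hs)).trans ?_
        have : |s - τ| ≤ |t - τ| := abs_sub_left_of_mem_uIcc hs
        gcongr) (convex_uIcc τ t) left_mem_uIcc right_mem_uIcc
    rw [hG0, sub_zero, Real.norm_eq_abs, Real.norm_eq_abs] at h4
    calc _ = |G t| := rfl
      _ ≤ _ := h4
      _ = _ := by ring

/-- Cauchy–Schwarz against the constant function, from the nonnegative integral of `(f - c)²` with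
`c` the mean of `f`. -/
lemma sq_intervalIntegral_le {f : ℝ → ℝ} {a b : ℝ} (hab : a ≤ b)
    (hf : IntervalIntegrable f volume a b)
    (hf2 : IntervalIntegrable (fun t => f t ^ 2) volume a b) :
    (∫ t in a..b, f t) ^ 2 ≤ (b - a) * ∫ t in a..b, f t ^ 2 := by
  rcases hab.eq_or_lt with rfl | hlt
  · simp
  have hba : 0 < b - a := sub_pos.2 hlt
  set I := ∫ t in a..b, f t with hI
  set c := I / (b - a) with hc
  have h1 : 0 ≤ ∫ t in a..b, (f t - c) ^ 2 :=
    intervalIntegral.integral_nonneg hab fun _ _ => sq_nonneg _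
  have h2 : ∫ t in a..b, (f t - c) ^ 2 =
      (∫ t in a..b, f t ^ 2) - 2 * c * I + c ^ 2 * (b - a) := by
    have : ∀ t, (f t - c) ^ 2 = f t ^ 2 - 2 * c * f t + c ^ 2 := fun t => by ring
    simp only [this]
    rw [intervalIntegral.integral_add (hf2.sub (hf.const_mul _)) (by simp),
      intervalIntegral.integral_sub hf2 (hf.const_mul _), intervalIntegral.integral_const_mul]
    simp
    ring
  have h3 : c * (b - a) = I := div_mul_cancel₀ _ hba.ne'
  rw [h2] at h1
  have h4 : 0 ≤ (∫ t in a..b, f t ^ 2) - c * I := by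
    have : c ^ 2 * (b - a) = c * I := by rw [sq, mul_assoc, h3]
    linarith
  have h5 : (b - a) * (c * I) = I ^ 2 := by rw [← mul_assoc, mul_comm (b - a), h3, sq]
  nlinarith [mul_nonneg hba.le h4]

namespace IsSpline

variable {p K : ℕ} {x : ℕ → ℝ} {s h : ℝ → ℝ}

lemma iteratedDerivWithin_eq (hs : IsSpline p K x s) (hx : IsKnotSeq K x) (r : ℕ) {i : ℕ}
    (hi : i ≤ K) {t : ℝ} (ht : t ∈ Ioo (x i) (x (i + 1))) :
    iteratedDerivWithin r s (Icc 0 1) t = iteratedDeriv r s t :=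
  iteratedDerivWithin_eq_iteratedDeriv (uniqueDiffOn_Icc zero_lt_one) (hs.contDiffAt hi ht _)
    (hx.Icc_subset hi (Ioo_subset_Icc_self ht))

/-- The fundamental theorem of calculus for the continuous derivatives of a spline. -/
lemma integral_iteratedDeriv (hs : IsSpline p K x s) (hx : IsKnotSeq K x) {r : ℕ}
    (hr : r + 2 ≤ p) {u v : ℝ} (hu : u ∈ Icc (0 : ℝ) 1) (hv : v ∈ Icc (0 : ℝ) 1) :
    ∫ t in u..v, iteratedDeriv (r + 1) s t =
      iteratedDerivWithin r s (Icc 0 1) v - iteratedDerivWithin r s (Icc 0 1) u := by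
  have hsub : uIcc u v ⊆ Icc (0 : ℝ) 1 := ordConnected_Icc.uIcc_subset hu hv
  -- The derivative of order `r ≤ p - 2` is continuous on `[0, 1]` and differentiable off the
  -- countable set of knots.
  refine MeasureTheory.integral_eq_of_hasDerivAt_off_countable _ _ (countable_range x) ?_ ?_ ?_
  · refine ContinuousOn.mono ?_ hsub
    exact hs.1.continuousOn_iteratedDerivWithin (by exact_mod_cast (by omega : r ≤ p - 2))
      (uniqueDiffOn_Icc zero_lt_one)
  · intro t ht
    have htI : t ∈ Icc (0 : ℝ) 1 := hsub (Ioo_subset_Icc_self ht.1)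
    obtain ⟨i, hi, hti⟩ := hx.exists_mem_Ioo htI ht.2
    obtain ⟨q, -, -, hq⟩ := hs.exists_piece hi
    have h1 := (Polynomial.derivative^[r] q).hasDerivAt t
    rw [← Function.iterate_succ_apply' (f := Polynomial.derivative), ← hq (r + 1) t hti] at h1
    refine h1.congr_of_eventuallyEq ?_
    filter_upwards [isOpen_Ioo.mem_nhds hti] with t' ht'
    rw [hs.iteratedDerivWithin_eq hx r hi ht', hq r t' ht']
  · exact ((hs.isPiecewisePoly_iteratedDeriv (r + 1)).intervalIntegrable hx).mono_set
      (by rw [uIcc_of_le zero_le_one]; exact hsub)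

end IsSpline

/-- A Sobolev interpolation inequality for splines. -/
lemma exists_spline_sobolev_bound (m : ℕ) (hm : 1 ≤ m) : ∃ C : ℝ, 0 < C ∧
    ∀ (p K : ℕ) (x : ℕ → ℝ), m < p → IsKnotSeq K x → ∀ h, IsSpline p K x h →
    ∀ a : ℝ, 0 < a → a ≤ 1 → ∀ t ∈ Icc (0 : ℝ) 1,
      h t ^ 2 * a ≤ C * (sqNorm h + a ^ (2 * m) * sqNorm (iteratedDeriv m h)) := by
  obtain ⟨C, hC, hCb⟩ := exists_polynomial_bound (m - 1)
  refine ⟨2 * C, by positivity, fun p K x hmp hx h hh a ha ha1 t ht => ?_⟩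
  obtain ⟨m, rfl⟩ : ∃ k, m = k + 1 := ⟨m - 1, by omega⟩
  simp only [Nat.add_sub_cancel] at hCb
  set N := sqNorm (iteratedDeriv (m + 1) h) with hN
  have hN0 : 0 ≤ N := sqNorm_nonneg _
  -- A window of length `a` inside `[0, 1]` that contains `t`, pushed left when `t` is close to `1`.
  obtain ⟨u, hu0, hu1, htu⟩ : ∃ u, 0 ≤ u ∧ u + a ≤ 1 ∧ t ∈ Icc u (u + a) := by
    refine ⟨min t (1 - a), le_min ht.1 (by linarith), by linarith [min_le_right t (1 - a)],
      min_le_left _ _, ?_⟩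
    rcases min_choice t (1 - a) with h | h <;> rw [h] <;> linarith [ht.2]
  have hsub : Icc u (u + a) ⊆ Icc (0 : ℝ) 1 := Icc_subset_Icc hu0 hu1
  let F : ℕ → ℝ → ℝ := fun l => iteratedDerivWithin l h (Icc 0 1)
  have hF : ∀ l < m, ∀ s ∈ Icc u (u + a),
      HasDerivWithinAt (F l) (F (l + 1) s) (Icc u (u + a)) s := by
    intro l hl s hs
    have hd := hh.1.differentiableOn_iteratedDerivWithin (m := l)
      (by exact_mod_cast (by omega : l < p - 2)) (uniqueDiffOn_Icc zero_lt_one) s (hsub hs)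
    have := hd.hasDerivWithinAt
    rw [← iteratedDerivWithin_succ] at this
    exact this.mono hsub
  -- The highest continuous derivative is an integral of the next one, so Cauchy–Schwarz bounds its
  -- oscillation on the window.
  have hε : ∀ s ∈ Icc u (u + a), |F m s - F m t| ≤ √(a * N) := by
    intro s hs
    rw [← hh.integral_iteratedDeriv hx (by omega) ht (hsub hs)]
    refine Real.abs_le_sqrt ?_
    have key : ∀ v w : ℝ, v ∈ Icc u (u + a) → w ∈ Icc u (u + a) → v ≤ w →
        (∫ r in v..w, iteratedDeriv (m + 1) h r) ^ 2 ≤ a * N := by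
      intro v w hv hw hvw
      have hpp := hh.isPiecewisePoly_iteratedDeriv (m + 1)
      have hsub2 : uIcc v w ⊆ uIcc (0 : ℝ) 1 := by
        rw [uIcc_of_le zero_le_one]
        exact ordConnected_Icc.uIcc_subset (hsub hv) (hsub hw)
      refine (sq_intervalIntegral_le hvw ((hpp.intervalIntegrable hx).mono_set hsub2)
        ((hpp.sq.intervalIntegrable hx).mono_set hsub2)).trans ?_
      have h1 : ∫ r in v..w, iteratedDeriv (m + 1) h r ^ 2 ≤ N :=
        intervalIntegral.integral_mono_interval (hsub hv).1 hvw (hsub hw).2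
          (Eventually.of_forall fun _ => sq_nonneg _) (hpp.sq.intervalIntegrable hx)
      have h2 : w - v ≤ a := by linarith [hv.1, hw.2]
      exact mul_le_mul h2 h1 (intervalIntegral.integral_nonneg hvw fun _ _ => sq_nonneg _) ha.le
    rcases le_total t s with hts | hts
    · exact key t s htu hs hts
    · rw [intervalIntegral.integral_symm, neg_sq]
      exact key s t hs htu hts
  have hT := abs_sub_taylor_le m hF htu hε
  -- The Taylor polynomial at `t` has the value `h t` there, so the polynomial sup bound on the
  -- window applies to it; it differs from `h` by at most `√(a N) a^m`.
  let T : Polynomial ℝ := ∑ l ∈ Finset.range (m + 1),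
    Polynomial.C (F l t / l.factorial) * (Polynomial.X - Polynomial.C t) ^ l
  have hTe : ∀ s, T.eval s = ∑ l ∈ Finset.range (m + 1), F l t * ((s - t) ^ l / l.factorial) := by
    intro s
    simp only [T, Polynomial.eval_finsetSum, Polynomial.eval_mul, Polynomial.eval_C,
      Polynomial.eval_pow, Polynomial.eval_sub, Polynomial.eval_X]
    exact Finset.sum_congr rfl fun l _ => by ring
  have hTd : T.natDegree ≤ m := by
    refine Polynomial.natDegree_sum_le_of_forall_le _ _ fun l hl => ?_
    refine (Polynomial.natDegree_C_mul_le _ _).trans ?_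
    refine Polynomial.natDegree_pow_le.trans ?_
    rw [Polynomial.natDegree_X_sub_C, mul_one]
    exact Nat.lt_succ_iff.1 (Finset.mem_range.1 hl)
  have hTt : T.eval t = h t := by
    rw [hTe, Finset.sum_range_succ']
    simp [F]
  have h1 := (hCb T hTd u (u + a) (by linarith)).1 t htu
  rw [hTt, add_sub_cancel_left] at h1
  have hpp := hh.isPiecewisePoly
  have hsub2 : uIcc u (u + a) ⊆ uIcc (0 : ℝ) 1 := by
    rw [uIcc_of_le zero_le_one, uIcc_of_le (by linarith)]
    exact hsub
  have h2 : ∫ s in u..(u + a), T.eval s ^ 2 ≤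
      ∫ s in u..(u + a), (2 * h s ^ 2 + 2 * (a * N * (a ^ m) ^ 2)) := by
    refine intervalIntegral.integral_mono_on (by linarith)
      (Continuous.intervalIntegrable (by fun_prop) _ _)
      ((((hpp.sq.intervalIntegrable hx).mono_set hsub2).const_mul 2).add (by simp))
      fun s hs => ?_
    have h3 := hT s hs
    rw [← hTe] at h3
    have h3' : F 0 s = h s := by simp [F]
    rw [h3'] at h3
    have h4 : |h s - T.eval s| ≤ √(a * N) * a ^ m := by
      refine h3.trans ?_
      have : |s - t| ≤ a := by
        rw [abs_le]
        constructor <;> linarith [hs.1, hs.2, htu.1, htu.2]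
      gcongr
    have h5 : (h s - T.eval s) ^ 2 ≤ a * N * (a ^ m) ^ 2 := by
      calc _ = |h s - T.eval s| ^ 2 := (sq_abs _).symm
        _ ≤ (√(a * N) * a ^ m) ^ 2 := pow_le_pow_left₀ (abs_nonneg _) h4 2
        _ = _ := by rw [mul_pow, Real.sq_sqrt (by positivity)]
    nlinarith [sq_nonneg (2 * h s - T.eval s)]
  have h6 : ∫ s in u..(u + a), h s ^ 2 ≤ sqNorm h :=
    intervalIntegral.integral_mono_interval hu0 (by linarith) hu1
      (Eventually.of_forall fun _ => sq_nonneg _) (hpp.sq.intervalIntegrable hx)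
  rw [intervalIntegral.integral_add (((hpp.sq.intervalIntegrable hx).mono_set hsub2).const_mul 2)
    (by simp), intervalIntegral.integral_const_mul, intervalIntegral.integral_const] at h2
  calc h t ^ 2 * a ≤ C * ∫ s in u..(u + a), T.eval s ^ 2 := h1
    _ ≤ C * (2 * sqNorm h + (u + a - u) • (2 * (a * N * (a ^ m) ^ 2))) := by
        gcongr
        exact h2.trans (by gcongr)
    _ = _ := by rw [smul_eq_mul]; ring

/-! ### Empirical norms -/

/-- Integration by parts: both averages equal `G 1` minus the integral of the respective
distribution function against `g`, so their difference is at most the uniform distance times `∫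
|g|`. The hypothesis on `G` is an integral identity because splines may have kinks. -/
lemma abs_empirical_sub_integral_le {n : ℕ} (hn : 0 < n) {t : Fin n → ℝ}
    (ht : ∀ i, t i ∈ Icc (0 : ℝ) 1) {q : ℝ → ℝ} (hq : IntervalIntegrable q volume 0 1)
    (hq1 : ∫ s in (0 : ℝ)..1, q s = 1) {η : ℝ}
    (hη : ∀ s ∈ Icc (0 : ℝ) 1, |empiricalCDF t s - ∫ r in (0 : ℝ)..s, q r| ≤ η)
    {G g : ℝ → ℝ} (hg : IntervalIntegrable g volume 0 1)
    (hGq : IntervalIntegrable (fun s => G s * q s) volume 0 1)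
    (hG : ∀ s ∈ Icc (0 : ℝ) 1, G 1 - G s = ∫ r in s..1, g r) :
    |(n : ℝ)⁻¹ * ∑ i, G (t i) - ∫ s in (0 : ℝ)..1, G s * q s| ≤
      η * ∫ s in (0 : ℝ)..1, |g s| := by
  have hn' : (n : ℝ) ≠ 0 := by exact_mod_cast hn.ne'
  have hind : ∀ r ∈ Icc (0 : ℝ) 1, ∫ s in r..1, g s =
      ∫ s in (0 : ℝ)..1, (Ici r).indicator g s := by
    intro r hr
    rw [intervalIntegral.integral_of_le zero_le_one, ← integral_Icc_eq_integral_Ioc,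
      integral_indicator measurableSet_Ici,
      intervalIntegral.integral_of_le hr.2, ← integral_Icc_eq_integral_Ioc, Measure.restrict_restrict measurableSet_Ici]
    congr 2
    ext s
    simp only [mem_Icc, mem_inter_iff, mem_Ici]
    exact ⟨fun h => ⟨h.1, hr.1.trans h.1, h.2⟩, fun h => ⟨h.1, h.2.2⟩⟩
  have hcdf : ∀ s, empiricalCDF t s = (n : ℝ)⁻¹ * ∑ i, if t i ≤ s then (1 : ℝ) else 0 := by
    intro s
    classical
    rw [empiricalCDF, Nat.card_eq_fintype_card, Fintype.card_subtype, Finset.sum_boole]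
  have hindint : ∀ r : ℝ, IntervalIntegrable ((Ici r).indicator g) volume 0 1 := by
    intro r
    rw [intervalIntegrable_iff] at hg ⊢
    exact hg.indicator measurableSet_Ici
  have h1 : (n : ℝ)⁻¹ * ∑ i, G (t i) = G 1 - ∫ s in (0 : ℝ)..1, empiricalCDF t s * g s := by
    have e1 : ∀ s, empiricalCDF t s * g s = (n : ℝ)⁻¹ * ∑ i, (Ici (t i)).indicator g s := by
      intro s
      rw [hcdf, mul_assoc, Finset.sum_mul]
      congr 1
      refine Finset.sum_congr rfl fun i _ => ?_
      simp only [indicator, mem_Ici]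
      split_ifs <;> simp
    simp only [e1]
    rw [intervalIntegral.integral_const_mul,
      intervalIntegral.integral_finsetSum fun i _ => hindint (t i)]
    have e2 : ∀ i, G (t i) = G 1 - ∫ s in (0 : ℝ)..1, (Ici (t i)).indicator g s := by
      intro i
      rw [← hind _ (ht i), ← hG _ (ht i)]
      ring
    rw [Finset.sum_congr rfl fun i _ => e2 i, Finset.sum_sub_distrib]
    simp only [Finset.sum_const, Finset.card_univ, Fintype.card_fin, nsmul_eq_mul]
    field_simp
  have hqI : IntegrableOn q (Ioc 0 1) := (intervalIntegrable_iff_integrableOn_Ioc_of_le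
    zero_le_one).1 hq
  have hgI : IntegrableOn g (Ioc 0 1) := (intervalIntegrable_iff_integrableOn_Ioc_of_le
    zero_le_one).1 hg
  -- Fubini on the triangle: integrating out the first variable leaves the distribution function
  -- times `g`, integrating out the second leaves `(G 1 - G r) q r`.
  have hprod : Integrable ({z : ℝ × ℝ | z.1 ≤ z.2}.indicator fun z => q z.1 * g z.2)
      ((volume.restrict (Ioc (0 : ℝ) 1)).prod (volume.restrict (Ioc (0 : ℝ) 1))) :=
    (Integrable.mul_prod hqI hgI).indicator (measurableSet_le measurable_fst measurable_snd)
  have hQg : ∀ s ∈ Ioc (0 : ℝ) 1, ∫ r in Ioc (0 : ℝ) 1,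
      {z : ℝ × ℝ | z.1 ≤ z.2}.indicator (fun z => q z.1 * g z.2) (r, s) =
      (∫ r in (0 : ℝ)..s, q r) * g s := by
    intro s hs
    have : ∀ r, {z : ℝ × ℝ | z.1 ≤ z.2}.indicator (fun z => q z.1 * g z.2) (r, s) =
        (Iic s).indicator q r * g s := by
      intro r
      simp only [indicator, mem_ofPred_eq, mem_Iic]
      split_ifs <;> simp
    simp only [this]
    rw [integral_mul_const, integral_indicator measurableSet_Iic,
      Measure.restrict_restrict measurableSet_Iic, intervalIntegral.integral_of_le hs.1.le]
    congr 3
    ext r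
    simp only [mem_inter_iff, mem_Iic, mem_Ioc]
    exact ⟨fun h => ⟨h.2.1, h.1⟩, fun h => ⟨h.2, h.1, h.2.trans hs.2⟩⟩
  have hGr : ∀ r ∈ Ioc (0 : ℝ) 1, ∫ s in Ioc (0 : ℝ) 1,
      {z : ℝ × ℝ | z.1 ≤ z.2}.indicator (fun z => q z.1 * g z.2) (r, s) =
      G 1 * q r - G r * q r := by
    intro r hr
    have : ∀ s, {z : ℝ × ℝ | z.1 ≤ z.2}.indicator (fun z => q z.1 * g z.2) (r, s) =
        q r * (Ici r).indicator g s := by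
      intro s
      simp only [indicator, mem_ofPred_eq, mem_Ici]
      split_ifs <;> simp
    simp only [this]
    rw [integral_const_mul, ← intervalIntegral.integral_of_le zero_le_one,
      ← hind r (Ioc_subset_Icc_self hr), ← hG r (Ioc_subset_Icc_self hr)]
    ring
  have hQgI : IntegrableOn (fun s => (∫ r in (0 : ℝ)..s, q r) * g s) (Ioc 0 1) := by
    refine Integrable.congr hprod.integral_prod_right ?_
    filter_upwards [ae_restrict_mem measurableSet_Ioc] with s hs
    exact hQg s hs
  have h2 : ∫ s in (0 : ℝ)..1, G s * q s =
      G 1 - ∫ s in (0 : ℝ)..1, (∫ r in (0 : ℝ)..s, q r) * g s := by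
    have e1 := integral_integral_swap (μ := volume.restrict (Ioc (0 : ℝ) 1))
      (ν := volume.restrict (Ioc (0 : ℝ) 1))
      (f := fun r s => {z : ℝ × ℝ | z.1 ≤ z.2}.indicator (fun z => q z.1 * g z.2) (r, s)) hprod
    rw [setIntegral_congr_fun measurableSet_Ioc hGr, setIntegral_congr_fun measurableSet_Ioc hQg,
      ← intervalIntegral.integral_of_le zero_le_one, ← intervalIntegral.integral_of_le zero_le_one,
      intervalIntegral.integral_sub (hq.const_mul _) hGq, intervalIntegral.integral_const_mul,
      hq1] at e1
    linarith
  have hEgI : IntervalIntegrable (fun s => empiricalCDF t s * g s) volume 0 1 := by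
    have e1 : (fun s => empiricalCDF t s * g s) =
        fun s => (n : ℝ)⁻¹ * ∑ i, (Ici (t i)).indicator g s := by
      funext s
      rw [hcdf, mul_assoc, Finset.sum_mul]
      congr 1
      refine Finset.sum_congr rfl fun i _ => ?_
      simp only [indicator, mem_Ici]
      split_ifs <;> simp
    rw [e1]
    refine IntervalIntegrable.const_mul ?_ _
    have := IntervalIntegrable.sum (μ := volume) (a := 0) (b := 1) Finset.univ
      (f := fun i => (Ici (t i)).indicator g) fun i _ => hindint (t i)
    simpa only [Finset.sum_fn] using this
  have hQgI' := (intervalIntegrable_iff_integrableOn_Ioc_of_le zero_le_one).2 hQgI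
  rw [h1, h2, sub_sub_sub_cancel_left, ← intervalIntegral.integral_sub hQgI' hEgI]
  rw [← intervalIntegral.integral_const_mul]
  refine (intervalIntegral.abs_integral_le_integral_abs zero_le_one).trans ?_
  refine intervalIntegral.integral_mono_on zero_le_one (hQgI'.sub hEgI).abs
    (hg.abs.const_mul _) fun s hs => ?_
  rw [← sub_mul, abs_mul, abs_sub_comm]
  exact mul_le_mul_of_nonneg_right (hη s hs) (abs_nonneg _)

/-- Integration by parts with `G = h²` and `g = 2 h h'`. The inverse inequality gives `∫ |2 h h'| ≤
const * (K + 1) ∫ h²`, so a discrepancy `η` of order `o(1 / K)` is harmless. -/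
lemma exists_spline_empirical_bound (p : ℕ) (M : ℝ) : ∃ C : ℝ, 0 < C ∧
    ∀ (K : ℕ) (x : ℕ → ℝ), IsKnotSeq K x →
    (∀ i ≤ K, ∀ k ≤ K, x (i + 1) - x i ≤ M * (x (k + 1) - x k)) →
    ∀ (n : ℕ), 0 < n → ∀ (t : Fin n → ℝ), (∀ i, t i ∈ Icc (0 : ℝ) 1) →
    ∀ (q : ℝ → ℝ), Measurable q → ∀ (a A : ℝ), 0 < a →
    (∀ s ∈ Icc (0 : ℝ) 1, a ≤ q s ∧ q s ≤ A) → (∫ s in (0 : ℝ)..1, q s) = 1 →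
    ∀ η : ℝ, (∀ s ∈ Icc (0 : ℝ) 1, |empiricalCDF t s - ∫ r in (0 : ℝ)..s, q r| ≤ η) →
    ∀ h, IsSpline p K x h →
      (a - η * (C * (K + 1))) * sqNorm h ≤ (n : ℝ)⁻¹ * ∑ i, h (t i) ^ 2 ∧
      (n : ℝ)⁻¹ * ∑ i, h (t i) ^ 2 ≤ (A + η * (C * (K + 1))) * sqNorm h := by
  obtain ⟨C, hC, hCb⟩ := exists_spline_deriv_bound p 1 M
  refine ⟨C + 1, by positivity, fun K x hx hM n hn t ht q hqm a A ha hq hq1 η hη h hh => ?_⟩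
  have hη0 : 0 ≤ η := (abs_nonneg _).trans (hη 0 (by simp))
  have hpp := hh.isPiecewisePoly
  have hpd := hh.isPiecewisePoly_iteratedDeriv 1
  have hqI : IntervalIntegrable q volume 0 1 := by
    rw [intervalIntegrable_iff_integrableOn_Icc_of_le zero_le_one]
    refine Measure.integrableOn_of_bounded (M := A) (by simp) hqm.aestronglyMeasurable ?_
    filter_upwards [ae_restrict_mem measurableSet_Icc] with s hs
    rw [Real.norm_eq_abs, abs_of_nonneg (ha.le.trans (hq s hs).1)]
    exact (hq s hs).2
  have hGqI : IntervalIntegrable (fun s => h s ^ 2 * q s) volume 0 1 := by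
    have hint := hpp.sq.intervalIntegrable hx
    rw [intervalIntegrable_iff_integrableOn_Icc_of_le zero_le_one] at hint ⊢
    refine Integrable.mul_bdd (c := A) hint hqm.aestronglyMeasurable ?_
    filter_upwards [ae_restrict_mem measurableSet_Icc] with s hs
    rw [Real.norm_eq_abs, abs_of_nonneg (ha.le.trans (hq s hs).1)]
    exact (hq s hs).2
  have hgI : IntervalIntegrable (fun s => 2 * (h s * iteratedDeriv 1 h s)) volume 0 1 :=
    ((hpp.mul hpd).intervalIntegrable hx).const_mul 2
  have hG : ∀ s ∈ Icc (0 : ℝ) 1, h 1 ^ 2 - h s ^ 2 =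
      ∫ r in s..1, 2 * (h r * iteratedDeriv 1 h r) := by
    intro s hs
    have hsub : uIcc s 1 ⊆ Icc (0 : ℝ) 1 := ordConnected_Icc.uIcc_subset hs (by simp)
    symm
    refine MeasureTheory.integral_eq_of_hasDerivAt_off_countable (fun r => h r ^ 2) _
      (countable_range x) ((hh.1.continuousOn.pow 2).mono hsub) ?_
      (hgI.mono_set (by rwa [uIcc_of_le zero_le_one]))
    intro r hr
    obtain ⟨i, hi, hri⟩ := hx.exists_mem_Ioo (hsub (Ioo_subset_Icc_self hr.1)) hr.2
    have h1 : HasDerivAt h (iteratedDeriv 1 h r) r := by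
      rw [iteratedDeriv_one]
      exact ((hh.contDiffAt hi hri 1).differentiableAt (by simp)).hasDerivAt
    refine (h1.fun_pow 2).congr_deriv ?_
    push_cast
    ring
  have h1 := abs_empirical_sub_integral_le hn ht hqI hq1 hη hgI hGqI hG
  have hK : (0 : ℝ) < K + 1 := by positivity
  have hN0 := sqNorm_nonneg h
  have h2 : ∫ s in (0 : ℝ)..1, |2 * (h s * iteratedDeriv 1 h s)| ≤ (C + 1) * (K + 1) * sqNorm h := by
    -- The weights `K + 1` and its inverse balance the factor `(K + 1)²` of the inverse inequality.
    calc _ ≤ ∫ s in (0 : ℝ)..1, ((K + 1) * h s ^ 2 + (K + 1 : ℝ)⁻¹ * iteratedDeriv 1 h s ^ 2) := by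
          refine intervalIntegral.integral_mono_on zero_le_one hgI.abs
            (((hpp.sq.intervalIntegrable hx).const_mul _).add
              ((hpd.sq.intervalIntegrable hx).const_mul _)) fun s _ => ?_
          rw [abs_mul, abs_mul, abs_of_pos (two_pos), ← sq_abs (h s),
            ← sq_abs (iteratedDeriv 1 h s)]
          set u := |h s|
          set v := |iteratedDeriv 1 h s|
          have : (K + 1 : ℝ) * u ^ 2 + (K + 1 : ℝ)⁻¹ * v ^ 2 - 2 * (u * v) =
              (K + 1 : ℝ)⁻¹ * ((K + 1) * u - v) ^ 2 := by
            field_simp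
            ring
          have h0 : 0 ≤ (K + 1 : ℝ)⁻¹ * ((K + 1) * u - v) ^ 2 := by positivity
          linarith
      _ = (K + 1) * sqNorm h + (K + 1 : ℝ)⁻¹ * sqNorm (iteratedDeriv 1 h) := by
          rw [intervalIntegral.integral_add ((hpp.sq.intervalIntegrable hx).const_mul _)
              ((hpd.sq.intervalIntegrable hx).const_mul _), intervalIntegral.integral_const_mul,
              intervalIntegral.integral_const_mul]
          rfl
      _ ≤ (K + 1) * sqNorm h + (K + 1 : ℝ)⁻¹ * (C * (K + 1) ^ (2 * 1) * sqNorm h) := by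
          gcongr
          exact hCb K x hx hM h hh
      _ = _ := by field_simp; ring
  have h3 : a * sqNorm h ≤ ∫ s in (0 : ℝ)..1, h s ^ 2 * q s := by
    rw [sqNorm, ← intervalIntegral.integral_const_mul]
    refine intervalIntegral.integral_mono_on zero_le_one
      ((hpp.sq.intervalIntegrable hx).const_mul _) hGqI fun s hs => ?_
    rw [mul_comm]
    exact mul_le_mul_of_nonneg_left (hq s hs).1 (sq_nonneg _)
  have h4 : ∫ s in (0 : ℝ)..1, h s ^ 2 * q s ≤ A * sqNorm h := by
    rw [sqNorm, ← intervalIntegral.integral_const_mul]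
    refine intervalIntegral.integral_mono_on zero_le_one hGqI
      ((hpp.sq.intervalIntegrable hx).const_mul _) fun s hs => ?_
    rw [mul_comm]
    exact mul_le_mul_of_nonneg_right (hq s hs).2 (sq_nonneg _)
  have h5 := h1.trans (mul_le_mul_of_nonneg_left h2 hη0)
  rw [abs_le] at h5
  constructor <;> nlinarith [h5.1, h5.2]

/-! ### Truncated powers -/

/-- Induction on `d`, each derivative again being a truncated power; at the origin the two one-sided
derivatives agree. This provides splines with prescribed breaks. -/
lemma contDiff_max_pow (d : ℕ) : ContDiff ℝ (d : WithTop ℕ∞) fun u : ℝ => max u 0 ^ (d + 1) := by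
  induction d with
  | zero =>
    have : Continuous fun u : ℝ => max u 0 := by fun_prop
    simp only [Nat.cast_zero, zero_add, pow_one]
    exact contDiff_zero.2 this
  | succ d ih =>
    have hd : ∀ u : ℝ, HasDerivAt (fun u : ℝ => max u 0 ^ (d + 1 + 1))
        ((d + 2 : ℝ) * max u 0 ^ (d + 1)) u := by
      intro u
      have h1 : HasDerivWithinAt (fun u : ℝ => max u 0 ^ (d + 1 + 1))
          ((d + 2 : ℝ) * max u 0 ^ (d + 1)) (Iic 0) u ∨ 0 < u := by
        refine (le_or_gt u 0).imp (fun hu => ?_) id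
        rw [max_eq_right hu, zero_pow (by omega), mul_zero]
        refine (hasDerivWithinAt_const u (Iic 0) (0 : ℝ)).congr (fun v hv => ?_) ?_
        · rw [max_eq_right hv, zero_pow (by omega)]
        · rw [max_eq_right hu, zero_pow (by omega)]
      have h2 : HasDerivWithinAt (fun u : ℝ => max u 0 ^ (d + 1 + 1))
          ((d + 2 : ℝ) * max u 0 ^ (d + 1)) (Ici 0) u ∨ u < 0 := by
        refine (le_or_gt 0 u).imp (fun hu => ?_) id
        rw [max_eq_left hu]
        have h3 : HasDerivAt (fun v : ℝ => v ^ (d + 1 + 1)) ((d + 2 : ℝ) * u ^ (d + 1)) u := by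
          have := hasDerivAt_pow (d + 1 + 1) u
          refine this.congr_deriv ?_
          rw [Nat.add_sub_cancel]
          push_cast
          ring
        refine h3.hasDerivWithinAt.congr (fun v hv => ?_) ?_
        · rw [max_eq_left hv]
        · rw [max_eq_left hu]
      rcases lt_trichotomy u 0 with hu | hu | hu
      · exact (h1.resolve_right hu.not_gt).hasDerivAt (Iic_mem_nhds hu)
      · subst hu
        have := (h1.resolve_right (lt_irrefl _)).union (h2.resolve_right (lt_irrefl _))
        rwa [Iic_union_Ici, hasDerivWithinAt_univ] at this
      · exact (h2.resolve_right hu.not_gt).hasDerivAt (Ici_mem_nhds hu)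
    have : deriv (fun u : ℝ => max u 0 ^ (d + 1 + 1)) = fun u => (d + 2 : ℝ) * max u 0 ^ (d + 1) :=
      funext fun u => (hd u).deriv
    rw [Nat.cast_succ, contDiff_succ_iff_deriv]
    refine ⟨fun u => (hd u).differentiableAt, by simp, ?_⟩
    rw [this]
    exact contDiff_const.mul ih

lemma max_sub_pow_eq {K : ℕ} {x : ℕ → ℝ} (hx : IsKnotSeq K x) {d : ℕ} (hd : d ≠ 0) {k i : ℕ}
    (hk : k ≤ K + 1) (hi : i ≤ K) {t : ℝ} (ht : t ∈ Icc (x i) (x (i + 1))) :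
    max (t - x k) 0 ^ d = if i < k then 0 else (t - x k) ^ d := by
  split_ifs with hik
  · rw [max_eq_right, zero_pow hd]
    linarith [ht.2, hx.mono (show i + 1 ≤ k from hik) hk]
  · rw [max_eq_left]
    linarith [ht.1, hx.mono (not_lt.1 hik) (by omega)]

lemma isSpline_max_sub_pow {p K : ℕ} (hp : 2 ≤ p) {x : ℕ → ℝ} (hx : IsKnotSeq K x) {k : ℕ}
    (hk : k ≤ K + 1) : IsSpline p K x fun t => max (t - x k) 0 ^ (p - 1) := by
  constructor
  · obtain ⟨d, rfl⟩ : ∃ d, p = d + 2 := ⟨p - 2, by omega⟩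
    exact ((contDiff_max_pow d).comp (contDiff_id.sub contDiff_const)).contDiffOn
  · intro i hi
    refine ⟨if i < k then 0 else (Polynomial.X - Polynomial.C (x k)) ^ (p - 1), ?_, fun t ht => ?_⟩
    · split_ifs
      · simp
      · refine Polynomial.natDegree_pow_le.trans ?_
        rw [Polynomial.natDegree_X_sub_C, mul_one]
    · simp only
      rw [max_sub_pow_eq hx (by omega : p - 1 ≠ 0) hk hi ht]
      split_ifs <;> simp

/-! ### Representation of monomials by shifted powers -/

/-- The coefficients are a row of the inverse Vandermonde matrix, which annihilates all moments `∑
γ_a z_a^n` except the one that multiplies `X^l` in the binomial expansion. Nodes that are bounded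
and separated form a compact set on which this inverse is continuous, hence the uniform bound. -/
lemma exists_bounded_shifted_power_repr (d : ℕ) (A B : ℝ) (hB : 0 < B) : ∃ C : ℝ, 0 < C ∧
    ∀ z : Fin (d + 1) → ℝ, (∀ a, |z a| ≤ A) → (∀ a b, a ≠ b → B ≤ |z a - z b|) →
    ∀ l ≤ d, ∃ γ : Fin (d + 1) → ℝ, (∀ a, |γ a| ≤ C) ∧
      ∀ X : ℝ, ∑ a, γ a * (X - z a) ^ d = X ^ l := by
  let Z : Set (Fin (d + 1) → ℝ) := {z | (∀ a, |z a| ≤ A) ∧ ∀ a b, a ≠ b → B ≤ |z a - z b|}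
  have hZ : IsCompact Z := by
    refine Metric.isCompact_of_isClosed_isBounded ?_ ?_
    · simp only [Z, ofPred_and, ofPred_forall]
      refine IsClosed.inter (isClosed_iInter fun a => isClosed_le (by fun_prop) (by fun_prop))
        (isClosed_iInter fun a => isClosed_iInter fun b => isClosed_iInter fun _ =>
          isClosed_le (by fun_prop) (by fun_prop))
    · refine (Metric.isBounded_closedBall (x := (0 : Fin (d + 1) → ℝ)) (r := A)).subset ?_
      intro z hz
      have hA : 0 ≤ A := (abs_nonneg _).trans (hz.1 0)
      rw [mem_closedBall_zero_iff, pi_norm_le_iff_of_nonneg hA]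
      exact hz.1
  have hdet : ∀ z ∈ Z, (Matrix.vandermonde z).det ≠ 0 := by
    intro z hz
    rw [Matrix.det_vandermonde_ne_zero_iff]
    intro a b hab
    by_contra hne
    have := hz.2 a b hne
    rw [hab, sub_self, abs_zero] at this
    linarith
  have hvc : Continuous fun z : Fin (d + 1) → ℝ => Matrix.vandermonde z :=
    continuous_matrix fun a b => by simp only [Matrix.vandermonde_apply]; fun_prop
  have hcont : ContinuousOn (fun z => ∑ n, ∑ a, |(Matrix.vandermonde z)⁻¹ n a|) Z := by
    refine continuousOn_finsetSum _ fun n _ => continuousOn_finsetSum _ fun a _ => ?_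
    refine ContinuousOn.abs ?_
    have : ∀ z ∈ Z, (Matrix.vandermonde z)⁻¹ n a =
        (Matrix.vandermonde z).det⁻¹ * (Matrix.vandermonde z).adjugate n a := by
      intro z hz
      rw [Matrix.inv_def, Ring.inverse_eq_inv']
      rfl
    refine ContinuousOn.congr ?_ this
    refine ContinuousOn.mul (ContinuousOn.inv₀ hvc.matrix_det.continuousOn hdet) ?_
    exact (hvc.matrix_adjugate.matrix_elem n a).continuousOn
  obtain ⟨C, hC⟩ := hZ.exists_bound_of_continuousOn hcont
  refine ⟨max C 1, by positivity, fun z hz1 hz2 l hl => ?_⟩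
  have hz : z ∈ Z := ⟨hz1, hz2⟩
  set V := Matrix.vandermonde z with hV
  let n₀ : Fin (d + 1) := ⟨d - l, by omega⟩
  -- Cancels the factor `(-1)^{d-l} (d choose l)` with which `X^l z^{d-l}` occurs in `(X - z)^d`.
  let ρ : ℝ := (-1) ^ (d - l) / (d.choose l : ℝ)
  have hchoose : (1 : ℝ) ≤ d.choose l := by exact_mod_cast Nat.choose_pos hl
  have hρ : |ρ| ≤ 1 := by
    simp only [ρ, abs_div, abs_pow, abs_neg, abs_one, one_pow, Nat.abs_cast]
    exact (div_le_one (by linarith)).2 hchoose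
  refine ⟨fun a => ρ * V⁻¹ n₀ a, fun a => ?_, fun X => ?_⟩
  · rw [abs_mul]
    have h1 := hC z hz
    rw [Real.norm_eq_abs, abs_of_nonneg (by positivity)] at h1
    have h2 : |V⁻¹ n₀ a| ≤ ∑ n, ∑ a, |V⁻¹ n a| :=
      (Finset.single_le_sum (f := fun a => |V⁻¹ n₀ a|) (fun _ _ => abs_nonneg _)
        (Finset.mem_univ a)).trans
        (Finset.single_le_sum (f := fun n => ∑ a, |V⁻¹ n a|)
          (fun _ _ => Finset.sum_nonneg fun _ _ => abs_nonneg _) (Finset.mem_univ n₀))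
    calc |ρ| * |V⁻¹ n₀ a| ≤ 1 * C := mul_le_mul hρ (h2.trans h1) (abs_nonneg _) zero_le_one
      _ ≤ max C 1 := by rw [one_mul]; exact le_max_left _ _
  · have hVV : V⁻¹ * V = 1 := Matrix.nonsing_inv_mul _ (isUnit_iff_ne_zero.2 (hdet z hz))
    have hmom : ∀ n : Fin (d + 1), ∑ a, V⁻¹ n₀ a * z a ^ (n : ℕ) = if n₀ = n then 1 else 0 := by
      intro n
      have := congrFun (congrFun hVV n₀) n
      rw [Matrix.mul_apply, Matrix.one_apply] at this
      simpa [V, Matrix.vandermonde_apply] using this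
    have hexp : ∀ a, ρ * V⁻¹ n₀ a * (X - z a) ^ d = ∑ r ∈ Finset.range (d + 1),
        X ^ r * (-1) ^ (d - r) * d.choose r * ρ * (V⁻¹ n₀ a * z a ^ (d - r)) := by
      intro a
      rw [sub_eq_add_neg, add_pow, Finset.mul_sum]
      refine Finset.sum_congr rfl fun r _ => ?_
      rw [neg_pow]
      ring
    simp only [hexp]
    rw [Finset.sum_comm]
    simp only [← Finset.mul_sum]
    rw [Finset.sum_eq_single l]
    · have := hmom ⟨d - l, by omega⟩
      simp only at this
      rw [this, if_pos rfl, mul_one]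
      simp only [ρ]
      have h1 : ((-1 : ℝ) ^ (d - l)) * (-1) ^ (d - l) = 1 := by
        rw [← mul_pow]; simp
      have h2 : (d.choose l : ℝ) ≠ 0 := by linarith
      calc X ^ l * (-1) ^ (d - l) * (d.choose l : ℝ) * ((-1) ^ (d - l) / (d.choose l : ℝ))
          = X ^ l * ((-1) ^ (d - l) * (-1) ^ (d - l)) := by field_simp
        _ = X ^ l := by rw [h1, mul_one]
    · intro r hr hrl
      have hr' := Finset.mem_range.1 hr
      have := hmom ⟨d - r, by omega⟩
      simp only at this
      rw [this, if_neg, mul_zero]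
      simp only [n₀, Fin.mk.injEq]
      omega
    · intro h
      exact absurd (Finset.mem_range.2 (by omega)) h

/-! ### Taylor polynomials of smooth functions on `[0, 1]` -/

/-- The Taylor polynomial of degree less than `j` at `τ`. -/
noncomputable def taylorPoly (j : ℕ) (F : ℕ → ℝ → ℝ) (τ : ℝ) : Polynomial ℝ :=
  ∑ l ∈ Finset.range j,
    Polynomial.C (F l τ / l.factorial) * (Polynomial.X - Polynomial.C τ) ^ l

lemma taylorPoly_eval (j : ℕ) (F : ℕ → ℝ → ℝ) (τ t : ℝ) :
    (taylorPoly j F τ).eval t = ∑ l ∈ Finset.range j, F l τ * ((t - τ) ^ l / l.factorial) := by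
  simp only [taylorPoly, Polynomial.eval_finsetSum, Polynomial.eval_mul, Polynomial.eval_C,
    Polynomial.eval_pow, Polynomial.eval_sub, Polynomial.eval_X]
  exact Finset.sum_congr rfl fun l _ => by ring

lemma taylorPoly_natDegree_le {j d : ℕ} (hjd : j ≤ d + 1) (F : ℕ → ℝ → ℝ) (τ : ℝ) :
    (taylorPoly j F τ).natDegree ≤ d := by
  refine Polynomial.natDegree_sum_le_of_forall_le _ _ fun l hl => ?_
  refine (Polynomial.natDegree_C_mul_le _ _).trans (Polynomial.natDegree_pow_le.trans ?_)
  rw [Polynomial.natDegree_X_sub_C, mul_one]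
  have := Finset.mem_range.1 hl
  omega

/-- The oscillation of `F k` is at most `2 B`, and dropping the top Taylor term costs another `B`.
-/
lemma abs_sub_taylor_le_of_bound {a b : ℝ} {k : ℕ} {F : ℕ → ℝ → ℝ}
    (hF : ∀ l < k, ∀ t ∈ Icc a b, HasDerivWithinAt (F l) (F (l + 1) t) (Icc a b) t)
    {τ : ℝ} (hτ : τ ∈ Icc a b) {B : ℝ} (hB : ∀ t ∈ Icc a b, |F k t| ≤ B)
    {t : ℝ} (ht : t ∈ Icc a b) :
    |F 0 t - ∑ l ∈ Finset.range k, F l τ * ((t - τ) ^ l / l.factorial)| ≤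
      3 * B * |t - τ| ^ k := by
  have h1 := abs_sub_taylor_le k hF hτ (ε := 2 * B) (fun s hs => by
    have := abs_sub (F k s) (F k τ)
    linarith [hB s hs, hB τ hτ]) t ht
  rw [Finset.sum_range_succ] at h1
  have h2 : |F k τ * ((t - τ) ^ k / k.factorial)| ≤ B * |t - τ| ^ k := by
    rw [abs_mul, abs_div, abs_pow, Nat.abs_cast]
    refine mul_le_mul (hB τ hτ) (div_le_self (by positivity) ?_) (by positivity)
      ((abs_nonneg _).trans (hB τ hτ))
    exact_mod_cast Nat.factorial_pos k
  have h3 := abs_add_le (F 0 t - (∑ l ∈ Finset.range k, F l τ * ((t - τ) ^ l / l.factorial) +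
    F k τ * ((t - τ) ^ k / k.factorial))) (F k τ * ((t - τ) ^ k / k.factorial))
  have h4 : F 0 t - (∑ l ∈ Finset.range k, F l τ * ((t - τ) ^ l / l.factorial) +
    F k τ * ((t - τ) ^ k / k.factorial)) + F k τ * ((t - τ) ^ k / k.factorial) =
    F 0 t - ∑ l ∈ Finset.range k, F l τ * ((t - τ) ^ l / l.factorial) := by ring
  rw [h4] at h3
  linarith

/-- Expanded around `τ'`, the coefficient of order `l` is, up to `l!`, the Taylor remainder at `τ'`
of the derivative `F l` expanded at `τ` to order `j - l`. -/
lemma taylorPoly_eval_sub {a b : ℝ} {j : ℕ} {F : ℕ → ℝ → ℝ}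
    (hF : ∀ l < j, ∀ t ∈ Icc a b, HasDerivWithinAt (F l) (F (l + 1) t) (Icc a b) t)
    {B : ℝ} (hB : ∀ t ∈ Icc a b, |F j t| ≤ B) {τ τ' : ℝ} (hτ : τ ∈ Icc a b) (hτ' : τ' ∈ Icc a b) :
    ∃ e : ℕ → ℝ, (∀ l < j, |e l| ≤ 3 * B * |τ' - τ| ^ (j - l)) ∧
      ∀ X, (taylorPoly j F τ').eval X - (taylorPoly j F τ).eval X =
        ∑ l ∈ Finset.range j, e l * (X - τ') ^ l := by
  refine ⟨fun l => (F l τ' - ∑ r ∈ Finset.range (j - l),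
    F (l + r) τ * ((τ' - τ) ^ r / r.factorial)) / l.factorial, fun l hl => ?_, fun X => ?_⟩
  · have h1 := abs_sub_taylor_le_of_bound (k := j - l) (F := fun r => F (l + r))
      (fun r hr t ht => hF (l + r) (by omega) t ht) hτ (B := B)
      (fun t ht => by simpa [Nat.add_sub_cancel' hl.le] using hB t ht) hτ'
    rw [abs_div, Nat.abs_cast]
    refine (div_le_self (abs_nonneg _) ?_).trans h1
    exact_mod_cast Nat.factorial_pos l
  · have h2 : (taylorPoly j F τ).eval X = ∑ l ∈ Finset.range j, (X - τ') ^ l / l.factorial *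
        ∑ r ∈ Finset.range (j - l), F (l + r) τ * ((τ' - τ) ^ r / r.factorial) := by
      simp only [Finset.mul_sum]
      rw [← Finset.sum_range_diag_flip j fun l r =>
        (X - τ') ^ l / l.factorial * (F (l + r) τ * ((τ' - τ) ^ r / r.factorial)), taylorPoly_eval]
      refine Finset.sum_congr rfl fun k _ => ?_
      have h3 : X - τ = (X - τ') + (τ' - τ) := by ring
      rw [h3, add_pow, Finset.sum_div, Finset.mul_sum]
      refine Finset.sum_congr rfl fun l hl => ?_
      have hlk : l ≤ k := Nat.lt_succ_iff.1 (Finset.mem_range.1 hl)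
      rw [Nat.add_sub_cancel' hlk]
      have h4 : (k.choose l : ℝ) * l.factorial * (k - l).factorial = k.factorial := by
        exact_mod_cast Nat.choose_mul_factorial_mul_factorial hlk
      rw [← h4]
      have : (k.choose l : ℝ) ≠ 0 := by exact_mod_cast (Nat.choose_pos hlk).ne'
      field_simp
    rw [h2, taylorPoly_eval, ← Finset.sum_sub_distrib]
    refine Finset.sum_congr rfl fun l _ => ?_
    ring

lemma Nat.descFactorial_le_factorial_left (l r : ℕ) : l.descFactorial r ≤ l.factorial := by
  rcases le_or_gt r l with h | h
  · rw [← Nat.factorial_mul_descFactorial h]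
    exact Nat.le_mul_of_pos_left _ (Nat.factorial_pos _)
  · rw [Nat.descFactorial_eq_zero_iff_lt.2 h]
    exact Nat.zero_le _

lemma Polynomial.eval_iterate_derivative_X_sub_C_pow (l r : ℕ) (c t : ℝ) :
    (Polynomial.derivative^[r] ((Polynomial.X - Polynomial.C c) ^ l)).eval t =
      l.descFactorial r * (t - c) ^ (l - r) := by
  rw [Polynomial.iterate_derivative_X_sub_pow, Polynomial.eval_smul, nsmul_eq_mul]
  simp

lemma abs_iterate_derivative_taylorPoly_le {j : ℕ} {F : ℕ → ℝ → ℝ} {B τ t : ℝ}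
    (hB : ∀ l < j, |F l τ| ≤ B) (ht : |t - τ| ≤ 1) (r : ℕ) :
    |(Polynomial.derivative^[r] (taylorPoly j F τ)).eval t| ≤ j * B := by
  rw [taylorPoly, Polynomial.iterate_derivative_sum, Polynomial.eval_finsetSum]
  refine (Finset.abs_sum_le_sum_abs _ _).trans ?_
  refine (Finset.sum_le_sum (g := fun _ => B) fun l hl => ?_).trans (by simp)
  rw [Polynomial.iterate_derivative_C_mul, Polynomial.eval_mul, Polynomial.eval_C,
    Polynomial.eval_iterate_derivative_X_sub_C_pow]
  simp only [abs_mul, abs_div, abs_pow, Nat.abs_cast]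
  have h1 : ((l.descFactorial r : ℕ) : ℝ) ≤ l.factorial := by
    exact_mod_cast Nat.descFactorial_le_factorial_left l r
  have h2 : |t - τ| ^ (l - r) ≤ 1 := pow_le_one₀ (abs_nonneg _) ht
  have hl' := hB l (Finset.mem_range.1 hl)
  have h3 : (0 : ℝ) < l.factorial := by exact_mod_cast Nat.factorial_pos l
  calc |F l τ| / l.factorial * (l.descFactorial r * |t - τ| ^ (l - r))
      ≤ |F l τ| / l.factorial * (l.factorial * 1) := by gcongr
    _ = |F l τ| := by field_simp
    _ ≤ B := hl'

/-! ### Approximation of smooth functions by splines -/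

namespace IsKnotSeq

variable {K : ℕ} {x : ℕ → ℝ} {M : ℝ}

lemma sub_le_mul (hx : IsKnotSeq K x)
    (hM : ∀ i ≤ K, ∀ k ≤ K, x (i + 1) - x i ≤ M * (x (k + 1) - x k)) {i k : ℕ} (hik : i ≤ k)
    (hk : k ≤ K + 1) : (K + 1) * (x k - x i) ≤ (k - i) * M := by
  induction k, hik using Nat.le_induction with
  | base => simp
  | succ k hik ih =>
    have h1 := ih (by omega)
    have h2 := hx.mesh_le hM (k := k) (by omega)
    push_cast
    linarith

lemma abs_sub_le_mul (hx : IsKnotSeq K x)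
    (hM : ∀ i ≤ K, ∀ k ≤ K, x (i + 1) - x i ≤ M * (x (k + 1) - x k)) {i k N : ℕ}
    (hi : i ≤ K + 1) (hk : k ≤ K + 1) (hik : i ≤ k + N) (hki : k ≤ i + N) :
    (K + 1) * |x k - x i| ≤ N * M := by
  have hM0 : 0 ≤ M := zero_le_one.trans (hx.one_le_ratio hM)
  rcases le_total i k with h | h
  · rw [abs_of_nonneg (sub_nonneg.2 (hx.mono h hk))]
    refine (hx.sub_le_mul hM h hk).trans ?_
    have : (k : ℝ) ≤ i + N := by exact_mod_cast hki
    gcongr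
    linarith
  · rw [abs_sub_comm, abs_of_nonneg (sub_nonneg.2 (hx.mono h hi))]
    refine (hx.sub_le_mul hM h hi).trans ?_
    have : (i : ℝ) ≤ k + N := by exact_mod_cast hik
    gcongr
    linarith

lemma le_abs_sub (hx : IsKnotSeq K x)
    (hM : ∀ i ≤ K, ∀ k ≤ K, x (i + 1) - x i ≤ M * (x (k + 1) - x k)) {i k : ℕ}
    (hi : i ≤ K + 1) (hk : k ≤ K + 1) (hik : i ≠ k) : M⁻¹ ≤ (K + 1) * |x k - x i| := by
  have hM0 : 0 < M := zero_lt_one.trans_le (hx.one_le_ratio hM)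
  wlog hlt : i < k generalizing i k
  · rw [abs_sub_comm]
    exact this hk hi hik.symm (by omega)
  have h1 := hx.one_le_mesh hM (k := i) (by omega)
  have h2 := hx.mono (show i + 1 ≤ k from hlt) hk
  rw [inv_le_iff_one_le_mul₀ hM0]
  have h3 := hx.2.2 i (by omega)
  rw [abs_of_nonneg (by linarith)]
  calc (1 : ℝ) ≤ M * (K + 1) * (x (i + 1) - x i) := h1
    _ ≤ M * (K + 1) * (x k - x i) := by gcongr
    _ = _ := by ring

end IsKnotSeq

lemma iteratedDeriv_eq_of_eqOn_Ioo {s : ℝ → ℝ} {q : Polynomial ℝ} {a b : ℝ}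
    (h : ∀ t ∈ Ioo a b, s t = q.eval t) (r : ℕ) {t : ℝ} (ht : t ∈ Ioo a b) :
    iteratedDeriv r s t = (Polynomial.derivative^[r] q).eval t := by
  have : s =ᶠ[𝓝 t] fun t => q.eval t := by
    filter_upwards [isOpen_Ioo.mem_nhds ht] with t' ht'
    exact h t' ht'
  rw [(this.iteratedDeriv_eq r), Polynomial.iteratedDeriv_eval]

lemma IsKnotSeq.sqNorm_le_sq {K : ℕ} {x : ℕ → ℝ} (hx : IsKnotSeq K x) {f : ℝ → ℝ} {C : ℝ}
    (hf : ∀ i ≤ K, ∀ t ∈ Ioo (x i) (x (i + 1)), |f t| ≤ C) : sqNorm f ≤ C ^ 2 := by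
  have := intervalIntegral.norm_integral_le_of_norm_le_const_ae (a := 0) (b := 1)
    (f := fun t => f t ^ 2) (C := C ^ 2) (by
      have : ∀ᵐ t : ℝ, t ∉ range x := (countable_range x).ae_notMem _
      filter_upwards [this] with t ht htI
      rw [uIoc_of_le zero_le_one] at htI
      obtain ⟨i, hi, hti⟩ := hx.exists_mem_Ioo ⟨htI.1.le, htI.2⟩ ht
      rw [norm_pow, Real.norm_eq_abs]
      exact pow_le_pow_left₀ (abs_nonneg _) (hf i hi t hti) 2)
  simp only [sub_zero, abs_one, mul_one] at this
  exact (le_abs_self _).trans this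

/-- Differences of Taylor polynomials at neighbouring knots as combinations of shifted powers. -/
lemma exists_taylor_difference_repr (d j : ℕ) (hjd : j ≤ d + 1) (M B : ℝ) (hB : 0 ≤ B) :
    ∃ C : ℝ, 0 < C ∧
    ∀ (K : ℕ) (x : ℕ → ℝ), IsKnotSeq K x →
    (∀ i ≤ K, ∀ k ≤ K, x (i + 1) - x i ≤ M * (x (k + 1) - x k)) →
    ∀ F : ℕ → ℝ → ℝ,
    (∀ l < j, ∀ t ∈ Icc (0 : ℝ) 1, HasDerivWithinAt (F l) (F (l + 1) t) (Icc 0 1) t) →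
    (∀ t ∈ Icc (0 : ℝ) 1, |F j t| ≤ B) →
    ∀ i, i + 1 + d ≤ K → ∃ c : Fin (d + 1) → ℝ, (∀ a, |c a| * (K + 1) ^ j ≤ C * (K + 1) ^ d) ∧
      ∀ X : ℝ, ∑ a : Fin (d + 1), c a * (X - x (i + 1 + a)) ^ d =
        (taylorPoly j F (x (i + 1))).eval X - (taylorPoly j F (x i)).eval X := by
  by_cases hM1 : 1 ≤ M
  swap
  · exact ⟨1, one_pos, fun K x hx hM => absurd (hx.one_le_ratio hM) hM1⟩
  have hM0 : 0 < M := by linarith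
  obtain ⟨C, hC, hCb⟩ := exists_bounded_shifted_power_repr d (d * M) M⁻¹ (by positivity)
  refine ⟨j * (3 * B * M ^ j * C) + 1, by positivity, fun K x hx hM F hF hFB i hi => ?_⟩
  set κ : ℝ := K + 1 with hκ
  have hκ1 : 1 ≤ κ := by simp [hκ]
  have hκ0 : 0 < κ := by linarith
  obtain ⟨e, he, heq⟩ := taylorPoly_eval_sub hF hFB (hx.mem_Icc (i := i) (by omega))
    (hx.mem_Icc (i := i + 1) (by omega))
  -- After scaling by `K + 1` the nodes are bounded by `d M` and separated by `M⁻¹`, so the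
  -- representation constant does not depend on `K`.
  let z : Fin (d + 1) → ℝ := fun a => κ * (x (i + 1 + a) - x (i + 1))
  have hz1 : ∀ a, |z a| ≤ d * M := by
    intro a
    simp only [z]
    rw [abs_mul, abs_of_pos hκ0]
    exact hx.abs_sub_le_mul hM (N := d) (by omega) (by omega) (by omega) (by omega)
  have hz2 : ∀ a b, a ≠ b → M⁻¹ ≤ |z a - z b| := by
    intro a b hab
    have : z a - z b = κ * (x (i + 1 + a) - x (i + 1 + b)) := by simp only [z]; ring
    rw [this, abs_mul, abs_of_pos hκ0]
    refine hx.le_abs_sub hM (by omega) (by omega) ?_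
    intro h
    exact hab (Fin.ext (by omega))
  choose γ hγ1 hγ2 using fun l : Fin (d + 1) => hCb z hz1 hz2 l (by omega)
  let γ' : ℕ → Fin (d + 1) → ℝ := fun l a => if h : l < d + 1 then γ ⟨l, h⟩ a else 0
  refine ⟨fun a => ∑ l ∈ Finset.range j, e l * (κ ^ (d - l) * γ' l a), fun a => ?_, fun X => ?_⟩
  · have h1 : ∀ l ∈ Finset.range j, |e l * (κ ^ (d - l) * γ' l a)| * κ ^ j ≤
        3 * B * M ^ j * C * κ ^ d := by
      intro l hl
      have hlj := Finset.mem_range.1 hl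
      have hγ : |γ' l a| ≤ C := by
        simp only [γ', dif_pos (show l < d + 1 by omega)]
        exact hγ1 _ a
      have h2 := he l hlj
      have h3 : κ * |x (i + 1) - x i| ≤ M := by
        simpa using hx.abs_sub_le_mul hM (N := 1) (i := i) (k := i + 1) (by omega) (by omega)
          (by omega) (by omega)
      have h4 : |x (i + 1) - x i| ^ (j - l) * κ ^ (j - l) ≤ M ^ j := by
        rw [← mul_pow, mul_comm]
        calc (κ * |x (i + 1) - x i|) ^ (j - l) ≤ M ^ (j - l) := by gcongr
          _ ≤ M ^ j := pow_le_pow_right₀ hM1 (by omega)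
      rw [abs_mul, abs_mul, abs_of_pos (pow_pos hκ0 _)]
      have h5 : κ ^ j = κ ^ (j - l) * κ ^ l := by rw [← pow_add]; congr 1; omega
      have h6 : κ ^ d = κ ^ (d - l) * κ ^ l := by rw [← pow_add]; congr 1; omega
      rw [h5, h6]
      calc |e l| * (κ ^ (d - l) * |γ' l a|) * (κ ^ (j - l) * κ ^ l)
          ≤ (3 * B * |x (i + 1) - x i| ^ (j - l)) * (κ ^ (d - l) * C) * (κ ^ (j - l) * κ ^ l) := by
            gcongr
        _ = 3 * B * (|x (i + 1) - x i| ^ (j - l) * κ ^ (j - l)) * C * (κ ^ (d - l) * κ ^ l) := by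
            ring
        _ ≤ 3 * B * M ^ j * C * (κ ^ (d - l) * κ ^ l) := by gcongr
    calc _ ≤ (∑ l ∈ Finset.range j, |e l * (κ ^ (d - l) * γ' l a)|) * κ ^ j := by
          gcongr
          exact Finset.abs_sum_le_sum_abs _ _
      _ = ∑ l ∈ Finset.range j, |e l * (κ ^ (d - l) * γ' l a)| * κ ^ j := Finset.sum_mul _ _ _
      _ ≤ ∑ l ∈ Finset.range j, 3 * B * M ^ j * C * κ ^ d := Finset.sum_le_sum h1
      _ = j * (3 * B * M ^ j * C) * κ ^ d := by simp; ring
      _ ≤ _ := by gcongr; linarith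
  · rw [heq]
    simp only [Finset.sum_mul]
    rw [Finset.sum_comm]
    refine Finset.sum_congr rfl fun l hl => ?_
    have hlj := Finset.mem_range.1 hl
    have hld : l < d + 1 := by omega
    have h2 := hγ2 ⟨l, hld⟩ (κ * (X - x (i + 1)))
    have h3 : ∀ a : Fin (d + 1), e l * (κ ^ (d - l) * γ' l a) * (X - x (i + 1 + a)) ^ d =
        e l * (κ ^ l)⁻¹ * (γ ⟨l, hld⟩ a * (κ * (X - x (i + 1)) - z a) ^ d) := by
      intro a
      have : κ * (X - x (i + 1)) - z a = κ * (X - x (i + 1 + a)) := by simp only [z]; ring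
      have h6 : κ ^ d = κ ^ (d - l) * κ ^ l := by rw [← pow_add]; congr 1; omega
      rw [this, mul_pow, h6]
      simp only [γ', dif_pos hld]
      field_simp
    rw [Finset.sum_congr rfl fun a _ => h3 a, ← Finset.mul_sum, h2, mul_pow]
    field_simp

/-- Simultaneous approximation of a `C^j` function and boundedness of the `m`-th derivative. -/
lemma exists_spline_approx (p j m : ℕ) (hp : 2 ≤ p) (hj : 1 ≤ j) (hjp : j ≤ p) (hmj : m ≤ j)
    (hmp : m < p) (M : ℝ) (g : ℝ → ℝ) (hg : ContDiffOn ℝ (j : WithTop ℕ∞) g (Icc 0 1)) :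
    ∃ C : ℝ, 0 < C ∧ ∀ (K : ℕ) (x : ℕ → ℝ), IsKnotSeq K x →
    (∀ i ≤ K, ∀ k ≤ K, x (i + 1) - x i ≤ M * (x (k + 1) - x k)) → p ≤ K →
    ∃ s, IsSpline p K x s ∧ (∀ t ∈ Icc (0 : ℝ) 1, |s t - g t| * (K + 1) ^ j ≤ C) ∧
      sqNorm (iteratedDeriv m s) ≤ C := by
  by_cases hM1 : 1 ≤ M
  swap
  · exact ⟨1, one_pos, fun K x hx hM => absurd (hx.one_le_ratio hM) hM1⟩
  have hM0 : 0 < M := by linarith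
  obtain ⟨d, rfl⟩ : ∃ d, p = d + 1 := ⟨p - 1, by omega⟩
  let F : ℕ → ℝ → ℝ := fun l => iteratedDerivWithin l g (Icc 0 1)
  have hF : ∀ l < j, ∀ t ∈ Icc (0 : ℝ) 1, HasDerivWithinAt (F l) (F (l + 1) t) (Icc 0 1) t := by
    intro l hl t ht
    have := (hg.differentiableOn_iteratedDerivWithin (m := l) (by exact_mod_cast hl)
      (uniqueDiffOn_Icc zero_lt_one) t ht).hasDerivWithinAt
    rwa [← iteratedDerivWithin_succ] at this
  obtain ⟨B, hB0, hB⟩ : ∃ B : ℝ, 0 ≤ B ∧ ∀ l ≤ j, ∀ t ∈ Icc (0 : ℝ) 1, |F l t| ≤ B := by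
    have : ∀ l : Fin (j + 1), ∃ B, ∀ t ∈ Icc (0 : ℝ) 1, ‖F l t‖ ≤ B := fun l =>
      isCompact_Icc.exists_bound_of_continuousOn (hg.continuousOn_iteratedDerivWithin
        (by exact_mod_cast (by omega : (l : ℕ) ≤ j)) (uniqueDiffOn_Icc zero_lt_one))
    choose B hB using this
    refine ⟨∑ l, |B l|, by positivity, fun l hl t ht => ?_⟩
    refine ((hB ⟨l, by omega⟩ t ht).trans (le_abs_self _)).trans ?_
    exact Finset.single_le_sum (f := fun l => |B l|) (fun _ _ => abs_nonneg _) (Finset.mem_univ _)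
  obtain ⟨C, hC, hCb⟩ := exists_taylor_difference_repr d j hjp M B hB0
  -- bound for the polynomial correction terms
  let E : ℝ := (d + 1) * (d + 1) * (C * d.factorial * ((d + 1) * M) ^ d)
  have hE : 0 < E := by positivity
  refine ⟨3 * B * ((d + 1) * M) ^ j + E + (j * B + E) ^ 2, by positivity,
    fun K x hx hM hK => ?_⟩
  set κ : ℝ := K + 1 with hκ
  have hκ1 : 1 ≤ κ := by simp [hκ]
  have hκ0 : 0 < κ := by linarith
  -- For `i < R` the knots `i + 1, ..., i + 1 + d` needed by the representation are all interior.
  let R := K - d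
  choose c hc1 hc2 using fun i : Fin R => hCb K x hx hM F hF (hB j le_rfl) i (by omega)
  let c' : ℕ → Fin (d + 1) → ℝ := fun i a => if h : i < R then c ⟨i, h⟩ a else 0
  have hc1' : ∀ i a, |c' i a| * κ ^ j ≤ C * κ ^ d := by
    intro i a
    simp only [c']
    split_ifs with h
    · exact hc1 ⟨i, h⟩ a
    · simp only [abs_zero, zero_mul]; positivity
  have hc2' : ∀ i < R, ∀ X, ∑ a : Fin (d + 1), c' i a * (X - x (i + 1 + a)) ^ d =
      (taylorPoly j F (x (i + 1))).eval X - (taylorPoly j F (x i)).eval X := by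
    intro i hi X
    simp only [c', dif_pos hi]
    exact hc2 ⟨i, hi⟩ X
  -- The jump from the Taylor polynomial at `x i` to the one at `x (i + 1)` is written in powers `(t
  -- - x (i + 1 + a))^d`, which are then truncated. Once all its knots are passed a jump is
  -- complete, so the sum telescopes to the local Taylor polynomial.
  let s : ℝ → ℝ := fun t => (taylorPoly j F (x 0)).eval t +
    ∑ i ∈ Finset.range R, ∑ a : Fin (d + 1), c' i a * max (t - x (i + 1 + a)) 0 ^ d
  have hs : IsSpline (d + 1) K x s := by
    refine (IsSpline.of_polynomial _ (taylorPoly_natDegree_le hjp F _)).add ?_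
    refine IsSpline.sum _ fun i hi => IsSpline.sum _ fun a _ => IsSpline.const_mul ?_ _
    have := Finset.mem_range.1 hi
    exact isSpline_max_sub_pow hp hx (by omega)
  -- On the piece `k`, the part of the already started jumps whose knots have not been passed; this
  -- is the deviation of `s` from a Taylor polynomial.
  let T : ℕ → Polynomial ℝ := fun k => ∑ i ∈ Finset.range (min k R), ∑ a : Fin (d + 1),
    if k < i + 1 + a then
      Polynomial.C (c' i a) * (Polynomial.X - Polynomial.C (x (i + 1 + a))) ^ d else 0
  have hpiece : ∀ k ≤ K, ∀ t ∈ Icc (x k) (x (k + 1)),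
      s t = (taylorPoly j F (x (min k R)) - T k).eval t := by
    intro k hk t ht
    have h1 : ∑ i ∈ Finset.range R, ∑ a : Fin (d + 1), c' i a * max (t - x (i + 1 + a)) 0 ^ d =
        ∑ i ∈ Finset.range (min k R), ∑ a : Fin (d + 1), c' i a * max (t - x (i + 1 + a)) 0 ^ d := by
      symm
      refine Finset.sum_subset (Finset.range_subset_range.2 (min_le_right _ _)) fun i hi hi' => ?_
      have hi1 := Finset.mem_range.1 hi
      have hi2 : ¬ i < min k R := fun h => hi' (Finset.mem_range.2 h)
      refine Finset.sum_eq_zero fun a _ => ?_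
      rw [max_sub_pow_eq hx (by omega) (by omega) hk ht, if_pos (by omega), mul_zero]
    have h2 : ∀ i ∈ Finset.range (min k R),
        ∑ a : Fin (d + 1), c' i a * max (t - x (i + 1 + a)) 0 ^ d =
        ((taylorPoly j F (x (i + 1))).eval t - (taylorPoly j F (x i)).eval t) -
        ∑ a : Fin (d + 1), if k < i + 1 + a then c' i a * (t - x (i + 1 + a)) ^ d else 0 := by
      intro i hi
      have hi1 := Finset.mem_range.1 hi
      rw [← hc2' i (by omega), ← Finset.sum_sub_distrib]
      refine Finset.sum_congr rfl fun a _ => ?_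
      rw [max_sub_pow_eq hx (by omega) (by omega) hk ht]
      split_ifs <;> simp
    simp only [s]
    rw [h1, Finset.sum_congr rfl h2, Finset.sum_sub_distrib,
      Finset.sum_range_sub (fun i => (taylorPoly j F (x i)).eval t)]
    simp only [Polynomial.eval_sub, T, Polynomial.eval_finsetSum]
    have h3 : ∀ i ∈ Finset.range (min k R), ∀ a : Fin (d + 1),
        (if k < i + 1 + a then c' i a * (t - x (i + 1 + a)) ^ d else 0) =
        Polynomial.eval t (if k < i + 1 + a then
          Polynomial.C (c' i a) * (Polynomial.X - Polynomial.C (x (i + 1 + a))) ^ d else 0) := by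
      intro i _ a
      split_ifs <;> simp
    rw [Finset.sum_congr rfl fun i hi => Finset.sum_congr rfl fun a _ => h3 i hi a]
    ring
  have hT : ∀ k ≤ K, ∀ t ∈ Icc (x k) (x (k + 1)), ∀ r ≤ d,
      |(Polynomial.derivative^[r] (T k)).eval t| * κ ^ j ≤ E * κ ^ r := by
    intro k hk t ht r hr
    have hterm : ∀ i ∈ Finset.range (min k R), ∀ a : Fin (d + 1),
        |(Polynomial.derivative^[r] (if k < i + 1 + a then
          Polynomial.C (c' i a) * (Polynomial.X - Polynomial.C (x (i + 1 + a))) ^ d else 0)).eval t| *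
          κ ^ j ≤ if k < i + 1 + d then C * d.factorial * ((d + 1) * M) ^ d * κ ^ r else 0 := by
      intro i hi a
      have hi1 := Finset.mem_range.1 hi
      by_cases hka : k < i + 1 + a
      · rw [if_pos hka, if_pos (by omega), Polynomial.iterate_derivative_C_mul, Polynomial.eval_mul,
          Polynomial.eval_C, Polynomial.eval_iterate_derivative_X_sub_C_pow, abs_mul, abs_mul,
          Nat.abs_cast, abs_pow]
        have h1 : κ * |t - x (i + 1 + a)| ≤ (d + 1) * M := by
          have h2 : κ * |x k - x (i + 1 + a)| ≤ d * M :=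
            hx.abs_sub_le_mul hM (N := d) (by omega) (by omega) (by omega) (by omega)
          have h3 : κ * |t - x k| ≤ M := by
            rw [abs_of_nonneg (by linarith [ht.1])]
            refine le_trans ?_ (hx.mesh_le hM hk)
            gcongr
            exact ht.2
          have h4 := abs_sub_le t (x k) (x (i + 1 + a))
          nlinarith
        have h2 : κ ^ (d - r) * |t - x (i + 1 + a)| ^ (d - r) ≤ ((d + 1) * M) ^ d := by
          rw [← mul_pow]
          have hdM : 1 ≤ (d + 1) * M := by nlinarith [Nat.cast_nonneg (α := ℝ) d]
          calc _ ≤ ((d + 1) * M) ^ (d - r) := by gcongr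
            _ ≤ _ := pow_le_pow_right₀ hdM (by omega)
        have h3 : κ ^ d = κ ^ (d - r) * κ ^ r := by rw [← pow_add]; congr 1; omega
        have h4 := hc1' i a
        have h5 : ((d.descFactorial r : ℕ) : ℝ) ≤ d.factorial := by
          exact_mod_cast Nat.descFactorial_le_factorial_left d r
        calc |c' i a| * (d.descFactorial r * |t - x (i + 1 + a)| ^ (d - r)) * κ ^ j
            = (|c' i a| * κ ^ j) * d.descFactorial r * |t - x (i + 1 + a)| ^ (d - r) := by ring
          _ ≤ (C * κ ^ d) * d.factorial * |t - x (i + 1 + a)| ^ (d - r) := by gcongr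
          _ = C * d.factorial * (κ ^ (d - r) * |t - x (i + 1 + a)| ^ (d - r)) * κ ^ r := by
              rw [h3]; ring
          _ ≤ C * d.factorial * ((d + 1) * M) ^ d * κ ^ r := by gcongr
      · rw [if_neg hka, Polynomial.iterate_derivative_zero]
        simp only [Polynomial.eval_zero, abs_zero, zero_mul]
        split_ifs
        · positivity
        · exact le_rfl
    simp only [T, Polynomial.iterate_derivative_sum, Polynomial.eval_finsetSum]
    calc _ ≤ (∑ i ∈ Finset.range (min k R), ∑ a : Fin (d + 1),
          |(Polynomial.derivative^[r] (if k < i + 1 + a then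
          Polynomial.C (c' i a) * (Polynomial.X - Polynomial.C (x (i + 1 + a))) ^ d
            else 0)).eval t|) * κ ^ j := by
          gcongr
          refine (Finset.abs_sum_le_sum_abs _ _).trans (Finset.sum_le_sum fun i _ => ?_)
          exact Finset.abs_sum_le_sum_abs _ _
      _ = ∑ i ∈ Finset.range (min k R), ∑ a : Fin (d + 1),
          |(Polynomial.derivative^[r] (if k < i + 1 + a then
          Polynomial.C (c' i a) * (Polynomial.X - Polynomial.C (x (i + 1 + a))) ^ d
            else 0)).eval t| * κ ^ j := by
          rw [Finset.sum_mul]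
          exact Finset.sum_congr rfl fun i _ => Finset.sum_mul _ _ _
      _ ≤ ∑ i ∈ Finset.range (min k R), ∑ a : Fin (d + 1),
          if k < i + 1 + d then C * d.factorial * ((d + 1) * M) ^ d * κ ^ r else 0 :=
          Finset.sum_le_sum fun i hi => Finset.sum_le_sum fun a _ => hterm i hi a
      _ = (d + 1) * (∑ i ∈ Finset.range (min k R),
          if k < i + 1 + d then C * d.factorial * ((d + 1) * M) ^ d * κ ^ r else 0) := by
          simp [Finset.mul_sum]
      _ = (d + 1) * ((((Finset.range (min k R)).filter fun i => k < i + 1 + d).card : ℝ) *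
          (C * d.factorial * ((d + 1) * M) ^ d * κ ^ r)) := by
          rw [← Finset.sum_filter, Finset.sum_const, nsmul_eq_mul]
      _ ≤ (d + 1) * ((d + 1 : ℝ) * (C * d.factorial * ((d + 1) * M) ^ d * κ ^ r)) := by
          gcongr
          -- Only jumps that started within the last `d` knots can be incomplete, so the number of
          -- correction terms is independent of `K`.
          have : ((Finset.range (min k R)).filter fun i => k < i + 1 + d) ⊆ Finset.Ico (k - d) k := by
            intro i hi
            simp only [Finset.mem_filter, Finset.mem_range, lt_min_iff] at hi
            rw [Finset.mem_Ico]
            omega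
          have h := Finset.card_le_card this
          rw [Nat.card_Ico] at h
          have h' : ((Finset.range (min k R)).filter fun i => k < i + 1 + d).card ≤ d + 1 := by omega
          exact_mod_cast h'
      _ = E * κ ^ r := by simp only [E]; ring
  refine ⟨s, hs, fun t ht => ?_, ?_⟩
  · obtain ⟨k, hk, htk⟩ := hx.exists_mem_Icc ht
    have h1 := hT k hk t htk 0 (Nat.zero_le _)
    simp only [Function.iterate_zero, id_eq, pow_zero, mul_one] at h1
    have h2 := abs_sub_taylor_le_of_bound hF (hx.mem_Icc (i := min k R) (by omega)) (hB j le_rfl) ht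
    rw [← taylorPoly_eval] at h2
    -- Beyond `x R` the Taylor polynomial stays centered at `x R`; the point `t` is still within `d
    -- + 1` mesh widths.
    have h3 : κ * |t - x (min k R)| ≤ (d + 1) * M := by
      have h2 : κ * |x k - x (min k R)| ≤ d * M :=
        hx.abs_sub_le_mul hM (N := d) (by omega) (by omega) (by omega) (by omega)
      have h3 : κ * |t - x k| ≤ M := by
        rw [abs_of_nonneg (by linarith [htk.1])]
        refine le_trans ?_ (hx.mesh_le hM hk)
        gcongr
        exact htk.2
      have h4 := abs_sub_le t (x k) (x (min k R))
      nlinarith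
    have h4 : |t - x (min k R)| ^ j * κ ^ j ≤ ((d + 1) * M) ^ j := by
      rw [← mul_pow, mul_comm]
      gcongr
    have hF0 : F 0 t = g t := by simp [F]
    rw [hF0] at h2
    have h5 : |s t - g t| ≤ |g t - (taylorPoly j F (x (min k R))).eval t| + |(T k).eval t| := by
      rw [hpiece k hk t htk, Polynomial.eval_sub]
      calc _ = |-(g t - (taylorPoly j F (x (min k R))).eval t) - (T k).eval t| := by congr 1; ring
        _ ≤ |-(g t - (taylorPoly j F (x (min k R))).eval t)| + |(T k).eval t| := abs_sub _ _
        _ = _ := by rw [abs_neg]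
    calc |s t - g t| * κ ^ j ≤
          (3 * B * |t - x (min k R)| ^ j + |(T k).eval t|) * κ ^ j := by
          gcongr
          exact h5.trans (by gcongr)
      _ = 3 * B * (|t - x (min k R)| ^ j * κ ^ j) + |(T k).eval t| * κ ^ j := by ring
      _ ≤ 3 * B * ((d + 1) * M) ^ j + E := by gcongr
      _ ≤ _ := by linarith [sq_nonneg (j * B + E)]
  · have h1 : sqNorm (iteratedDeriv m s) ≤ (j * B + E) ^ 2 := by
      refine hx.sqNorm_le_sq fun k hk t ht => ?_
      have htI := Ioo_subset_Icc_self ht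
      rw [iteratedDeriv_eq_of_eqOn_Ioo
        (fun t ht => hpiece k hk t (Ioo_subset_Icc_self ht)) m ht,
        Polynomial.iterate_derivative_sub, Polynomial.eval_sub]
      refine (abs_sub _ _).trans (add_le_add ?_ ?_)
      · refine abs_iterate_derivative_taylorPoly_le
          (fun l hl => hB l hl.le _ (hx.mem_Icc (by omega))) ?_ m
        have h2 := hx.Icc_subset hk htI
        have h3 := hx.mem_Icc (i := min k R) (by omega)
        rw [abs_le]
        constructor <;> linarith [h2.1, h2.2, h3.1, h3.2]
      · have h2 := hT k hk t htI m (by omega)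
        -- The corrections are of order `κ^{-j}` and each derivative costs a factor `κ`, so `m ≤ j`
        -- keeps their `m`-th derivative bounded.
        have h3 : κ ^ m ≤ κ ^ j := pow_le_pow_right₀ hκ1 hmj
        have h4 : 0 < κ ^ j := by positivity
        by_contra! hlt
        nlinarith
    have : 0 ≤ 3 * B * ((d + 1) * M) ^ j := by positivity
    linarith

/-! ### Orthonormal bases of the spline space -/

/-- The form is turned into an inner product locally and its standard orthonormal basis is taken;
the conclusion is in coordinates so that no norm on `V` survives. -/
lemma exists_orthonormal_family {V : Type*} [AddCommGroup V] [Module ℝ V] [Module.Finite ℝ V]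
    (B : V → V → ℝ) (hsymm : ∀ u v, B u v = B v u) (hnonneg : ∀ v, 0 ≤ B v v)
    (hadd : ∀ u v w, B (u + v) w = B u w + B v w) (hsmul : ∀ (c : ℝ) u v, B (c • u) v = c * B u v)
    (hdef : ∀ v, B v v = 0 → v = 0) :
    ∃ (N : ℕ) (b : Fin N → V), (∀ v, ∃ β : EuclideanSpace ℝ (Fin N), ∑ k, β k • b k = v) ∧
      ∀ β : EuclideanSpace ℝ (Fin N), B (∑ k, β k • b k) (∑ k, β k • b k) = ‖β‖ ^ 2 := by
  let core : InnerProductSpace.Core ℝ V :=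
    { inner := B
      conj_inner_symm := fun u v => by simpa using hsymm v u
      re_inner_nonneg := fun v => by simpa using hnonneg v
      add_left := hadd
      smul_left := fun u v c => by simpa using hsmul c u v
      definite := hdef }
  let : NormedAddCommGroup V := core.toNormedAddCommGroup
  let : InnerProductSpace ℝ V := InnerProductSpace.ofCore core.toCore
  let b := stdOrthonormalBasis ℝ V
  refine ⟨Module.finrank ℝ V, b, fun v => ⟨b.repr v, b.sum_repr v⟩, fun β => ?_⟩
  have h1 : ∑ k, β k • b k = b.repr.symm β := (b.sum_repr_symm β)
  rw [h1]
  have h2 : B (b.repr.symm β) (b.repr.symm β) = inner ℝ (b.repr.symm β) (b.repr.symm β) := rfl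
  rw [h2, real_inner_self_eq_norm_sq, LinearIsometryEquiv.norm_map]

/-- The spline space as a space of functions on `[0, 1]`. -/
def splineSubmodule (p K : ℕ) (x : ℕ → ℝ) : Submodule ℝ (Icc (0 : ℝ) 1 → ℝ) where
  carrier := {v | IsSpline p K x (IccExtend zero_le_one v)}
  add_mem' := fun hu hv => IsSpline.add hu hv
  zero_mem' := IsSpline.zero
  smul_mem' := fun c _ hv => IsSpline.const_mul hv c

/-- Evaluation at `p` distinct points of each piece is injective, since a polynomial of degree less
than `p` with `p` zeros vanishes. -/
lemma finite_splineSubmodule {p K : ℕ} (hp : 1 ≤ p) {x : ℕ → ℝ} (hx : IsKnotSeq K x) :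
    Module.Finite ℝ (splineSubmodule p K x) := by
  let z : Fin (K + 1) × Fin p → Icc (0 : ℝ) 1 := fun a =>
    ⟨x a.1 + (x (a.1 + 1) - x a.1) * ((a.2 : ℕ) / p), by
      have h1 := hx.2.2 a.1 (by omega)
      have hp' : (0 : ℝ) < p := by exact_mod_cast hp
      have h2 : ((a.2 : ℕ) : ℝ) / p ≤ 1 :=
        (div_le_one hp').2 (by exact_mod_cast a.2.2.le)
      have h3 : 0 ≤ ((a.2 : ℕ) : ℝ) / p := by positivity
      refine hx.Icc_subset (i := a.1) (by omega) ⟨?_, ?_⟩ <;> nlinarith⟩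
  let ev : splineSubmodule p K x →ₗ[ℝ] (Fin (K + 1) × Fin p → ℝ) :=
    (LinearMap.funLeft ℝ ℝ z).comp (splineSubmodule p K x).subtype
  refine Module.Finite.of_injective ev ?_
  rw [← LinearMap.ker_eq_bot, LinearMap.ker_eq_bot']
  intro v hv
  ext t
  obtain ⟨i, hi, hti⟩ := hx.exists_mem_Icc t.2
  obtain ⟨q, hq, hqv⟩ := v.2.2 i hi
  have hq0 : q = 0 := by
    have hlt := hx.2.2 i hi
    have hp' : (0 : ℝ) < p := by exact_mod_cast hp
    refine Polynomial.eq_zero_of_degree_lt_of_eval_index_eq_zero (s := (Finset.univ : Finset (Fin p)))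
      (v := fun a : Fin p => x i + (x (i + 1) - x i) * ((a : ℕ) / p)) ?_ ?_ ?_
    · intro a _ b _ hab
      simp only [add_right_inj, mul_eq_mul_left_iff, sub_eq_zero] at hab
      rcases hab with hab | hab
      · rw [div_left_inj' hp'.ne'] at hab
        exact Fin.ext (by exact_mod_cast hab)
      · exact absurd hab hlt.ne'
    · rw [Finset.card_univ, Fintype.card_fin]
      by_cases h0 : q = 0
      · rw [h0, Polynomial.degree_zero]
        exact WithBot.bot_lt_coe p
      · rw [Polynomial.degree_eq_natDegree h0]
        exact_mod_cast (by omega : q.natDegree < p)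
    · intro a _
      have h1 := congrFun hv (⟨i, by omega⟩, a)
      have h3 : x i + (x (i + 1) - x i) * ((a : ℕ) / p) ∈ Icc (x i) (x (i + 1)) := by
        have h2 : ((a : ℕ) : ℝ) / p ≤ 1 := (div_le_one hp').2 (by exact_mod_cast a.2.le)
        have h3 : 0 ≤ ((a : ℕ) : ℝ) / p := by positivity
        constructor <;> nlinarith
      rw [← hqv _ h3, IccExtend_of_mem zero_le_one _ (hx.Icc_subset hi h3)]
      exact h1
  have h1 := hqv t hti
  rw [hq0, Polynomial.eval_zero, IccExtend_of_mem zero_le_one _ t.2] at h1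
  exact h1

lemma sqNorm_iteratedDeriv_add_mul {p K : ℕ} {x : ℕ → ℝ} (hx : IsKnotSeq K x) {s h : ℝ → ℝ}
    (hs : IsSpline p K x s) (hh : IsSpline p K x h) (m : ℕ) :
    sqNorm (iteratedDeriv m fun t => s t + h t) = sqNorm (iteratedDeriv m s) +
      2 * (∫ t in (0 : ℝ)..1, iteratedDeriv m s t * iteratedDeriv m h t) +
      sqNorm (iteratedDeriv m h) := by
  have h1 := hs.isPiecewisePoly_iteratedDeriv m
  have h2 := hh.isPiecewisePoly_iteratedDeriv m
  have : sqNorm (iteratedDeriv m fun t => s t + h t) = ∫ t in (0 : ℝ)..1,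
      (iteratedDeriv m s t ^ 2 + 2 * (iteratedDeriv m s t * iteratedDeriv m h t) +
        iteratedDeriv m h t ^ 2) := by
    refine hx.integral_congr fun i hi t ht => ?_
    rw [hs.iteratedDeriv_add hh m hi ht]
    ring
  rw [this, intervalIntegral.integral_add
    ((h1.sq.intervalIntegrable hx).add (((h1.mul h2).intervalIntegrable hx).const_mul 2))
    (h2.sq.intervalIntegrable hx), intervalIntegral.integral_add (h1.sq.intervalIntegrable hx)
    (((h1.mul h2).intervalIntegrable hx).const_mul 2), intervalIntegral.integral_const_mul]
  rfl

/-- Cauchy–Schwarz via the discriminant of the nonnegative quadratic `c ↦ sqNorm ((s + c h)^{(m)})`.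
-/
lemma abs_integral_iteratedDeriv_mul_le {p K : ℕ} {x : ℕ → ℝ} (hx : IsKnotSeq K x) {s h : ℝ → ℝ}
    (hs : IsSpline p K x s) (hh : IsSpline p K x h) (m : ℕ) :
    |∫ t in (0 : ℝ)..1, iteratedDeriv m s t * iteratedDeriv m h t| ≤
      √(sqNorm (iteratedDeriv m s)) * √(sqNorm (iteratedDeriv m h)) := by
  set I := ∫ t in (0 : ℝ)..1, iteratedDeriv m s t * iteratedDeriv m h t with hI
  have hq : ∀ c : ℝ, 0 ≤ sqNorm (iteratedDeriv m h) * (c * c) + 2 * I * c +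
      sqNorm (iteratedDeriv m s) := by
    intro c
    have h1 := sqNorm_iteratedDeriv_add_mul hx hs (hh.const_mul c) m
    have h2 : ∫ t in (0 : ℝ)..1, iteratedDeriv m s t * iteratedDeriv m (fun t => c * h t) t =
        c * I := by
      rw [hI, ← intervalIntegral.integral_const_mul]
      refine hx.integral_congr fun i hi t ht => ?_
      rw [hh.iteratedDeriv_const_mul c m hi ht]
      ring
    have h3 : sqNorm (iteratedDeriv m fun t => c * h t) = c ^ 2 * sqNorm (iteratedDeriv m h) := by
      rw [sqNorm, sqNorm, ← intervalIntegral.integral_const_mul]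
      refine hx.integral_congr fun i hi t ht => ?_
      rw [hh.iteratedDeriv_const_mul c m hi ht]
      ring
    have h4 := sqNorm_nonneg (iteratedDeriv m fun t => s t + c * h t)
    rw [h1, h2, h3] at h4
    linarith
  have hd := discrim_le_zero hq
  rw [discrim] at hd
  rw [← Real.sqrt_mul (sqNorm_nonneg _)]
  refine Real.abs_le_sqrt ?_
  linarith

/-- Coordinates in which the penalized norm is Euclidean. The form is definite only after passing to
functions on `[0, 1]`: a continuous spline of zero `L²` norm vanishes there, while values elsewhere
are free. -/
lemma exists_spline_orthonormal {p K : ℕ} (hp : 1 ≤ p) {x : ℕ → ℝ} (hx : IsKnotSeq K x) (m : ℕ)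
    {lam : ℝ} (hlam : 0 ≤ lam) : ∃ (N : ℕ) (φ : Fin N → ℝ → ℝ), (∀ k, IsSpline p K x (φ k)) ∧
      (∀ h, IsSpline p K x h → ∃ β : EuclideanSpace ℝ (Fin N),
        ∀ t ∈ Icc (0 : ℝ) 1, h t = ∑ k, β k * φ k t) ∧
      ∀ β : EuclideanSpace ℝ (Fin N), sqNorm (fun t => ∑ k, β k * φ k t) +
        lam * sqNorm (iteratedDeriv m fun t => ∑ k, β k * φ k t) = ‖β‖ ^ 2 := by
  have := finite_splineSubmodule hp hx
  let E : splineSubmodule p K x → ℝ → ℝ := fun v => IccExtend zero_le_one v.1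
  have hE : ∀ v, IsSpline p K x (E v) := fun v => v.2
  have hEadd : ∀ u v, E (u + v) = fun t => E u t + E v t := fun _ _ => rfl
  have hEsmul : ∀ (c : ℝ) v, E (c • v) = fun t => c * E v t := fun _ _ => rfl
  let B : splineSubmodule p K x → splineSubmodule p K x → ℝ := fun u v =>
    (∫ t in (0 : ℝ)..1, E u t * E v t) +
      lam * ∫ t in (0 : ℝ)..1, iteratedDeriv m (E u) t * iteratedDeriv m (E v) t
  have hBself : ∀ v, B v v = sqNorm (E v) + lam * sqNorm (iteratedDeriv m (E v)) := by
    intro v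
    simp only [B, sqNorm, pow_two]
  obtain ⟨N, b, hb1, hb2⟩ := exists_orthonormal_family B
    (fun u v => by simp only [B, mul_comm])
    (fun v => by
      rw [hBself]
      exact add_nonneg (sqNorm_nonneg _) (mul_nonneg hlam (sqNorm_nonneg _)))
    (fun u v w => by
      simp only [B]
      have h1 : ∫ t in (0 : ℝ)..1, E (u + v) t * E w t =
          (∫ t in (0 : ℝ)..1, E u t * E w t) + ∫ t in (0 : ℝ)..1, E v t * E w t := by
        rw [← intervalIntegral.integral_add
          (((hE u).isPiecewisePoly.mul (hE w).isPiecewisePoly).intervalIntegrable hx)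
          (((hE v).isPiecewisePoly.mul (hE w).isPiecewisePoly).intervalIntegrable hx)]
        simp only [hEadd, add_mul]
      have h2 : ∫ t in (0 : ℝ)..1, iteratedDeriv m (E (u + v)) t * iteratedDeriv m (E w) t =
          (∫ t in (0 : ℝ)..1, iteratedDeriv m (E u) t * iteratedDeriv m (E w) t) +
            ∫ t in (0 : ℝ)..1, iteratedDeriv m (E v) t * iteratedDeriv m (E w) t := by
        have hw := (hE w).isPiecewisePoly_iteratedDeriv m
        rw [← intervalIntegral.integral_add
          ((((hE u).isPiecewisePoly_iteratedDeriv m).mul hw).intervalIntegrable hx)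
          ((((hE v).isPiecewisePoly_iteratedDeriv m).mul hw).intervalIntegrable hx)]
        refine hx.integral_congr fun i hi t ht => ?_
        rw [hEadd, (hE u).iteratedDeriv_add (hE v) m hi ht, add_mul]
      rw [h1, h2]
      ring)
    (fun c u v => by
      simp only [B]
      have h1 : ∫ t in (0 : ℝ)..1, E (c • u) t * E v t = c * ∫ t in (0 : ℝ)..1, E u t * E v t := by
        rw [← intervalIntegral.integral_const_mul]
        simp only [hEsmul, mul_assoc]
      have h2 : ∫ t in (0 : ℝ)..1, iteratedDeriv m (E (c • u)) t * iteratedDeriv m (E v) t =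
          c * ∫ t in (0 : ℝ)..1, iteratedDeriv m (E u) t * iteratedDeriv m (E v) t := by
        rw [← intervalIntegral.integral_const_mul]
        refine hx.integral_congr fun i hi t ht => ?_
        rw [hEsmul, (hE u).iteratedDeriv_const_mul c m hi ht, mul_assoc]
      rw [h1, h2]
      ring)
    (fun v hv => by
      rw [hBself] at hv
      have h0 : sqNorm (E v) = 0 := by
        have h1 := sqNorm_nonneg (E v)
        have h2 := mul_nonneg hlam (sqNorm_nonneg (iteratedDeriv m (E v)))
        linarith
      ext t
      by_contra hne
      have hpos : 0 < sqNorm (E v) := by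
        refine intervalIntegral.integral_pos one_pos ((hE v).1.continuousOn.pow 2)
          (fun _ _ => sq_nonneg _) ⟨t, t.2, ?_⟩
        refine sq_pos_iff.2 ?_
        simpa [E, IccExtend_of_mem zero_le_one _ t.2] using hne
      exact hpos.ne' h0)
  have hEsum : ∀ β : EuclideanSpace ℝ (Fin N), E (∑ k, β k • b k) =
      fun t => ∑ k, β k * E (b k) t := by
    intro β
    funext t
    simp only [E, IccExtend, Function.comp_apply, Submodule.coe_sum, Finset.sum_apply,
      Submodule.coe_smul, Pi.smul_apply, smul_eq_mul]
  refine ⟨N, fun k => E (b k), fun k => hE _, fun h hh => ?_, fun β => ?_⟩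
  · have hmem : (fun t : Icc (0 : ℝ) 1 => h t) ∈ splineSubmodule p K x :=
      hh.congr hx fun t ht => by rw [IccExtend_of_mem zero_le_one _ ht]
    obtain ⟨β, hβ⟩ := hb1 ⟨_, hmem⟩
    refine ⟨β, fun t ht => ?_⟩
    have h1 := congrFun (hEsum β) t
    simp only at h1
    rw [← h1, hβ]
    simp only [E]
    rw [IccExtend_of_mem zero_le_one _ ht]
  · rw [← hb2 β, hBself, hEsum]

/-- Testing with `β = φ`: the sum of squares is the squared norm of the evaluation functional. -/
lemma sum_sq_le_of_eval_bound {N : ℕ} {φ : Fin N → ℝ} {R : ℝ} (hR : 0 ≤ R)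
    (h : ∀ β : EuclideanSpace ℝ (Fin N), (∑ k, β k * φ k) ^ 2 ≤ R * ‖β‖ ^ 2) :
    ∑ k, φ k ^ 2 ≤ R := by
  have h1 := h (WithLp.toLp 2 φ)
  rw [EuclideanSpace.real_norm_sq_eq] at h1
  simp only [← pow_two] at h1
  have h0 : 0 ≤ ∑ k, φ k ^ 2 := Finset.sum_nonneg fun _ _ => sq_nonneg _
  rcases h0.eq_or_lt with h2 | h2
  · rwa [← h2]
  · rw [pow_two] at h1
    exact le_of_mul_le_mul_right h1 h2

/-! ### Exponential families -/

namespace ExpFamily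

variable (F : ExpFamily)

lemma density_of_mem {y : ℝ} (hy : y ∈ F.carrier) (θ : ℝ) :
    F.density θ y = Real.exp (y * θ - F.b θ + F.c y) := indicator_of_mem hy _

lemma density_of_notMem {y : ℝ} (hy : y ∉ F.carrier) (θ : ℝ) : F.density θ y = 0 :=
  indicator_of_notMem hy _

lemma density_nonneg (θ y : ℝ) : 0 ≤ F.density θ y :=
  indicator_nonneg (fun _ _ => (Real.exp_pos _).le) _

lemma density_pos {y : ℝ} (hy : y ∈ F.carrier) (θ : ℝ) : 0 < F.density θ y := by
  rw [F.density_of_mem hy]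
  exact Real.exp_pos _

lemma measurable_density (θ : ℝ) : Measurable (F.density θ) := by
  have := F.measurable_c
  exact Measurable.indicator (by fun_prop) F.measurableSet_carrier

lemma lintegral_density (θ : ℝ) : ∫⁻ y, ENNReal.ofReal (F.density θ y) ∂F.ν = 1 :=
  F.lintegral_eq_one θ

lemma integrable_density (θ : ℝ) : Integrable (F.density θ) F.ν := by
  refine ⟨(F.measurable_density θ).aestronglyMeasurable, ?_⟩
  rw [hasFiniteIntegral_iff_ofReal (Eventually.of_forall fun y => F.density_nonneg θ y),
    F.lintegral_density]
  exact ENNReal.one_lt_top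

lemma integral_law (θ : ℝ) (G : ℝ → ℝ) :
    ∫ y, G y ∂F.law θ = ∫ y, F.density θ y * G y ∂F.ν := by
  rw [law, integral_withDensity_eq_integral_toReal_smul
    (F.measurable_density θ).ennreal_ofReal (Eventually.of_forall fun _ => ENNReal.ofReal_lt_top)]
  simp only [ENNReal.toReal_ofReal (F.density_nonneg θ _), smul_eq_mul]

/-- The carrier measure `exp (c y) dν` on the carrier. -/
noncomputable def baseMeasure : Measure ℝ :=
  F.ν.withDensity fun y => ENNReal.ofReal (F.carrier.indicator (fun y => Real.exp (F.c y)) y)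

lemma lintegral_exp_baseMeasure (θ : ℝ) :
    ∫⁻ y, ENNReal.ofReal (Real.exp (θ * y)) ∂F.baseMeasure = ENNReal.ofReal (Real.exp (F.b θ)) := by
  have hc : Measurable fun y => ENNReal.ofReal (F.carrier.indicator (fun y => Real.exp (F.c y)) y) := by
    have := F.measurable_c
    exact (Measurable.indicator (by fun_prop) F.measurableSet_carrier).ennreal_ofReal
  rw [baseMeasure, lintegral_withDensity_eq_lintegral_mul _ hc (by fun_prop)]
  have : ∀ y, ENNReal.ofReal (F.carrier.indicator (fun y => Real.exp (F.c y)) y) *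
      ENNReal.ofReal (Real.exp (θ * y)) =
      ENNReal.ofReal (Real.exp (F.b θ)) * ENNReal.ofReal (F.density θ y) := by
    intro y
    rw [← ENNReal.ofReal_mul (indicator_nonneg (fun _ _ => (Real.exp_pos _).le) _),
      ← ENNReal.ofReal_mul (Real.exp_pos _).le]
    by_cases hy : y ∈ F.carrier
    · rw [indicator_of_mem hy, F.density_of_mem hy, ← Real.exp_add, ← Real.exp_add]
      congr 2
      ring
    · rw [indicator_of_notMem hy, F.density_of_notMem hy, zero_mul, mul_zero]
  simp only [Pi.mul_apply, this]
  rw [lintegral_const_mul _ (F.measurable_density θ).ennreal_ofReal, F.lintegral_density, mul_one]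

/-- Normalization says that `exp (b θ)` is the Laplace transform of the base measure. As it is
finite for every real `θ`, `b` is analytic on the whole line. -/
lemma b_eq_cgf : F.b = cgf id F.baseMeasure := by
  funext θ
  have : mgf id F.baseMeasure θ = Real.exp (F.b θ) := by
    rw [mgf, integral_eq_lintegral_of_nonneg_ae (Eventually.of_forall fun _ => (Real.exp_pos _).le)
      (by fun_prop)]
    simp only [id]
    rw [F.lintegral_exp_baseMeasure, ENNReal.toReal_ofReal (Real.exp_pos _).le]
  rw [cgf, this, Real.log_exp]

lemma integrableExpSet_baseMeasure : integrableExpSet id F.baseMeasure = univ := by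
  refine eq_univ_of_forall fun θ => ?_
  refine ⟨by fun_prop, ?_⟩
  rw [hasFiniteIntegral_iff_ofReal (Eventually.of_forall fun _ => (Real.exp_pos _).le)]
  simp only [id]
  rw [F.lintegral_exp_baseMeasure]
  exact ENNReal.ofReal_lt_top

lemma analyticAt_b (θ : ℝ) : AnalyticAt ℝ F.b θ := by
  rw [F.b_eq_cgf]
  refine analyticAt_cgf ?_
  rw [F.integrableExpSet_baseMeasure, interior_univ]
  trivial

/-- The mean `b'(θ)`. -/
noncomputable def b1 : ℝ → ℝ := deriv F.b

/-- The variance `b''(θ)`. -/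
noncomputable def b2 : ℝ → ℝ := deriv F.b1

lemma hasDerivAt_b (θ : ℝ) : HasDerivAt F.b (F.b1 θ) θ :=
  (F.analyticAt_b θ).differentiableAt.hasDerivAt

lemma hasDerivAt_b1 (θ : ℝ) : HasDerivAt F.b1 (F.b2 θ) θ :=
  (F.analyticAt_b θ).deriv.differentiableAt.hasDerivAt

lemma hasDerivAt_b2 (θ : ℝ) : HasDerivAt F.b2 (deriv F.b2 θ) θ :=
  (F.analyticAt_b θ).deriv.deriv.differentiableAt.hasDerivAt

lemma continuous_b : Continuous F.b :=
  continuous_iff_continuousAt.2 fun θ => (F.hasDerivAt_b θ).continuousAt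

lemma continuous_b1 : Continuous F.b1 :=
  continuous_iff_continuousAt.2 fun θ => (F.hasDerivAt_b1 θ).continuousAt

lemma continuous_b2 : Continuous F.b2 :=
  continuous_iff_continuousAt.2 fun θ => (F.hasDerivAt_b2 θ).continuousAt

lemma continuous_deriv_b2 : Continuous (deriv F.b2) :=
  continuous_iff_continuousAt.2 fun θ => (F.analyticAt_b θ).deriv.deriv.deriv.continuousAt

lemma exists_bound_of_continuous {f : ℝ → ℝ} (hf : Continuous f) (T : ℝ) :
    ∃ C : ℝ, 0 ≤ C ∧ ∀ θ, |θ| ≤ T → |f θ| ≤ C := by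
  obtain ⟨C, hC⟩ := (isCompact_Icc (a := -T) (b := T)).exists_bound_of_continuousOn hf.continuousOn
  exact ⟨|C|, abs_nonneg _, fun θ hθ => (hC θ (abs_le.1 hθ)).trans (le_abs_self _)⟩

/-- The powers `f_θ(y)^a (y - b'(θ))^k`. -/
noncomputable def pw (a : ℝ) (k : ℕ) (θ y : ℝ) : ℝ := F.density θ y ^ a * (y - F.b1 θ) ^ k

lemma measurable_pw (a : ℝ) (k : ℕ) (θ : ℝ) : Measurable (F.pw a k θ) := by
  have := F.measurable_density θ
  unfold pw
  fun_prop

/-! ### Differentiation of powers of the density in the parameter and in the exponent. -/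

lemma hasDerivAt_density_rpow {a : ℝ} (ha : 0 < a) (θ y : ℝ) :
    HasDerivAt (fun θ => F.density θ y ^ a) (a * F.pw a 1 θ y) θ := by
  by_cases hy : y ∈ F.carrier
  · have h1 : (fun θ => F.density θ y ^ a) = fun θ => Real.exp ((y * θ - F.b θ + F.c y) * a) := by
      funext η
      rw [F.density_of_mem hy, ← Real.exp_mul]
    rw [pw, F.density_of_mem hy, ← Real.exp_mul, h1]
    have h2 : HasDerivAt (fun θ => (y * θ - F.b θ + F.c y) * a) ((y - F.b1 θ) * a) θ := by
      have := ((((hasDerivAt_id θ).const_mul y).sub (F.hasDerivAt_b θ)).add_const (F.c y)).mul_const a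
      simpa using this
    refine h2.exp.congr_deriv ?_
    ring
  · have h1 : (fun θ => F.density θ y ^ a) = fun _ => 0 := by
      funext η
      rw [F.density_of_notMem hy, Real.zero_rpow ha.ne']
    rw [h1, pw, F.density_of_notMem hy, Real.zero_rpow ha.ne', zero_mul, mul_zero]
    exact hasDerivAt_const _ _

/-- The weights `pw` are closed under differentiation in `θ`, which is the reason for introducing
them. The truncated `k - 1` is harmless at `k = 0`, where its coefficient vanishes. -/
lemma hasDerivAt_pw {a : ℝ} (ha : 0 < a) (k : ℕ) (θ y : ℝ) :
    HasDerivAt (fun θ => F.pw a k θ y)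
      (a * F.pw a (k + 1) θ y - k * F.b2 θ * F.pw a (k - 1) θ y) θ := by
  have h1 : HasDerivAt (fun θ => (y - F.b1 θ) ^ k) (k * (y - F.b1 θ) ^ (k - 1) * (-F.b2 θ)) θ := by
    have := ((hasDerivAt_const θ y).sub (F.hasDerivAt_b1 θ)).fun_pow k
    simpa using this
  refine ((F.hasDerivAt_density_rpow ha θ y).mul h1).congr_deriv ?_
  simp only [pw]
  ring

lemma hasDerivAt_pw_exponent {a : ℝ} (ha : 0 < a) (k : ℕ) (θ y : ℝ) :
    HasDerivAt (fun a => F.pw a k θ y) (F.pw a k θ y * Real.log (F.density θ y)) a := by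
  by_cases hy : y ∈ F.carrier
  · have h1 : HasDerivAt (fun a => F.density θ y ^ a)
        (F.density θ y ^ a * Real.log (F.density θ y)) a := by
      simpa [mul_comm] using (hasDerivAt_id a).const_rpow (F.density_pos hy θ)
    refine (h1.mul_const _).congr_deriv ?_
    simp only [pw]
    ring
  · have h1 : ∀ b : ℝ, 0 < b → F.pw b k θ y = 0 := fun b hb => by
      rw [pw, F.density_of_notMem hy, Real.zero_rpow hb.ne', zero_mul]
    rw [h1 a ha, zero_mul]
    refine (hasDerivAt_const a (0 : ℝ)).congr_of_eventuallyEq ?_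
    filter_upwards [lt_mem_nhds ha] with b hb
    exact h1 b hb

lemma hasDerivAt_log_density {y : ℝ} (hy : y ∈ F.carrier) (θ : ℝ) :
    HasDerivAt (fun η => Real.log (F.density η y)) (y - F.b1 θ) θ := by
  have h1 : (fun η => Real.log (F.density η y)) = fun η => y * η - F.b η + F.c y := by
    funext η
    rw [F.density_of_mem hy, Real.log_exp]
  rw [h1]
  have := (((hasDerivAt_id θ).const_mul y).sub (F.hasDerivAt_b θ)).add_const (F.c y)
  simpa using this

lemma density_rpow_mul_score_sq {a : ℝ} (ha : 0 < a) (θ y : ℝ) :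
    F.density θ y ^ a * F.score θ y ^ 2 = F.pw a 2 θ y := by
  by_cases hy : y ∈ F.carrier
  · rw [score, (F.hasDerivAt_log_density hy θ).deriv, pw]
  · rw [pw, F.density_of_notMem hy, Real.zero_rpow ha.ne', zero_mul, zero_mul]

/-! #### Decay of the densities -/

variable (hB : ∃ B : ℝ, ∀ θ y, F.density θ y ≤ B)

include hB in
-- Tilting: `f_θ(y) = f_{θ+s}(y) exp(b(θ+s) - b(θ)) exp(-s y)`. Taking for `s` the sign of `y` gives
-- the factor `exp(-|y|)`, and the other factors are bounded for `|θ| ≤ T`.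
lemma exists_density_le_exp (T : ℝ) : ∃ C : ℝ, 1 ≤ C ∧ ∀ θ, |θ| ≤ T → ∀ y,
    F.density θ y ≤ C * Real.exp (-|y|) := by
  obtain ⟨B, hB⟩ := hB
  obtain ⟨D, hD0, hD⟩ := exists_bound_of_continuous F.continuous_b (T + 1)
  refine ⟨max B 1 * Real.exp (2 * D), ?_, fun θ hθ y => ?_⟩
  · calc (1 : ℝ) = 1 * 1 := (one_mul 1).symm
      _ ≤ _ := mul_le_mul (le_max_right _ _) (Real.one_le_exp (by positivity)) zero_le_one
        (by positivity)
  by_cases hy : y ∈ F.carrier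
  swap
  · rw [F.density_of_notMem hy]
    positivity
  have key : ∀ s : ℝ, |s| ≤ 1 → s * y = |y| →
      F.density θ y ≤ max B 1 * Real.exp (2 * D) * Real.exp (-|y|) := by
    intro s hs hsy
    have h1 : F.density θ y =
        F.density (θ + s) y * (Real.exp (F.b (θ + s) - F.b θ) * Real.exp (-|y|)) := by
      rw [F.density_of_mem hy, F.density_of_mem hy, ← Real.exp_add, ← Real.exp_add, ← hsy]
      congr 1
      ring
    have h2 := abs_le.1 (hD θ (by linarith))
    have h3 := abs_le.1 (hD (θ + s) ((abs_add_le _ _).trans (by linarith)))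
    rw [h1, mul_assoc]
    gcongr
    · exact (hB _ _).trans (le_max_left _ _)
    · linarith [h2.1, h3.2]
  rcases le_total 0 y with h | h
  · exact key 1 (by simp) (by rw [one_mul, abs_of_nonneg h])
  · exact key (-1) (by simp) (by rw [abs_of_nonpos h]; ring)

include hB in
/-- Uniform boundedness of all polynomial and logarithmic weights of powers of the densities. -/
lemma exists_weight_bound {a₁ : ℝ} (ha₁ : 0 < a₁) (a₂ T : ℝ) : ∃ C : ℝ, 0 ≤ C ∧
    ∀ a, a₁ ≤ a → a ≤ a₂ → ∀ θ, |θ| ≤ T → ∀ y,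
      F.density θ y ^ a * (1 + |y - F.b1 θ|) ^ 4 * (1 + |Real.log (F.density θ y)|) ≤ C := by
  obtain ⟨C, hC1, hC⟩ := F.exists_density_le_exp hB T
  obtain ⟨D, hD0, hD⟩ := exists_bound_of_continuous F.continuous_b1 T
  have hC0 : 0 < C := by linarith
  obtain ⟨κ, hκ⟩ : ∃ κ, κ = a₁ / 2 := ⟨_, rfl⟩
  have hκ0 : 0 < κ := by rw [hκ]; positivity
  refine ⟨C ^ (a₂ / 2) * (1 + D) ^ 4 * (24 / κ ^ 4 * Real.exp κ) *
    (C ^ (a₂ / 2) * (1 + Real.log C) + (1 + 1 / κ)), ?_, fun a ha ha' θ hθ y => ?_⟩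
  · have := Real.log_nonneg hC1
    positivity
  have hlogC := Real.log_nonneg hC1
  have ha0 : 0 < a := by linarith
  by_cases hy : y ∈ F.carrier
  swap
  · rw [F.density_of_notMem hy, Real.zero_rpow ha0.ne', zero_mul, zero_mul]
    positivity
  have hf := F.density_pos hy θ
  set f := F.density θ y with hfdef
  have hfC := hC θ hθ y
  rw [← hfdef] at hfC
  have hpow : C ^ (a / 2) ≤ C ^ (a₂ / 2) := Real.rpow_le_rpow_of_exponent_le hC1 (by linarith)
  -- One half of the power absorbs the polynomial factor through exponential decay, the other
  -- absorbs the logarithm.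
  have hsplit : f ^ a = f ^ (a / 2) * f ^ (a / 2) := by
    rw [← Real.rpow_add hf]
    congr 1
    ring
  have h1 : f ^ (a / 2) * (1 + |y - F.b1 θ|) ^ 4 ≤
      C ^ (a₂ / 2) * (1 + D) ^ 4 * (24 / κ ^ 4 * Real.exp κ) := by
    have e1 : f ^ (a / 2) ≤ C ^ (a₂ / 2) * Real.exp (-(κ * |y|)) := by
      calc f ^ (a / 2) ≤ (C * Real.exp (-|y|)) ^ (a / 2) :=
            Real.rpow_le_rpow hf.le hfC (by positivity)
        _ = C ^ (a / 2) * Real.exp (-|y| * (a / 2)) := by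
            rw [Real.mul_rpow hC0.le (Real.exp_pos _).le, ← Real.exp_mul]
        _ ≤ C ^ (a₂ / 2) * Real.exp (-(κ * |y|)) := by
            gcongr
            nlinarith [abs_nonneg y]
    have e2 : 1 + |y - F.b1 θ| ≤ (1 + D) * (1 + |y|) := by
      have := abs_sub y (F.b1 θ)
      nlinarith [hD θ hθ, abs_nonneg y]
    have e3 : Real.exp (-(κ * |y|)) * (1 + |y|) ^ 4 ≤ 24 / κ ^ 4 * Real.exp κ := by
      have := Real.pow_div_factorial_le_exp (κ * (1 + |y|)) (by positivity) 4
      have h24 : ((Nat.factorial 4 : ℕ) : ℝ) = 24 := by norm_num [Nat.factorial]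
      rw [h24, mul_pow, div_le_iff₀ (by norm_num)] at this
      have h5 : Real.exp (κ * (1 + |y|)) = Real.exp κ * Real.exp (κ * |y|) := by
        rw [← Real.exp_add]; congr 1; ring
      rw [h5] at this
      have h6 : (1 + |y|) ^ 4 ≤ Real.exp (κ * |y|) * (24 / κ ^ 4 * Real.exp κ) := by
        calc (1 + |y|) ^ 4 = κ ^ 4 * (1 + |y|) ^ 4 / κ ^ 4 := by field_simp
          _ ≤ Real.exp κ * Real.exp (κ * |y|) * 24 / κ ^ 4 := by gcongr
          _ = _ := by ring
      calc _ ≤ Real.exp (-(κ * |y|)) * (Real.exp (κ * |y|) * (24 / κ ^ 4 * Real.exp κ)) := by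
            gcongr
        _ = _ := by rw [← mul_assoc, ← Real.exp_add, neg_add_cancel, Real.exp_zero, one_mul]
    calc f ^ (a / 2) * (1 + |y - F.b1 θ|) ^ 4
        ≤ (C ^ (a₂ / 2) * Real.exp (-(κ * |y|))) * ((1 + D) * (1 + |y|)) ^ 4 := by gcongr
      _ = C ^ (a₂ / 2) * (1 + D) ^ 4 * (Real.exp (-(κ * |y|)) * (1 + |y|) ^ 4) := by ring
      _ ≤ _ := by gcongr
  have h2 : f ^ (a / 2) * (1 + |Real.log f|) ≤
      C ^ (a₂ / 2) * (1 + Real.log C) + (1 + 1 / κ) := by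
    rcases le_or_gt f 1 with hf1 | hf1
    · have e1 := Real.abs_log_mul_self_rpow_lt f (a / 2) hf hf1 (by positivity)
      rw [abs_mul, abs_of_pos (Real.rpow_pos_of_pos hf _)] at e1
      have e2 : f ^ (a / 2) ≤ 1 := Real.rpow_le_one hf.le hf1 (by positivity)
      have e3 : 1 / (a / 2) ≤ 1 / κ := one_div_le_one_div_of_le hκ0 (by linarith)
      have e4 : 0 ≤ C ^ (a₂ / 2) * (1 + Real.log C) := by positivity
      nlinarith
    · have hfC' : f ≤ C := hfC.trans (mul_le_of_le_one_right hC0.le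
        (Real.exp_le_one_iff.2 (by simp)))
      have e1 : f ^ (a / 2) ≤ C ^ (a₂ / 2) :=
        (Real.rpow_le_rpow hf.le hfC' (by positivity)).trans hpow
      have e2 : |Real.log f| ≤ Real.log C := by
        rw [abs_of_nonneg (Real.log_nonneg hf1.le)]
        exact Real.log_le_log hf hfC'
      calc f ^ (a / 2) * (1 + |Real.log f|) ≤ C ^ (a₂ / 2) * (1 + Real.log C) := by gcongr
        _ ≤ _ := by linarith [show 0 < 1 + 1 / κ by positivity]
  calc f ^ a * (1 + |y - F.b1 θ|) ^ 4 * (1 + |Real.log f|)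
      = (f ^ (a / 2) * (1 + |y - F.b1 θ|) ^ 4) * (f ^ (a / 2) * (1 + |Real.log f|)) := by
        rw [hsplit]; ring
    _ ≤ _ := mul_le_mul h1 h2 (by positivity) (by positivity)

include hB in
-- One full power of `f` supplies integrability, the remaining exponent `a - 1 > 0` absorbs the
-- weights. Since `θ ↦ y θ` is monotone, the density is dominated uniformly in `|θ| ≤ T` by the
-- densities at `T` and `-T`.
lemma exists_integrable_weight_bound {a₁ : ℝ} (ha₁ : 1 < a₁) (a₂ T : ℝ) : ∃ g : ℝ → ℝ,
    Integrable g F.ν ∧ (∀ y, 0 ≤ g y) ∧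
    ∀ a, a₁ ≤ a → a ≤ a₂ → ∀ θ, |θ| ≤ T → ∀ y,
      F.density θ y ^ a * (1 + |y - F.b1 θ|) ^ 4 * (1 + |Real.log (F.density θ y)|) ≤ g y := by
  obtain ⟨C, hC0, hC⟩ := F.exists_weight_bound hB (sub_pos.2 ha₁) (a₂ - 1) T
  obtain ⟨D, hD0, hD⟩ := exists_bound_of_continuous F.continuous_b |T|
  refine ⟨fun y => Real.exp (2 * D) * C * (F.density T y + F.density (-T) y),
    ((F.integrable_density T).add (F.integrable_density (-T))).const_mul _,
    fun y => by have := F.density_nonneg T y; have := F.density_nonneg (-T) y; positivity,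
    fun a ha ha' θ hθ y => ?_⟩
  by_cases hy : y ∈ F.carrier
  swap
  · simp only [F.density_of_notMem hy]
    rw [Real.zero_rpow (by linarith), zero_mul, zero_mul]
    simp
  have hf := F.density_pos hy θ
  have h1 : F.density θ y ^ a = F.density θ y * F.density θ y ^ (a - 1) := by
    rw [← Real.rpow_one_add' hf.le (by linarith)]
    congr 1
    ring
  have h2 : F.density θ y ≤ Real.exp (2 * D) * (F.density T y + F.density (-T) y) := by
    have hT0 : 0 ≤ T := (abs_nonneg _).trans hθ
    have e0 := abs_le.1 (hD θ (by rwa [abs_of_nonneg hT0]))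
    have e1 : ∀ s : ℝ, |s| = |T| → y * θ ≤ y * s →
        F.density θ y ≤ Real.exp (2 * D) * F.density s y := by
      intro s hs hys
      have e2 := abs_le.1 (hD s hs.le)
      rw [F.density_of_mem hy, F.density_of_mem hy, ← Real.exp_add]
      refine Real.exp_le_exp.2 ?_
      linarith [e0.1, e2.2]
    have hθ' := abs_le.1 hθ
    have p1 := F.density_nonneg T y
    have p2 := F.density_nonneg (-T) y
    have p3 := Real.exp_pos (2 * D)
    rcases le_total 0 y with h | h
    · have := e1 T rfl (by nlinarith)
      nlinarith
    · have := e1 (-T) (abs_neg T) (by nlinarith)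
      nlinarith
  calc F.density θ y ^ a * (1 + |y - F.b1 θ|) ^ 4 * (1 + |Real.log (F.density θ y)|)
      = F.density θ y * (F.density θ y ^ (a - 1) * (1 + |y - F.b1 θ|) ^ 4 *
        (1 + |Real.log (F.density θ y)|)) := by rw [h1]; ring
    _ ≤ (Real.exp (2 * D) * (F.density T y + F.density (-T) y)) * C := by
        gcongr
        · have := F.density_nonneg T y; have := F.density_nonneg (-T) y; positivity
        · exact hC (a - 1) (by linarith) (by linarith) θ hθ y
    _ = _ := by ring

lemma abs_pw_le {k : ℕ} (hk : k ≤ 4) (a θ y : ℝ) : |F.pw a k θ y| ≤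
    F.density θ y ^ a * (1 + |y - F.b1 θ|) ^ 4 * (1 + |Real.log (F.density θ y)|) := by
  have hf := Real.rpow_nonneg (F.density_nonneg θ y) a
  rw [pw, abs_mul, abs_of_nonneg hf, abs_pow]
  have h1 : |y - F.b1 θ| ^ k ≤ (1 + |y - F.b1 θ|) ^ 4 :=
    (pow_le_pow_left₀ (abs_nonneg _) (by linarith [abs_nonneg (y - F.b1 θ)]) k).trans
      (pow_le_pow_right₀ (by linarith [abs_nonneg (y - F.b1 θ)]) hk)
  calc _ ≤ F.density θ y ^ a * (1 + |y - F.b1 θ|) ^ 4 := by gcongr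
    _ ≤ _ := le_mul_of_one_le_right (by positivity) (by simp)

lemma abs_pw_mul_log_le {k : ℕ} (hk : k ≤ 4) (a θ y : ℝ) :
    |F.pw a k θ y * Real.log (F.density θ y)| ≤
    F.density θ y ^ a * (1 + |y - F.b1 θ|) ^ 4 * (1 + |Real.log (F.density θ y)|) := by
  have hf := Real.rpow_nonneg (F.density_nonneg θ y) a
  rw [pw, abs_mul, abs_mul, abs_of_nonneg hf, abs_pow]
  have h1 : |y - F.b1 θ| ^ k ≤ (1 + |y - F.b1 θ|) ^ 4 :=
    (pow_le_pow_left₀ (abs_nonneg _) (by linarith [abs_nonneg (y - F.b1 θ)]) k).trans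
      (pow_le_pow_right₀ (by linarith [abs_nonneg (y - F.b1 θ)]) hk)
  gcongr
  simp

end ExpFamily

/-! ### The density power divergence loss -/

namespace ExpFamily

variable (F : ExpFamily)

/-- `∫ f_θ^a (y - b'(θ))^k dν`. -/
noncomputable def ipw (a : ℝ) (k : ℕ) (θ : ℝ) : ℝ := ∫ y, F.pw a k θ y ∂F.ν

variable (hB : ∃ B : ℝ, ∀ θ y, F.density θ y ≤ B)

include hB in
lemma integrable_pw {a : ℝ} (ha : 1 < a) {k : ℕ} (hk : k ≤ 4) (θ : ℝ) :
    Integrable (F.pw a k θ) F.ν := by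
  obtain ⟨g, hg, -, hgb⟩ := F.exists_integrable_weight_bound hB ha a |θ|
  refine hg.mono' (F.measurable_pw a k θ).aestronglyMeasurable (Eventually.of_forall fun y => ?_)
  exact (F.abs_pw_le hk a θ y).trans (hgb a le_rfl le_rfl θ le_rfl y)

include hB in
-- Differentiation under the integral sign with the dominating function that is uniform over a unit
-- ball around `θ`.
lemma hasDerivAt_ipw {a : ℝ} (ha : 1 < a) {k : ℕ} (hk : k ≤ 3) (θ : ℝ) :
    HasDerivAt (F.ipw a k) (a * F.ipw a (k + 1) θ - k * F.b2 θ * F.ipw a (k - 1) θ) θ := by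
  obtain ⟨g, hg, hg0, hgb⟩ := F.exists_integrable_weight_bound hB ha a (|θ| + 1)
  obtain ⟨D, hD0, hD⟩ := exists_bound_of_continuous F.continuous_b2 (|θ| + 1)
  have ha0 : 0 < a := by linarith
  have h := (hasDerivAt_integral_of_dominated_loc_of_deriv_le (μ := F.ν) (s := Metric.ball θ 1)
    (F := fun θ y => F.pw a k θ y)
    (F' := fun θ y => a * F.pw a (k + 1) θ y - k * F.b2 θ * F.pw a (k - 1) θ y)
    (bound := fun y => (a + k * D) * g y) (x₀ := θ) (Metric.ball_mem_nhds θ one_pos)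
    (Eventually.of_forall fun η => (F.measurable_pw a k η).aestronglyMeasurable)
    (F.integrable_pw hB ha (by omega) θ)
    (((F.measurable_pw a (k + 1) θ).const_mul a).sub
      ((F.measurable_pw a (k - 1) θ).const_mul _)).aestronglyMeasurable
    (Eventually.of_forall fun y η hη => by
      have hη' : |η| ≤ |θ| + 1 := by
        rw [Metric.mem_ball, Real.dist_eq] at hη
        have := abs_sub_abs_le_abs_sub η θ
        linarith
      have h1 := (F.abs_pw_le (show k + 1 ≤ 4 by omega) a η y).trans (hgb a le_rfl le_rfl η hη' y)
      have h2 := (F.abs_pw_le (show k - 1 ≤ 4 by omega) a η y).trans (hgb a le_rfl le_rfl η hη' y)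
      rw [Real.norm_eq_abs]
      refine (abs_sub _ _).trans ?_
      rw [abs_mul, abs_mul, abs_mul, abs_of_pos ha0, Nat.abs_cast]
      have := hD η hη'
      have := hg0 y
      calc a * |F.pw a (k + 1) η y| + k * |F.b2 η| * |F.pw a (k - 1) η y|
          ≤ a * g y + k * D * g y := by gcongr
        _ = _ := by ring)
    (hg.const_mul _)
    (Eventually.of_forall fun y η _ => F.hasDerivAt_pw ha0 k η y)).2
  refine h.congr_deriv ?_
  rw [integral_sub ((F.integrable_pw hB ha (by omega) θ).const_mul _)
    ((F.integrable_pw hB ha (by omega) θ).const_mul _), integral_const_mul, integral_const_mul]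
  rfl

/-- A weighted Lipschitz estimate for the powers of the density. -/
lemma abs_pw_sub_le {a₁ a₂ T D W y : ℝ} (ha₁ : 0 < a₁)
    (hD : ∀ θ, |θ| ≤ T → |F.b2 θ| ≤ D)
    (hW : ∀ a, a₁ ≤ a → a ≤ a₂ → ∀ θ, |θ| ≤ T →
      F.density θ y ^ a * (1 + |y - F.b1 θ|) ^ 4 * (1 + |Real.log (F.density θ y)|) ≤ W)
    {k : ℕ} (hk : k ≤ 3) {a a' θ θ' : ℝ} (ha : a₁ ≤ a) (haa : a ≤ a₂) (ha' : a₁ ≤ a')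
    (haa' : a' ≤ a₂) (hθ : |θ| ≤ T) (hθ' : |θ'| ≤ T) :
    |F.pw a k θ y - F.pw a' k θ' y| ≤ (a₂ + k * D + 1) * W * (|a - a'| + |θ - θ'|) := by
  have hW0 : 0 ≤ W := le_trans (by have := F.density_nonneg θ y; positivity) (hW a ha haa θ hθ)
  have hD0 : 0 ≤ D := (abs_nonneg _).trans (hD θ hθ)
  have ha₂ : 0 ≤ a₂ := by linarith
  have h1 : |F.pw a k θ y - F.pw a' k θ y| ≤ W * |a - a'| := by
    have := Convex.norm_image_sub_le_of_norm_hasDerivWithin_le (s := Icc a₁ a₂) (C := W)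
      (f := fun a => F.pw a k θ y) (x := a') (y := a)
      (fun b hb => (F.hasDerivAt_pw_exponent (ha₁.trans_le hb.1) k θ y).hasDerivWithinAt)
      (fun b hb => (F.abs_pw_mul_log_le (by omega) b θ y).trans (hW b hb.1 hb.2 θ hθ))
      (convex_Icc _ _) ⟨ha', haa'⟩ ⟨ha, haa⟩
    simpa [Real.norm_eq_abs] using this
  have h2 : |F.pw a' k θ y - F.pw a' k θ' y| ≤ (a₂ + k * D) * W * |θ - θ'| := by
    have := Convex.norm_image_sub_le_of_norm_hasDerivWithin_le (s := Icc (-T) T)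
      (C := (a₂ + k * D) * W) (f := fun θ => F.pw a' k θ y) (x := θ') (y := θ)
      (fun η _ => (F.hasDerivAt_pw (ha₁.trans_le ha') k η y).hasDerivWithinAt)
      (fun η hη => by
        have hη' : |η| ≤ T := abs_le.2 hη
        have e1 := (F.abs_pw_le (show k + 1 ≤ 4 by omega) a' η y).trans (hW a' ha' haa' η hη')
        have e2 := (F.abs_pw_le (show k - 1 ≤ 4 by omega) a' η y).trans (hW a' ha' haa' η hη')
        rw [Real.norm_eq_abs]
        refine (abs_sub _ _).trans ?_
        rw [abs_mul, abs_mul, abs_mul, abs_of_pos (ha₁.trans_le ha'), Nat.abs_cast]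
        have := hD η hη'
        calc _ ≤ a₂ * W + k * D * W := by gcongr
          _ = _ := by ring)
      (convex_Icc _ _) (abs_le.1 hθ') (abs_le.1 hθ)
    simpa [Real.norm_eq_abs] using this
  calc |F.pw a k θ y - F.pw a' k θ' y|
      ≤ |F.pw a k θ y - F.pw a' k θ y| + |F.pw a' k θ y - F.pw a' k θ' y| := abs_sub_le _ _ _
    _ ≤ W * |a - a'| + (a₂ + k * D) * W * |θ - θ'| := add_le_add h1 h2
    _ ≤ _ := by
        have e1 : 0 ≤ (a₂ + k * D) * W * |a - a'| := by positivity
        have e2 : 0 ≤ W * |θ - θ'| := by positivity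
        nlinarith

/-- Functions of `(α, θ, y)` that are bounded and Lipschitz in `(α, θ)`, uniformly in `y`, for
`α ∈ [a₁, a₂]` and `|θ| ≤ T`. -/
def IsBddLip (a₁ a₂ T : ℝ) (G : ℝ → ℝ → ℝ → ℝ) : Prop :=
  ∃ C : ℝ, 0 ≤ C ∧ ∀ a ∈ Icc a₁ a₂, ∀ θ, |θ| ≤ T → ∀ y, |G a θ y| ≤ C ∧
    ∀ a' ∈ Icc a₁ a₂, ∀ θ', |θ'| ≤ T → |G a θ y - G a' θ' y| ≤ C * (|a - a'| + |θ - θ'|)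

namespace IsBddLip

variable {a₁ a₂ T : ℝ} {G H : ℝ → ℝ → ℝ → ℝ}

lemma add (hG : IsBddLip a₁ a₂ T G) (hH : IsBddLip a₁ a₂ T H) :
    IsBddLip a₁ a₂ T fun a θ y => G a θ y + H a θ y := by
  obtain ⟨C, hC0, hC⟩ := hG
  obtain ⟨D, hD0, hD⟩ := hH
  refine ⟨C + D, by positivity, fun a ha θ hθ y => ⟨?_, fun a' ha' θ' hθ' => ?_⟩⟩
  · exact (abs_add_le _ _).trans (add_le_add (hC a ha θ hθ y).1 (hD a ha θ hθ y).1)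
  · have h1 := (hC a ha θ hθ y).2 a' ha' θ' hθ'
    have h2 := (hD a ha θ hθ y).2 a' ha' θ' hθ'
    calc _ = |(G a θ y - G a' θ' y) + (H a θ y - H a' θ' y)| := by congr 1; ring
      _ ≤ _ := (abs_add_le _ _).trans (add_le_add h1 h2)
      _ = _ := by ring

lemma mul (hG : IsBddLip a₁ a₂ T G) (hH : IsBddLip a₁ a₂ T H) :
    IsBddLip a₁ a₂ T fun a θ y => G a θ y * H a θ y := by
  obtain ⟨C, hC0, hC⟩ := hG
  obtain ⟨D, hD0, hD⟩ := hH
  refine ⟨2 * (C * D), by positivity, fun a ha θ hθ y => ⟨?_, fun a' ha' θ' hθ' => ?_⟩⟩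
  · rw [abs_mul]
    have := mul_le_mul (hC a ha θ hθ y).1 (hD a ha θ hθ y).1 (abs_nonneg _) hC0
    have : 0 ≤ C * D := by positivity
    linarith
  · have h1 := (hC a ha θ hθ y).2 a' ha' θ' hθ'
    have h2 := (hD a ha θ hθ y).2 a' ha' θ' hθ'
    calc _ = |(G a θ y - G a' θ' y) * H a θ y + G a' θ' y * (H a θ y - H a' θ' y)| := by
          congr 1; ring
      _ ≤ |G a θ y - G a' θ' y| * |H a θ y| + |G a' θ' y| * |H a θ y - H a' θ' y| := by
          rw [← abs_mul, ← abs_mul]; exact abs_add_le _ _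
      _ ≤ (C * (|a - a'| + |θ - θ'|)) * D + C * (D * (|a - a'| + |θ - θ'|)) := by
          have := (hD a ha θ hθ y).1
          have := (hC a' ha' θ' hθ' y).1
          gcongr
      _ = _ := by ring

lemma const (a₁ a₂ T c : ℝ) : IsBddLip a₁ a₂ T fun _ _ _ => c :=
  ⟨|c|, abs_nonneg _, fun a _ θ _ y => ⟨le_rfl, fun a' _ θ' _ => by
    rw [sub_self, abs_zero]; positivity⟩⟩

lemma neg (hG : IsBddLip a₁ a₂ T G) : IsBddLip a₁ a₂ T fun a θ y => -G a θ y := by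
  simpa using (const a₁ a₂ T (-1)).mul hG

lemma sub (hG : IsBddLip a₁ a₂ T G) (hH : IsBddLip a₁ a₂ T H) :
    IsBddLip a₁ a₂ T fun a θ y => G a θ y - H a θ y := by
  simpa only [sub_eq_add_neg] using hG.add hH.neg

lemma exponent (ha₁ : 0 ≤ a₁) : IsBddLip a₁ a₂ T fun a _ _ => a := by
  refine ⟨max a₂ 1, by positivity, fun a ha θ _ y => ⟨?_, fun a' _ θ' _ => ?_⟩⟩
  · rw [abs_of_nonneg (ha₁.trans ha.1)]
    exact ha.2.trans (le_max_left _ _)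
  · have := le_max_right a₂ 1
    nlinarith [abs_nonneg (a - a'), abs_nonneg (θ - θ')]

end IsBddLip

lemma isBddLip_b2 (a₁ a₂ T : ℝ) : IsBddLip a₁ a₂ T fun _ θ _ => F.b2 θ := by
  obtain ⟨D, hD0, hD⟩ := exists_bound_of_continuous F.continuous_b2 T
  obtain ⟨E, hE0, hE⟩ := exists_bound_of_continuous F.continuous_deriv_b2 T
  refine ⟨D + E, by positivity, fun a _ θ hθ y => ⟨(hD θ hθ).trans (by linarith),
    fun a' _ θ' hθ' => ?_⟩⟩
  have := Convex.norm_image_sub_le_of_norm_hasDerivWithin_le (s := Icc (-T) T) (C := E)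
      (f := F.b2) (x := θ') (y := θ) (fun η _ => (F.hasDerivAt_b2 η).hasDerivWithinAt)
      (fun η hη => hE η (abs_le.2 hη)) (convex_Icc _ _) (abs_le.1 hθ') (abs_le.1 hθ)
  rw [Real.norm_eq_abs, Real.norm_eq_abs] at this
  refine this.trans ?_
  nlinarith [abs_nonneg (a - a'), abs_nonneg (θ - θ'), mul_nonneg hD0 (abs_nonneg (a - a')),
    mul_nonneg hD0 (abs_nonneg (θ - θ')), mul_nonneg hE0 (abs_nonneg (a - a'))]

include hB in
-- The derivative in `θ` involves the power `k + 1` and the weight bound reaches the fourth power,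
-- hence `k ≤ 3`.
lemma isBddLip_pw {a₁ : ℝ} (ha₁ : 0 < a₁) (a₂ T : ℝ) {k : ℕ} (hk : k ≤ 3) :
    IsBddLip a₁ a₂ T fun a θ y => F.pw a k θ y := by
  obtain ⟨W, hW0, hW⟩ := F.exists_weight_bound hB ha₁ a₂ T
  obtain ⟨D, hD0, hD⟩ := exists_bound_of_continuous F.continuous_b2 T
  refine ⟨(|a₂| + k * D + 1) * W, by positivity, fun a ha θ hθ y => ⟨?_, fun a' ha' θ' hθ' => ?_⟩⟩
  · refine ((F.abs_pw_le (by omega) a θ y).trans (hW a ha.1 ha.2 θ hθ y)).trans ?_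
    refine le_mul_of_one_le_left hW0 ?_
    have : 0 ≤ |a₂| + k * D := by positivity
    linarith
  · refine (F.abs_pw_sub_le ha₁ hD (fun a h h' θ hθ => hW a h h' θ hθ y) hk ha.1 ha.2 ha'.1 ha'.2
      hθ hθ').trans ?_
    gcongr
    exact le_abs_self _

include hB in
lemma isBddLip_ipw {a₁ : ℝ} (ha₁ : 0 < a₁) (a₂ T : ℝ) {k : ℕ} (hk : k ≤ 3) :
    IsBddLip a₁ a₂ T fun a θ _ => F.ipw (1 + a) k θ := by
  obtain ⟨g, hg, hg0, hgb⟩ := F.exists_integrable_weight_bound hB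
    (show 1 < 1 + a₁ by linarith) (1 + a₂) T
  obtain ⟨D, hD0, hD⟩ := exists_bound_of_continuous F.continuous_b2 T
  have hI0 : 0 ≤ ∫ y, g y ∂F.ν := integral_nonneg hg0
  have hI : ∀ a, a₁ ≤ a → ∀ θ, Integrable (F.pw (1 + a) k θ) F.ν := fun a ha θ =>
    F.integrable_pw hB (by linarith) (by omega) θ
  refine ⟨(|1 + a₂| + k * D + 1) * ∫ y, g y ∂F.ν, by positivity,
    fun a ha θ hθ y => ⟨?_, fun a' ha' θ' hθ' => ?_⟩⟩
  · have h1 : |F.ipw (1 + a) k θ| ≤ ∫ y, g y ∂F.ν := by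
      refine (abs_integral_le_integral_abs).trans ?_
      refine integral_mono (hI a ha.1 θ).abs hg fun y => ?_
      exact (F.abs_pw_le (by omega) _ θ y).trans
        (hgb (1 + a) (by linarith [ha.1]) (by linarith [ha.2]) θ hθ y)
    refine h1.trans (le_mul_of_one_le_left hI0 ?_)
    have : 0 ≤ |1 + a₂| + k * D := by positivity
    linarith
  · simp only [ipw]
    rw [← integral_sub (hI a ha.1 θ) (hI a' ha'.1 θ')]
    refine (abs_integral_le_integral_abs).trans ?_
    rw [mul_right_comm, ← integral_const_mul]
    refine integral_mono ((hI a ha.1 θ).sub (hI a' ha'.1 θ')).abs (hg.const_mul _) fun y => ?_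
    have h1 := F.abs_pw_sub_le (a₁ := 1 + a₁) (a₂ := 1 + a₂) (by linarith) hD
      (fun b h h' θ hθ => hgb b h h' θ hθ y) hk (a := 1 + a) (a' := 1 + a') (by linarith [ha.1])
      (by linarith [ha.2]) (by linarith [ha'.1]) (by linarith [ha'.2]) hθ hθ'
    rw [add_sub_add_left_eq_sub] at h1
    simp only
    refine h1.trans ?_
    have := hg0 y
    calc (1 + a₂ + k * D + 1) * g y * (|a - a'| + |θ - θ'|)
        ≤ (|1 + a₂| + k * D + 1) * g y * (|a - a'| + |θ - θ'|) := by
          gcongr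
          exact le_abs_self _
      _ = _ := by ring

/-- The derivative of the loss in `θ`. -/
noncomputable def lossDeriv (α y θ : ℝ) : ℝ :=
  (1 + α) * (F.ipw (1 + α) 1 θ - F.pw α 1 θ y)

/-- The second derivative of the loss in `θ`. -/
noncomputable def lossDeriv2 (α y θ : ℝ) : ℝ :=
  (1 + α) * ((1 + α) * F.ipw (1 + α) 2 θ - F.b2 θ * F.ipw (1 + α) 0 θ -
    (α * F.pw α 2 θ y - F.b2 θ * F.pw α 0 θ y))

include hB in
lemma hasDerivAt_dpdLoss {α : ℝ} (hα : 0 < α) (y θ : ℝ) :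
    HasDerivAt (F.dpdLoss α y) (F.lossDeriv α y θ) θ := by
  have h1 : F.dpdLoss α y = fun θ => F.ipw (1 + α) 0 θ - (1 + 1 / α) * F.density θ y ^ α := by
    funext θ
    simp [dpdLoss, ipw, pw]
  rw [h1]
  have h2 := (F.hasDerivAt_ipw hB (show 1 < 1 + α by linarith) (k := 0) (by omega) θ).sub
    ((F.hasDerivAt_density_rpow hα θ y).const_mul (1 + 1 / α))
  refine h2.congr_deriv ?_
  rw [lossDeriv]
  push_cast
  field_simp
  ring

include hB in
lemma hasDerivAt_lossDeriv {α : ℝ} (hα : 0 < α) (y θ : ℝ) :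
    HasDerivAt (F.lossDeriv α y) (F.lossDeriv2 α y θ) θ := by
  have h2 := ((F.hasDerivAt_ipw hB (show 1 < 1 + α by linarith) (k := 1) (by omega) θ).sub
    (F.hasDerivAt_pw hα 1 θ y)).const_mul (1 + α)
  refine h2.congr_deriv ?_
  rw [lossDeriv2]
  simp

include hB in
lemma isBddLip_lossDeriv2 {a₁ : ℝ} (ha₁ : 0 < a₁) (a₂ T : ℝ) :
    IsBddLip a₁ a₂ T fun a θ y => F.lossDeriv2 a y θ := by
  have h1 : IsBddLip a₁ a₂ T fun a _ _ => 1 + a :=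
    (IsBddLip.const _ _ _ 1).add (IsBddLip.exponent ha₁.le)
  have hb := F.isBddLip_b2 a₁ a₂ T
  exact h1.mul (((h1.mul (F.isBddLip_ipw hB ha₁ a₂ T (k := 2) (by omega))).sub
    (hb.mul (F.isBddLip_ipw hB ha₁ a₂ T (k := 0) (by omega)))).sub
    (((IsBddLip.exponent ha₁.le).mul (F.isBddLip_pw hB ha₁ a₂ T (k := 2) (by omega))).sub
    (hb.mul (F.isBddLip_pw hB ha₁ a₂ T (k := 0) (by omega)))))

/-- A quadratic lower bound for increments of the loss. -/
lemma exists_loss_increment_bound {α₀ : ℝ} (hα₀ : 0 < α₀) (T : ℝ)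
    (hB : ∃ B : ℝ, ∀ θ y, F.density θ y ≤ B) : ∃ C : ℝ, 0 ≤ C ∧ ∀ ε > 0, ∃ η > 0, η < α₀ / 2 ∧
    ∀ α, |α - α₀| ≤ η → ∀ θ, |θ| ≤ T → ∀ u h, |u| ≤ η → |h| ≤ η → ∀ y,
      F.lossDeriv α y θ * h - C * (|u| * |h|) + (F.lossDeriv2 α₀ y θ - ε) / 2 * h ^ 2 ≤
        F.dpdLoss α y (θ + u + h) - F.dpdLoss α y (θ + u) := by
  obtain ⟨C, hC0, hC⟩ := F.isBddLip_lossDeriv2 hB (half_pos hα₀) (2 * α₀) (T + 2)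
  refine ⟨C, hC0, fun ε hε => ?_⟩
  -- The three entries keep `α` within `[α₀ / 2, 2 α₀]`, make the Lipschitz error `3 C η` at most
  -- `ε`, and keep all arguments within `T + 2`.
  refine ⟨min (min (α₀ / 4) (ε / (4 * (C + 1)))) 1, by positivity, ?_, ?_⟩
  · refine ((min_le_left _ _).trans (min_le_left _ _)).trans_lt ?_
    linarith
  intro α hα θ hθ u h hu hh y
  set η := min (min (α₀ / 4) (ε / (4 * (C + 1)))) 1 with hη
  have hη1 : η ≤ 1 := min_le_right _ _
  have hη2 : η ≤ α₀ / 4 := (min_le_left _ _).trans (min_le_left _ _)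
  have hη3 : C * (3 * η) ≤ ε := by
    have : η ≤ ε / (4 * (C + 1)) := (min_le_left _ _).trans (min_le_right _ _)
    rw [le_div_iff₀ (by positivity)] at this
    have hη0 : 0 ≤ η := (abs_nonneg _).trans hu
    nlinarith
  have hα' := abs_le.1 hα
  have hαI : α ∈ Icc (α₀ / 2) (2 * α₀) := ⟨by linarith [hα'.1], by linarith [hα'.2]⟩
  have hα₀I : α₀ ∈ Icc (α₀ / 2) (2 * α₀) := ⟨by linarith, by linarith⟩
  have hα0 : 0 < α := by linarith [hαI.1]
  have hψ := fun z => F.hasDerivAt_dpdLoss hB hα0 y z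
  have hψ2 := fun z => F.hasDerivAt_lossDeriv hB hα0 y z
  -- The second derivative is compared with its value at `α₀` and the true parameter, uniformly in
  -- `y`, so that only a sum free of the random tuning parameter needs a stochastic bound.
  have hlow : ∀ v, |v| ≤ 2 * η → F.lossDeriv2 α₀ y θ - ε ≤ F.lossDeriv2 α y (θ + v) := by
    intro v hv
    have h1 := (hC α₀ hα₀I θ (by linarith) y).2 α hαI (θ + v)
      ((abs_add_le _ _).trans (by linarith))
    have h2 : |α₀ - α| + |θ - (θ + v)| ≤ 3 * η := by
      rw [abs_sub_comm, sub_add_cancel_left, abs_neg]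
      linarith
    have h3 := (abs_le.1 (h1.trans (mul_le_mul_of_nonneg_left h2 hC0))).2
    linarith
  -- the first derivative at the shifted point
  have hu1 : |F.lossDeriv α y (θ + u) - F.lossDeriv α y θ| ≤ C * |u| := by
    have := Convex.norm_image_sub_le_of_norm_hasDerivWithin_le (s := Icc (-(T + 2)) (T + 2))
      (C := C) (f := F.lossDeriv α y) (x := θ) (y := θ + u)
      (fun z _ => (hψ2 z).hasDerivWithinAt)
      (fun z hz => (hC α hαI z (abs_le.2 hz) y).1) (convex_Icc _ _)
      (abs_le.1 (by linarith)) (abs_le.1 ((abs_add_le _ _).trans (by linarith)))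
    simpa [Real.norm_eq_abs] using this
  set κ := F.lossDeriv2 α₀ y θ - ε with hκ
  -- second order expansion
  have hmono : ∀ s ∈ Icc (0 : ℝ) 1, F.lossDeriv α y (θ + u) * h * s + κ / 2 * h ^ 2 * s ^ 2 ≤
      F.dpdLoss α y (θ + u + s * h) - F.dpdLoss α y (θ + u) := by
    have hlin : ∀ s : ℝ, HasDerivAt (fun s : ℝ => θ + u + s * h) h s := fun s => by
      simpa using ((hasDerivAt_id s).mul_const h).const_add (θ + u)
    have hf1 : ∀ s : ℝ, HasDerivAt (fun s => F.dpdLoss α y (θ + u + s * h))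
        (F.lossDeriv α y (θ + u + s * h) * h) s := fun s => (hψ _).comp s (hlin s)
    have hf2 : ∀ s : ℝ, HasDerivAt (fun s => F.lossDeriv α y (θ + u + s * h) * h)
        (F.lossDeriv2 α y (θ + u + s * h) * h * h) s := fun s =>
      ((hψ2 _).comp s (hlin s)).mul_const h
    have hs2 : ∀ s ∈ Icc (0 : ℝ) 1, |u + s * h| ≤ 2 * η := by
      intro s hs
      refine (abs_add_le _ _).trans ?_
      rw [abs_mul, abs_of_nonneg hs.1]
      have : s * |h| ≤ 1 * |h| := mul_le_mul_of_nonneg_right hs.2 (abs_nonneg _)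
      linarith
    have hg1 : MonotoneOn (fun s => F.lossDeriv α y (θ + u + s * h) * h - κ * h ^ 2 * s)
        (Icc 0 1) := by
      refine monotoneOn_of_hasDerivWithinAt_nonneg (convex_Icc 0 1) (fun s _ =>
        ((hf2 s).sub ((hasDerivAt_id s).const_mul (κ * h ^ 2))).continuousAt.continuousWithinAt)
        (fun s _ => ((hf2 s).sub ((hasDerivAt_id s).const_mul (κ * h ^ 2))).hasDerivWithinAt)
        fun s hs => ?_
      rw [interior_Icc] at hs
      have := hlow (u + s * h) (hs2 s (Ioo_subset_Icc_self hs))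
      rw [← add_assoc] at this
      nlinarith [sq_nonneg h]
    have hg0 : ∀ s ∈ Icc (0 : ℝ) 1, F.lossDeriv α y (θ + u) * h + κ * h ^ 2 * s ≤
        F.lossDeriv α y (θ + u + s * h) * h := by
      intro s hs
      have := hg1 (left_mem_Icc.2 zero_le_one) hs hs.1
      simp only [zero_mul, add_zero, mul_zero, sub_zero] at this
      linarith
    have hd : ∀ s : ℝ, HasDerivAt (fun s => F.dpdLoss α y (θ + u + s * h) -
        (F.lossDeriv α y (θ + u) * h * s + κ / 2 * h ^ 2 * s ^ 2))
        (F.lossDeriv α y (θ + u + s * h) * h - (F.lossDeriv α y (θ + u) * h + κ * h ^ 2 * s)) s := by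
      intro s
      refine ((hf1 s).sub (((hasDerivAt_id s).const_mul _).add
        ((hasDerivAt_pow 2 s).const_mul _))).congr_deriv ?_
      push_cast
      ring
    have hg2 : MonotoneOn (fun s => F.dpdLoss α y (θ + u + s * h) -
        (F.lossDeriv α y (θ + u) * h * s + κ / 2 * h ^ 2 * s ^ 2)) (Icc 0 1) := by
      refine monotoneOn_of_hasDerivWithinAt_nonneg (convex_Icc 0 1)
        (fun s _ => (hd s).continuousAt.continuousWithinAt)
        (fun s _ => (hd s).hasDerivWithinAt) fun s hs => ?_
      rw [interior_Icc] at hs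
      have := hg0 s (Ioo_subset_Icc_self hs)
      linarith
    intro s hs
    have := hg2 (left_mem_Icc.2 zero_le_one) hs hs.1
    simp only [zero_mul, add_zero, mul_zero, sub_zero, ne_eq, OfNat.ofNat_ne_zero,
      not_false_eq_true, zero_pow] at this
    linarith
  have h1 := hmono 1 (right_mem_Icc.2 zero_le_one)
  rw [one_mul] at h1
  have h2 : F.lossDeriv α y θ * h - C * (|u| * |h|) ≤ F.lossDeriv α y (θ + u) * h := by
    have h3 : |(F.lossDeriv α y (θ + u) - F.lossDeriv α y θ) * h| ≤ C * |u| * |h| := by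
      rw [abs_mul]
      gcongr
    have := (abs_le.1 h3).1
    linarith
  linarith

/-! #### Moments under the model -/

/-- With `k = 1` this makes the derivative of the loss at the true parameter centered for every `α >
0`. -/
lemma integral_law_pw {α : ℝ} (hα : 0 < α) (k : ℕ) (θ : ℝ) :
    ∫ y, F.pw α k θ y ∂F.law θ = F.ipw (1 + α) k θ := by
  rw [F.integral_law, ipw]
  refine integral_congr_ae (Eventually.of_forall fun y => ?_)
  simp only [pw]
  rw [Real.rpow_one_add' (F.density_nonneg θ y) (by linarith), mul_assoc]

instance isProbabilityMeasure_law (θ : ℝ) : IsProbabilityMeasure (F.law θ) :=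
  ⟨by rw [law, withDensity_apply _ MeasurableSet.univ, Measure.restrict_univ, F.lintegral_density]⟩

include hB in
lemma integrable_law_pw {α : ℝ} (hα : 0 < α) {k : ℕ} (hk : k ≤ 3) (θ : ℝ) :
    Integrable (F.pw α k θ) (F.law θ) := by
  obtain ⟨C, -, hC⟩ := F.isBddLip_pw hB hα α |θ| hk
  refine Integrable.of_bound (F.measurable_pw α k θ).aestronglyMeasurable C
    (Eventually.of_forall fun y => ?_)
  exact (hC α (by simp) θ le_rfl y).1

include hB in
-- Under the model the terms with `b''` cancel, and `(1 + α) - α = 1` copy of the positive term with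
-- `k = 2` remains: the source of the quadratic growth.
lemma integral_law_lossDeriv2 {α : ℝ} (hα : 0 < α) (θ : ℝ) :
    ∫ y, F.lossDeriv2 α y θ ∂F.law θ = (1 + α) * ∫ y, F.pw α 2 θ y ∂F.law θ := by
  have h0 := F.integrable_law_pw hB hα (k := 0) (by omega) θ
  have h2 := F.integrable_law_pw hB hα (k := 2) (by omega) θ
  have h3 : Integrable (fun y => α * F.pw α 2 θ y - F.b2 θ * F.pw α 0 θ y) (F.law θ) :=
    (h2.const_mul _).sub (h0.const_mul _)
  simp only [lossDeriv2]
  rw [integral_const_mul, integral_sub (integrable_const _) h3,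
    integral_sub (h2.const_mul _) (h0.const_mul _), integral_const_mul, integral_const_mul,
    F.integral_law_pw hα, F.integral_law_pw hα, integral_const, probReal_univ, one_smul]
  ring

end ExpFamily

/-! ### Second moments of sums of independent bounded variables -/

section Moments

variable {Ω : Type*} [MeasurableSpace Ω] {P : Measure Ω} [IsProbabilityMeasure P] {n : ℕ}
  {Y : Fin n → Ω → ℝ}

lemma lintegral_sq_sum_centered_le (hY : ∀ i, Measurable (Y i)) (hind : iIndepFun Y P)
    {v : Fin n → ℝ → ℝ} (hv : ∀ i, Measurable (v i)) {C : ℝ} (hC : ∀ i y, |v i y| ≤ C)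
    (c : Fin n → ℝ) :
    ∫⁻ ω, ENNReal.ofReal ((∑ i, c i * (v i (Y i ω) - ∫ ω', v i (Y i ω') ∂P)) ^ 2) ∂P ≤
      ENNReal.ofReal (C ^ 2 * ∑ i, c i ^ 2) := by
  let X : Fin n → Ω → ℝ := fun i ω => c i * v i (Y i ω)
  have hXm : ∀ i, Measurable (X i) := fun i => ((hv i).comp (hY i)).const_mul (c i)
  have hXb : ∀ i ω, ‖X i ω‖ ≤ |c i| * C := fun i ω => by
    rw [Real.norm_eq_abs, abs_mul]
    exact mul_le_mul_of_nonneg_left (hC i _) (abs_nonneg _)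
  have hX2 : ∀ i, MemLp (X i) 2 P := fun i =>
    MemLp.of_bound (hXm i).aestronglyMeasurable _ (Eventually.of_forall (hXb i))
  have hvar : variance (∑ i, X i) P = ∑ i, variance (X i) P := by
    refine IndepFun.variance_sum (fun i _ => hX2 i) fun i _ k _ hik => ?_
    exact (hind.indepFun hik).comp ((hv i).const_mul (c i)) ((hv k).const_mul (c k))
  have hvi : ∀ i, variance (X i) P ≤ C ^ 2 * c i ^ 2 := by
    intro i
    refine (variance_le_expectation_sq (hXm i).aestronglyMeasurable).trans ?_
    calc ∫ ω, (X i ^ 2) ω ∂P ≤ ∫ _, (C ^ 2 * c i ^ 2) ∂P := by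
          refine integral_mono_of_nonneg (Eventually.of_forall fun _ => sq_nonneg _)
            (integrable_const _) (Eventually.of_forall fun ω => ?_)
          have := pow_le_pow_left₀ (norm_nonneg _) (hXb i ω) 2
          rw [Real.norm_eq_abs, sq_abs, mul_pow |c i|, sq_abs (c i)] at this
          simp only [Pi.pow_apply]
          linarith
      _ = _ := by simp
  have hS2 : MemLp (∑ i, X i) 2 P := memLp_finsetSum' _ fun i _ => hX2 i
  have hmean : ∫ ω, (∑ i, X i) ω ∂P = ∑ i, c i * ∫ ω, v i (Y i ω) ∂P := by
    simp only [Finset.sum_apply]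
    rw [integral_finsetSum _ fun i _ => (hX2 i).integrable (by norm_num)]
    exact Finset.sum_congr rfl fun i _ => integral_const_mul _ _
  calc _ = evariance (∑ i, X i) P := by
        rw [evariance_eq_lintegral_ofReal, hmean]
        refine lintegral_congr fun ω => ?_
        congr 2
        rw [Finset.sum_apply, ← Finset.sum_sub_distrib]
        exact Finset.sum_congr rfl fun i _ => by simp only [X]; ring
    _ = ENNReal.ofReal (variance (∑ i, X i) P) := (hS2.ofReal_variance_eq).symm
    _ ≤ _ := by
        refine ENNReal.ofReal_le_ofReal ?_
        rw [hvar, Finset.mul_sum]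
        exact Finset.sum_le_sum fun i _ => hvi i

/-- Write `X α = X a + ∫ X'` and apply Cauchy–Schwarz. The bound does not depend on `α`, so second
moments of `X a` and of `X'` control the whole path of a smooth process. -/
lemma ofReal_sq_le_of_hasDerivAt {X X' : ℝ → ℝ} {a b D : ℝ} (hab : a ≤ b)
    (hd : ∀ s ∈ Icc a b, HasDerivAt X (X' s) s) (hm : Measurable X')
    (hD : ∀ s ∈ Icc a b, |X' s| ≤ D) {α : ℝ} (hα : α ∈ Icc a b) :
    ENNReal.ofReal (X α ^ 2) ≤ ENNReal.ofReal 2 * ENNReal.ofReal (X a ^ 2) +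
      ENNReal.ofReal (2 * (b - a)) * ∫⁻ s in Ioc a b, ENNReal.ofReal (X' s ^ 2) := by
  have hba : 0 ≤ b - a := sub_nonneg.2 hab
  have hint : ∀ β ∈ Icc a b, IntervalIntegrable X' volume a β ∧
      IntervalIntegrable (fun s => X' s ^ 2) volume a β := by
    intro β hβ
    rw [intervalIntegrable_iff_integrableOn_Ioc_of_le hβ.1,
      intervalIntegrable_iff_integrableOn_Ioc_of_le hβ.1]
    constructor
    · refine Measure.integrableOn_of_bounded (M := D) (by simp) hm.aestronglyMeasurable ?_
      filter_upwards [ae_restrict_mem measurableSet_Ioc] with s hs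
      exact hD s ⟨hs.1.le, hs.2.trans hβ.2⟩
    · refine Measure.integrableOn_of_bounded (M := D ^ 2) (by simp)
        (hm.pow_const 2).aestronglyMeasurable ?_
      filter_upwards [ae_restrict_mem measurableSet_Ioc] with s hs
      rw [norm_pow]
      exact pow_le_pow_left₀ (norm_nonneg _) (hD s ⟨hs.1.le, hs.2.trans hβ.2⟩) 2
  have hI : ∫ s in a..α, X' s = X α - X a := by
    refine intervalIntegral.integral_eq_sub_of_hasDerivAt (fun s hs => hd s ?_) (hint α hα).1
    rw [uIcc_of_le hα.1] at hs
    exact ⟨hs.1, hs.2.trans hα.2⟩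
  have h1 := sq_intervalIntegral_le hα.1 (hint α hα).1 (hint α hα).2
  have hbint := (hint b ⟨hab, le_rfl⟩).2
  have h2 : ∫ s in a..α, X' s ^ 2 ≤ ∫ s in a..b, X' s ^ 2 :=
    intervalIntegral.integral_mono_interval le_rfl hα.1 hα.2
      (Eventually.of_forall fun _ => sq_nonneg _) hbint
  have h0 : 0 ≤ ∫ s in a..α, X' s ^ 2 :=
    intervalIntegral.integral_nonneg hα.1 fun _ _ => sq_nonneg _
  have hb0 : 0 ≤ ∫ s in a..b, X' s ^ 2 := h0.trans h2
  have h3 : (X α - X a) ^ 2 ≤ (b - a) * ∫ s in a..b, X' s ^ 2 := by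
    rw [← hI]
    exact h1.trans (mul_le_mul (by linarith [hα.2]) h2 h0 hba)
  have h4 : X α ^ 2 ≤ 2 * X a ^ 2 + 2 * (b - a) * ∫ s in a..b, X' s ^ 2 := by
    nlinarith [sq_nonneg (X α - 2 * X a)]
  have h5 : ENNReal.ofReal (∫ s in a..b, X' s ^ 2) =
      ∫⁻ s in Ioc a b, ENNReal.ofReal (X' s ^ 2) := by
    rw [intervalIntegral.integral_of_le hab]
    exact ofReal_integral_eq_lintegral_ofReal
      ((intervalIntegrable_iff_integrableOn_Ioc_of_le hab).1 hbint)
      (Eventually.of_forall fun _ => sq_nonneg _)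
  refine (ENNReal.ofReal_le_ofReal h4).trans_eq ?_
  rw [ENNReal.ofReal_add (by positivity) (by positivity), ENNReal.ofReal_mul (by norm_num),
    ENNReal.ofReal_mul (by positivity : 0 ≤ 2 * (b - a)), h5]

lemma hasDerivAt_sum_centered (hY : ∀ i, Measurable (Y i)) {a' b' : ℝ} {v v' : Fin n → ℝ → ℝ → ℝ}
    (hv : ∀ i α, Measurable (v i α)) (hv' : ∀ i α, Measurable (v' i α))
    (hd : ∀ i, ∀ α ∈ Ioo a' b', ∀ y, HasDerivAt (fun α => v i α y) (v' i α y) α) {C : ℝ}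
    (hC : ∀ i, ∀ α ∈ Ioo a' b', ∀ y, |v i α y| ≤ C) (hC' : ∀ i, ∀ α ∈ Ioo a' b', ∀ y, |v' i α y| ≤ C)
    (c : Fin n → ℝ) (ω : Ω) {α : ℝ} (hα : α ∈ Ioo a' b') :
    HasDerivAt (fun α => ∑ i, c i * (v i α (Y i ω) - ∫ ω', v i α (Y i ω') ∂P))
      (∑ i, c i * (v' i α (Y i ω) - ∫ ω', v' i α (Y i ω') ∂P)) α := by
  refine HasDerivAt.fun_sum fun i _ => ((hd i α hα (Y i ω)).sub ?_).const_mul (c i)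
  exact (hasDerivAt_integral_of_dominated_loc_of_deriv_le (μ := P) (s := Ioo a' b')
    (F := fun α ω => v i α (Y i ω)) (F' := fun α ω => v' i α (Y i ω)) (bound := fun _ => C)
    (isOpen_Ioo.mem_nhds hα)
    (Eventually.of_forall fun η => ((hv i η).comp (hY i)).aestronglyMeasurable)
    (Integrable.of_bound ((hv i α).comp (hY i)).aestronglyMeasurable C
      (Eventually.of_forall fun ω => hC i α hα _))
    ((hv' i α).comp (hY i)).aestronglyMeasurable
    (Eventually.of_forall fun ω η hη => hC' i η hη _) (integrable_const _)
    (Eventually.of_forall fun ω η hη => hd i η hη _)).2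

lemma measurable_sum_centered (hY : ∀ i, Measurable (Y i)) {v' : Fin n → ℝ → ℝ → ℝ}
    (hv' : ∀ i, Measurable fun z : ℝ × ℝ => v' i z.1 z.2) (c : Fin n → ℝ) :
    Measurable fun z : Ω × ℝ =>
      ∑ i, c i * (v' i z.2 (Y i z.1) - ∫ ω', v' i z.2 (Y i ω') ∂P) := by
  refine Finset.measurable_fun_sum _ fun i _ => ?_
  have h1 : Measurable fun z : ℝ × Ω => v' i z.1 (Y i z.2) :=
    (hv' i).comp (measurable_fst.prodMk ((hY i).comp measurable_snd))
  have h2 : Measurable fun s : ℝ => ∫ ω', v' i s (Y i ω') ∂P :=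
    (h1.stronglyMeasurable.integral_prod_right').measurable
  exact ((h1.comp measurable_swap).sub (h2.comp measurable_snd)).const_mul (c i)

lemma abs_sum_centered_le {w : Fin n → ℝ → ℝ} {C : ℝ} (hC : ∀ i y, |w i y| ≤ C)
    (c : Fin n → ℝ) (ω : Ω) :
    |∑ i, c i * (w i (Y i ω) - ∫ ω', w i (Y i ω') ∂P)| ≤ ∑ i, |c i| * (2 * C) := by
  refine (Finset.abs_sum_le_sum_abs _ _).trans (Finset.sum_le_sum fun i _ => ?_)
  rw [abs_mul]
  refine mul_le_mul_of_nonneg_left ((abs_sub _ _).trans ?_) (abs_nonneg _)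
  have h1 := hC i (Y i ω)
  have h2 : |∫ ω', w i (Y i ω') ∂P| ≤ C := by
    have := norm_integral_le_of_norm_le_const (μ := P) (f := fun ω' => w i (Y i ω'))
      (Eventually.of_forall fun ω' => hC i (Y i ω'))
    simpa using this
  linarith

/-- A bound, uniform in a real parameter, for the square of a centered sum of independent
variables that depend smoothly on the parameter. -/
lemma exists_uniform_sq_bound (hY : ∀ i, Measurable (Y i)) (hind : iIndepFun Y P)
    {a b a' b' : ℝ} (hab : a ≤ b) (ha : a' < a) (hb : b < b') {v v' : Fin n → ℝ → ℝ → ℝ}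
    (hv : ∀ i α, Measurable (v i α)) (hv' : ∀ i, Measurable fun z : ℝ × ℝ => v' i z.1 z.2)
    (hd : ∀ i, ∀ α ∈ Ioo a' b', ∀ y, HasDerivAt (fun α => v i α y) (v' i α y) α) {C : ℝ}
    (hC : ∀ i, ∀ α ∈ Ioo a' b', ∀ y, |v i α y| ≤ C) (hC' : ∀ i, ∀ α ∈ Ioo a' b', ∀ y, |v' i α y| ≤ C)
    (c : Fin n → ℝ) :
    ∃ W : Ω → ENNReal, Measurable W ∧
      (∀ ω, ∀ α ∈ Icc a b, ENNReal.ofReal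
        ((∑ i, c i * (v i α (Y i ω) - ∫ ω', v i α (Y i ω') ∂P)) ^ 2) ≤ W ω) ∧
      ∫⁻ ω, W ω ∂P ≤ ENNReal.ofReal ((2 + 2 * (b - a) ^ 2) * C ^ 2 * ∑ i, c i ^ 2) := by
  have hba : 0 ≤ b - a := sub_nonneg.2 hab
  have hsub : Icc a b ⊆ Ioo a' b' := fun s hs => ⟨ha.trans_le hs.1, hs.2.trans_lt hb⟩
  have hv'α : ∀ i α, Measurable (v' i α) := fun i α =>
    (hv' i).comp (measurable_const.prodMk measurable_id)
  have hXd := fun ω α hα => hasDerivAt_sum_centered (P := P) hY hv hv'α hd hC hC' c ω (α := α) hα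
  have hX'm := measurable_sum_centered (P := P) hY hv' c
  have hXm : Measurable fun ω => ∑ i, c i * (v i a (Y i ω) - ∫ ω', v i a (Y i ω') ∂P) :=
    Finset.measurable_fun_sum _ fun i _ => (((hv i a).comp (hY i)).sub_const _).const_mul (c i)
  have hX'b := fun ω α hα => abs_sum_centered_le (P := P) (Y := Y) (w := fun i => v' i α)
    (fun i y => hC' i α hα y) c ω
  have e1 := lintegral_sq_sum_centered_le (P := P) hY hind (fun i => hv i a)
        (fun i y => hC i a (hsub ⟨le_rfl, hab⟩) y) c
  have e2 := fun s hs => lintegral_sq_sum_centered_le (P := P) hY hind (fun i => hv'α i s)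
              (fun i y => hC' i s hs y) c
  generalize hXe : (fun α ω => ∑ i, c i * (v i α (Y i ω) - ∫ ω', v i α (Y i ω') ∂P)) = X at *
  generalize hXe' : (fun α ω => ∑ i, c i * (v' i α (Y i ω) - ∫ ω', v' i α (Y i ω') ∂P)) = X' at *
  have hX : ∀ α ω, ∑ i, c i * (v i α (Y i ω) - ∫ ω', v i α (Y i ω') ∂P) = X α ω := fun α ω =>
    congrFun (congrFun hXe α) ω
  have hX' : ∀ α ω, ∑ i, c i * (v' i α (Y i ω) - ∫ ω', v' i α (Y i ω') ∂P) = X' α ω := fun α ω =>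
    congrFun (congrFun hXe' α) ω
  simp only [hX, hX'] at *
  have hX'2m : Measurable fun z : Ω × ℝ => ENNReal.ofReal (X' z.2 z.1 ^ 2) :=
    (hX'm.pow_const 2).ennreal_ofReal
  -- An explicit measurable majorant, so that measurability of a supremum over `α` never arises.
  refine ⟨fun ω => ENNReal.ofReal 2 * ENNReal.ofReal (X a ω ^ 2) + ENNReal.ofReal (2 * (b - a)) *
    ∫⁻ s in Ioc a b, ENNReal.ofReal (X' s ω ^ 2), ?_, fun ω α hα => ?_, ?_⟩
  · exact ((hXm.pow_const 2).ennreal_ofReal.const_mul _).add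
      ((hX'2m.lintegral_prod_right').const_mul _)
  · exact ofReal_sq_le_of_hasDerivAt (X := fun α => X α ω) hab (fun s hs => hXd ω s (hsub hs))
      (hX'm.comp (measurable_const.prodMk measurable_id)) (fun s hs => hX'b ω s (hsub hs)) hα
  · have hS0 : 0 ≤ C ^ 2 * ∑ i, c i ^ 2 := by positivity
    have e2' : ∫⁻ ω, (∫⁻ s in Ioc a b, ENNReal.ofReal (X' s ω ^ 2)) ∂P ≤
        ENNReal.ofReal (b - a) * ENNReal.ofReal (C ^ 2 * ∑ i, c i ^ 2) := by
      rw [lintegral_lintegral_swap hX'2m.aemeasurable]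
      calc _ ≤ ∫⁻ s in Ioc a b, ENNReal.ofReal (C ^ 2 * ∑ i, c i ^ 2) :=
            setLIntegral_mono measurable_const fun s hs => e2 s (hsub (Ioc_subset_Icc_self hs))
        _ = _ := by rw [setLIntegral_const, Real.volume_Ioc, mul_comm]
    rw [lintegral_add_left ((hXm.pow_const 2).ennreal_ofReal.const_mul _),
      lintegral_const_mul _ (hXm.pow_const 2).ennreal_ofReal,
      lintegral_const_mul _ hX'2m.lintegral_prod_right']
    calc _ ≤ ENNReal.ofReal 2 * ENNReal.ofReal (C ^ 2 * ∑ i, c i ^ 2) + ENNReal.ofReal (2 * (b - a)) *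
          (ENNReal.ofReal (b - a) * ENNReal.ofReal (C ^ 2 * ∑ i, c i ^ 2)) := by gcongr
      _ = _ := by
          rw [← ENNReal.ofReal_mul (by norm_num), ← ENNReal.ofReal_mul hba,
            ← ENNReal.ofReal_mul (by positivity), ← ENNReal.ofReal_add (by positivity)
              (by positivity)]
          congr 1
          ring

end Moments

/-! ### Evaluation bounds in the penalized norm -/

lemma minNegPow_pos {a lam e : ℝ} (ha : 0 < a) (hlam : 0 ≤ lam) : 0 < minNegPow a lam e := by
  rw [minNegPow]
  split_ifs with h
  · exact ha
  · exact lt_min ha (Real.rpow_pos_of_pos (lt_of_le_of_ne hlam (Ne.symm h)) _)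

lemma minNegPow_le {a lam e : ℝ} : minNegPow a lam e ≤ a := by
  rw [minNegPow]
  split_ifs with h
  · exact le_rfl
  · exact min_le_left _ _

/-- The factor `K` is the supremum bound for splines. The factor `lam^{-1/(2m)}` is the Sobolev
bound with window `a = lam^{1/(2m)}`, for which `a^{2m} = lam` produces exactly the penalized norm;
`lam ≤ 1` ensures `a ≤ 1`. -/
lemma exists_spline_eval_bound (p m : ℕ) (hm : 1 ≤ m) (hmp : m < p) (M : ℝ) : ∃ C : ℝ, 0 < C ∧
    ∀ (K : ℕ) (x : ℕ → ℝ), 1 ≤ K → IsKnotSeq K x →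
    (∀ i ≤ K, ∀ k ≤ K, x (i + 1) - x i ≤ M * (x (k + 1) - x k)) →
    ∀ lam : ℝ, 0 ≤ lam → lam ≤ 1 → ∀ h, IsSpline p K x h → ∀ t ∈ Icc (0 : ℝ) 1,
      h t ^ 2 ≤ C * minNegPow K lam (1 / (2 * m : ℝ)) *
        (sqNorm h + lam * sqNorm (iteratedDeriv m h)) := by
  obtain ⟨C₁, hC₁, h1⟩ := exists_spline_sup_bound p M
  obtain ⟨C₂, hC₂, h2⟩ := exists_spline_sobolev_bound m hm
  refine ⟨max (2 * C₁) C₂, by positivity, fun K x hK hx hM lam hlam hlam1 h hh t ht => ?_⟩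
  have hK' : (1 : ℝ) ≤ K := by exact_mod_cast hK
  set N := sqNorm h + lam * sqNorm (iteratedDeriv m h) with hN
  have hs0 := sqNorm_nonneg h
  have hd0 : 0 ≤ lam * sqNorm (iteratedDeriv m h) := mul_nonneg hlam (sqNorm_nonneg _)
  have hN0 : 0 ≤ N := by positivity
  have hK1 : h t ^ 2 ≤ max (2 * C₁) C₂ * K * N := by
    calc h t ^ 2 ≤ C₁ * (K + 1) * sqNorm h := h1 K x hx hM h hh t ht
      _ ≤ C₁ * (2 * K) * N := by
          gcongr
          · linarith
          · linarith
      _ = 2 * C₁ * K * N := by ring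
      _ ≤ _ := by
          gcongr
          exact le_max_left _ _
  rw [minNegPow]
  split_ifs with h0
  · exact hK1
  have hlam0 : 0 < lam := lt_of_le_of_ne hlam (Ne.symm h0)
  have hm0 : (0 : ℝ) < 2 * m := by positivity
  have ha0 : 0 < lam ^ (1 / (2 * m : ℝ)) := Real.rpow_pos_of_pos hlam0 _
  have ha1 : lam ^ (1 / (2 * m : ℝ)) ≤ 1 := Real.rpow_le_one hlam hlam1 (by positivity)
  have hpow : (lam ^ (1 / (2 * m : ℝ))) ^ (2 * m) = lam := by
    rw [← Real.rpow_natCast, ← Real.rpow_mul hlam]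
    push_cast
    rw [one_div_mul_cancel hm0.ne', Real.rpow_one]
  have h3 := h2 p K x hmp hx h hh _ ha0 ha1 t ht
  rw [hpow, ← hN] at h3
  have hL1 : h t ^ 2 ≤ max (2 * C₁) C₂ * lam ^ (-(1 / (2 * m : ℝ))) * N := by
    rw [Real.rpow_neg hlam]
    calc h t ^ 2 = (h t ^ 2 * lam ^ (1 / (2 * m : ℝ))) * (lam ^ (1 / (2 * m : ℝ)))⁻¹ := by
          field_simp
      _ ≤ C₂ * N * (lam ^ (1 / (2 * m : ℝ)))⁻¹ := by gcongr
      _ ≤ max (2 * C₁) C₂ * N * (lam ^ (1 / (2 * m : ℝ)))⁻¹ := by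
          gcongr
          exact le_max_right _ _
      _ = _ := by ring
  rcases min_cases (K : ℝ) (lam ^ (-(1 / (2 * m : ℝ)))) with h4 | h4
  · rw [h4.1]; exact hK1
  · rw [h4.1]; exact hL1

/-! ### Local minimizers from a sphere condition -/

/-- The linear combination `∑ k, β k * φ k`. -/
noncomputable def linComb {N : ℕ} (φ : Fin N → ℝ → ℝ) (β : EuclideanSpace ℝ (Fin N)) : ℝ → ℝ :=
  fun t => ∑ k, β k * φ k t

section LinComb

variable {N : ℕ} {φ : Fin N → ℝ → ℝ}

lemma linComb_sub (β γ : EuclideanSpace ℝ (Fin N)) (t : ℝ) :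
    linComb φ (β - γ) t = linComb φ β t - linComb φ γ t := by
  simp only [linComb, PiLp.sub_apply, sub_mul, Finset.sum_sub_distrib]

lemma linComb_zero (t : ℝ) : linComb φ 0 t = 0 := by
  simp [linComb]

lemma IsSpline.linComb {p K : ℕ} {x : ℕ → ℝ} (hφ : ∀ k, IsSpline p K x (φ k))
    (β : EuclideanSpace ℝ (Fin N)) : IsSpline p K x (linComb φ β) :=
  IsSpline.sum _ fun k _ => (hφ k).const_mul (β k)

lemma continuous_linComb (t : ℝ) : Continuous fun β => linComb φ β t := by
  unfold _root_.linComb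
  fun_prop

/-- The seminorm `sqNorm (iteratedDeriv m ·)` is continuous along affine families of splines. -/
lemma continuous_sqNorm_iteratedDeriv_linComb {p K : ℕ} {x : ℕ → ℝ} (hx : IsKnotSeq K x)
    {M : ℝ} (hM : ∀ i ≤ K, ∀ k ≤ K, x (i + 1) - x i ≤ M * (x (k + 1) - x k)) {m : ℕ} {lam : ℝ}
    (hlam : 0 ≤ lam) {s : ℝ → ℝ} (hs : IsSpline p K x s) (hφ : ∀ k, IsSpline p K x (φ k))
    (hφn : ∀ β, sqNorm (linComb φ β) + lam * sqNorm (iteratedDeriv m (linComb φ β)) = ‖β‖ ^ 2) :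
    Continuous fun β => sqNorm (iteratedDeriv m fun t => s t + linComb φ β t) := by
  obtain ⟨C, hC, hCb⟩ := exists_spline_deriv_bound p m M
  rw [continuous_iff_continuousAt]
  intro β
  set G : EuclideanSpace ℝ (Fin N) → ℝ := fun β => sqNorm (iteratedDeriv m fun t => s t + linComb φ β t)
  set D : ℝ := C * (K + 1) ^ (2 * m)
  have hD0 : 0 ≤ D := by positivity
  have hb : ∀ γ, sqNorm (iteratedDeriv m (linComb φ γ)) ≤ D * ‖γ‖ ^ 2 := by
    intro γ
    refine (hCb K x hx hM _ (IsSpline.linComb hφ γ)).trans (mul_le_mul_of_nonneg_left ?_ hD0)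
    rw [← hφn γ]
    have := mul_nonneg hlam (sqNorm_nonneg (iteratedDeriv m (linComb φ γ)))
    linarith
  have hdiff : ∀ β', |G β' - G β| ≤ 2 * √(G β) * √(D * ‖β' - β‖ ^ 2) + D * ‖β' - β‖ ^ 2 := by
    intro β'
    have hsβ := hs.add (IsSpline.linComb hφ β)
    have hγ := IsSpline.linComb hφ (β' - β)
    have h1 := sqNorm_iteratedDeriv_add_mul hx hsβ hγ m
    have h2 := abs_integral_iteratedDeriv_mul_le hx hsβ hγ m
    have e : (fun t => s t + linComb φ β t + linComb φ (β' - β) t) =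
        fun t => s t + linComb φ β' t := by
      funext t
      rw [linComb_sub]
      ring
    rw [e] at h1
    have h3 := hb (β' - β)
    have h4 := sqNorm_nonneg (iteratedDeriv m (linComb φ (β' - β)))
    have h5 := Real.sqrt_le_sqrt h3
    have h6 : G β' - G β = 2 * (∫ t in (0 : ℝ)..1, iteratedDeriv m (fun t => s t + linComb φ β t) t *
        iteratedDeriv m (linComb φ (β' - β)) t) + sqNorm (iteratedDeriv m (linComb φ (β' - β))) := by
      simp only [G]
      rw [h1]
      ring
    rw [h6]
    refine (abs_add_le _ _).trans ?_
    rw [abs_mul, abs_two, abs_of_nonneg h4]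
    have h7 : √(G β) * √(sqNorm (iteratedDeriv m (linComb φ (β' - β)))) ≤
        √(G β) * √(D * ‖β' - β‖ ^ 2) := mul_le_mul_of_nonneg_left h5 (Real.sqrt_nonneg _)
    simp only [G] at h7 ⊢
    linarith
  rw [ContinuousAt, tendsto_iff_norm_sub_tendsto_zero]
  have hlim : Tendsto (fun β' => 2 * √(G β) * √(D * ‖β' - β‖ ^ 2) + D * ‖β' - β‖ ^ 2) (𝓝 β) (𝓝 0) := by
    have hc : Continuous fun β' : EuclideanSpace ℝ (Fin N) =>
      2 * √(G β) * √(D * ‖β' - β‖ ^ 2) + D * ‖β' - β‖ ^ 2 := by fun_prop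
    have := hc.tendsto β
    simpa using this
  exact squeeze_zero (fun _ => norm_nonneg _) hdiff hlim

end LinComb

lemma ExpFamily.objective_congr (F : ExpFamily) {K : ℕ} {x : ℕ → ℝ} (hx : IsKnotSeq K x) {m n : ℕ}
    {lam α : ℝ} {t y : Fin n → ℝ} (ht : ∀ i, t i ∈ Icc (0 : ℝ) 1) {g h : ℝ → ℝ}
    (hgh : ∀ s ∈ Icc (0 : ℝ) 1, g s = h s) :
    objective F m n lam α t y g = objective F m n lam α t y h := by
  have h1 : sqNorm (iteratedDeriv m g) = sqNorm (iteratedDeriv m h) :=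
    hx.integral_congr fun i hi s hs => by rw [IsSpline.iteratedDeriv_congr hx hgh m hi hs]
  simp only [objective, h1, hgh _ (ht _)]

/-- A minimizer over the compact ball cannot lie on the sphere, where the objective exceeds its
value at the center. By the inverse inequality the penalized norm is at most a multiple of the `L²`
norm, so a small `L²` ball around the minimizer stays inside. -/
lemma ExpFamily.exists_localSplineMinimizer (F : ExpFamily)
    (hB : ∃ B : ℝ, ∀ θ y, F.density θ y ≤ B) {p K m n N : ℕ} {x : ℕ → ℝ} (hx : IsKnotSeq K x)
    {M : ℝ} (hM : ∀ i ≤ K, ∀ k ≤ K, x (i + 1) - x i ≤ M * (x (k + 1) - x k)) {lam α : ℝ}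
    (hlam : 0 ≤ lam) (hα : 0 < α) {t : Fin n → ℝ} (ht : ∀ i, t i ∈ Icc (0 : ℝ) 1) (y : Fin n → ℝ)
    {s : ℝ → ℝ} (hs : IsSpline p K x s) {φ : Fin N → ℝ → ℝ} (hφ : ∀ k, IsSpline p K x (φ k))
    (hφs : ∀ h, IsSpline p K x h → ∃ β : EuclideanSpace ℝ (Fin N),
      ∀ t ∈ Icc (0 : ℝ) 1, h t = linComb φ β t)
    (hφn : ∀ β, sqNorm (linComb φ β) + lam * sqNorm (iteratedDeriv m (linComb φ β)) = ‖β‖ ^ 2)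
    {ρ : ℝ} (hρ : 0 < ρ) (hsphere : ∀ β, ‖β‖ = ρ → objective F m n lam α t y s <
      objective F m n lam α t y fun r => s r + linComb φ β r) :
    ∃ β : EuclideanSpace ℝ (Fin N), ‖β‖ ≤ ρ ∧
      IsLocalSplineMinimizer p K x (objective F m n lam α t y) fun r => s r + linComb φ β r := by
  obtain ⟨C, hC, hCb⟩ := exists_spline_deriv_bound p m M
  have hcont : Continuous fun β => objective F m n lam α t y fun r => s r + linComb φ β r := by
    have h1 := continuous_sqNorm_iteratedDeriv_linComb hx hM hlam hs hφ hφn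
    have h2 : ∀ y, Continuous (F.dpdLoss α y) := fun y =>
      continuous_iff_continuousAt.2 fun θ => (F.hasDerivAt_dpdLoss hB hα y θ).continuousAt
    unfold objective
    refine (continuous_const.mul (continuous_finsetSum _ fun i _ => ?_)).add
      (continuous_const.mul h1)
    exact (h2 (y i)).comp (continuous_const.add (continuous_linComb (t i)))
  obtain ⟨β, hβ, hmin⟩ := (isCompact_closedBall (0 : EuclideanSpace ℝ (Fin N)) ρ).exists_isMinOn
    ⟨0, by simp [hρ.le]⟩ hcont.continuousOn
  rw [mem_closedBall_zero_iff] at hβ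
  have hmin' : ∀ γ : EuclideanSpace ℝ (Fin N), ‖γ‖ ≤ ρ →
      objective F m n lam α t y (fun r => s r + linComb φ β r) ≤
      objective F m n lam α t y (fun r => s r + linComb φ γ r) := fun γ hγ =>
    hmin (by rwa [mem_closedBall_zero_iff])
  have hlt : ‖β‖ < ρ := by
    refine lt_of_le_of_ne hβ fun h => ?_
    have h1 := hsphere β h
    have h2 := hmin' 0 (by simp [hρ.le])
    simp only [linComb_zero, add_zero] at h2
    linarith
  have hQ : 0 < 1 + lam * (C * (K + 1) ^ (2 * m)) := by positivity
  refine ⟨β, hβ, hs.add (IsSpline.linComb hφ β),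
    (ρ - ‖β‖) ^ 2 / (1 + lam * (C * (K + 1) ^ (2 * m))), by
      have := sub_pos.2 hlt
      positivity, fun h hh hhr => ?_⟩
  obtain ⟨γ, hγ⟩ := hφs (fun r => h r + (-1) * s r) (hh.add (hs.const_mul (-1)))
  have hγ' : ∀ r ∈ Icc (0 : ℝ) 1, h r = s r + linComb φ γ r := fun r hr => by
    rw [← hγ r hr]; ring
  rw [F.objective_congr hx ht hγ']
  refine hmin' γ ?_
  have hδ : sqNorm (linComb φ (γ - β)) = sqNorm fun r => h r - (s r + linComb φ β r) := by
    refine hx.integral_congr fun i hi r hr => ?_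
    simp only [linComb_sub, hγ' r (hx.Icc_subset hi (Ioo_subset_Icc_self hr))]
    ring
  rw [← hδ, lt_div_iff₀ hQ] at hhr
  have h1 : ‖γ - β‖ ^ 2 < (ρ - ‖β‖) ^ 2 := by
    rw [← hφn]
    have h2 := mul_le_mul_of_nonneg_left (hCb K x hx hM _ (IsSpline.linComb hφ (γ - β))) hlam
    refine lt_of_le_of_lt ?_ hhr
    linarith
  have h2 := lt_of_pow_lt_pow_left₀ 2 (sub_pos.2 hlt).le h1
  have h3 := norm_sub_norm_le γ β
  linarith

/-! ### Stochastic terms -/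

namespace ExpFamily

variable (F : ExpFamily)

section Stochastic

variable {Ω : Type*} [MeasurableSpace Ω] (P : Measure Ω) [IsProbabilityMeasure P]

/-- Chebyshev-type bound for the linear term, uniform in the tuning parameter. -/
lemma exists_linear_term_bound (hB : ∃ B : ℝ, ∀ θ y, F.density θ y ≤ B) {α₀ : ℝ} (hα₀ : 0 < α₀)
    (T : ℝ) : ∃ C : ℝ, 0 < C ∧ ∀ (n : ℕ) (Y : Fin n → Ω → ℝ) (θ : Fin n → ℝ), 0 < n →
      (∀ i, Measurable (Y i)) → iIndepFun Y P → (∀ i, P.map (Y i) = F.law (θ i)) →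
      (∀ i, |θ i| ≤ T) → ∀ (N : ℕ) (φ : Fin N → Fin n → ℝ) (R : ℝ), 0 < R →
      (∀ i, ∑ k, φ k i ^ 2 ≤ R) → ∀ A : ℝ, 0 < A →
      P {ω | ∃ α ∈ Icc (α₀ / 2) (3 * α₀ / 2), A * (R / n) <
        ∑ k, ((n : ℝ)⁻¹ * ∑ i, F.lossDeriv α (Y i ω) (θ i) * φ k i) ^ 2} ≤
          ENNReal.ofReal (C / A) := by
  obtain ⟨W, hW0, hW⟩ := F.exists_weight_bound hB (a₁ := α₀ / 4) (by positivity) (2 * α₀) T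
  -- Bounds both `(1 + α) f^α (y - b')` and its derivative in `α`, for `α < 2 α₀`.
  set C₁ : ℝ := (2 + 2 * α₀) * (W + 1) with hC₁
  have hC₁0 : 0 < C₁ := by positivity
  set C₂ : ℝ := (2 + 2 * (3 * α₀ / 2 - α₀ / 2) ^ 2) * C₁ ^ 2 with hC₂
  have hC₂0 : 0 < C₂ := by positivity
  refine ⟨C₂, hC₂0, fun n Y θ hn hY hind hlaw hθ N φ R hR hφR A hA => ?_⟩
  have hn' : (0 : ℝ) < n := by exact_mod_cast hn
  have key : ∀ k, _ := fun k => exists_uniform_sq_bound (P := P) hY hind (a := α₀ / 2)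
    (b := 3 * α₀ / 2) (a' := α₀ / 4) (b' := 2 * α₀) (by linarith) (by linarith) (by linarith)
    (v := fun i α y => (1 + α) * F.pw α 1 (θ i) y)
    (v' := fun i α y => F.pw α 1 (θ i) y +
      (1 + α) * (F.pw α 1 (θ i) y * Real.log (F.density (θ i) y)))
    (fun i α => (F.measurable_pw α 1 (θ i)).const_mul _)
    (fun i => by
      have h1 : Measurable fun z : ℝ × ℝ => F.density (θ i) z.2 :=
        (F.measurable_density (θ i)).comp measurable_snd
      have h2 : Measurable fun z : ℝ × ℝ => F.pw z.1 1 (θ i) z.2 := by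
        unfold pw
        exact (h1.pow measurable_fst).mul ((measurable_snd.sub_const _).pow_const 1)
      exact h2.add ((measurable_fst.const_add 1).mul (h2.mul h1.log)))
    (fun i α hα y => by
      have hα0 : 0 < α := by linarith [hα.1]
      have := ((hasDerivAt_id α).const_add 1).mul (F.hasDerivAt_pw_exponent hα0 1 (θ i) y)
      refine this.congr_deriv ?_
      simp)
    (C := C₁)
    (fun i α hα y => by
      have h1 := (F.abs_pw_le (k := 1) (by omega) α (θ i) y).trans
        (hW α hα.1.le hα.2.le (θ i) (hθ i) y)
      rw [abs_mul, abs_of_pos (by linarith [hα.1] : 0 < 1 + α)]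
      have : (1 + α) * |F.pw α 1 (θ i) y| ≤ (1 + 2 * α₀) * W := by
        refine mul_le_mul (by linarith [hα.2]) h1 (abs_nonneg _) (by linarith)
      rw [hC₁]
      nlinarith)
    (fun i α hα y => by
      have h1 := (F.abs_pw_le (k := 1) (by omega) α (θ i) y).trans
        (hW α hα.1.le hα.2.le (θ i) (hθ i) y)
      have h2 := (F.abs_pw_mul_log_le (k := 1) (by omega) α (θ i) y).trans
        (hW α hα.1.le hα.2.le (θ i) (hθ i) y)
      refine (abs_add_le _ _).trans ?_
      rw [abs_mul (1 + α), abs_of_pos (by linarith [hα.1] : 0 < 1 + α)]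
      have : (1 + α) * |F.pw α 1 (θ i) y * Real.log (F.density (θ i) y)| ≤ (1 + 2 * α₀) * W := by
        refine mul_le_mul (by linarith [hα.2]) h2 (abs_nonneg _) (by linarith)
      rw [hC₁]
      nlinarith)
    (fun i => (n : ℝ)⁻¹ * φ k i)
  choose V hVm hVb hVi using key
  -- The deterministic integral in the derivative of the loss is exactly the mean of its random
  -- part.
  have hcent : ∀ k ω α, 0 < α → (n : ℝ)⁻¹ * ∑ i, F.lossDeriv α (Y i ω) (θ i) * φ k i =
      -∑ i, (n : ℝ)⁻¹ * φ k i * ((1 + α) * F.pw α 1 (θ i) (Y i ω) -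
        ∫ ω', (1 + α) * F.pw α 1 (θ i) (Y i ω') ∂P) := by
    intro k ω α hα
    rw [Finset.mul_sum, ← Finset.sum_neg_distrib]
    refine Finset.sum_congr rfl fun i _ => ?_
    have h1 : ∫ ω', F.pw α 1 (θ i) (Y i ω') ∂P = F.ipw (1 + α) 1 (θ i) := by
      rw [← F.integral_law_pw hα, ← hlaw i,
        integral_map (hY i).aemeasurable (F.measurable_pw α 1 (θ i)).aestronglyMeasurable]
    rw [integral_const_mul, h1, lossDeriv]
    ring
  have hsum : ∫⁻ ω, ∑ k, V k ω ∂P ≤ ENNReal.ofReal (C₂ * (R / n)) := by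
    rw [lintegral_finsetSum _ fun k _ => hVm k]
    calc _ ≤ ∑ k, ENNReal.ofReal (C₂ * ∑ i, ((n : ℝ)⁻¹ * φ k i) ^ 2) :=
          Finset.sum_le_sum fun k _ => hVi k
      _ = ENNReal.ofReal (∑ k, C₂ * ∑ i, ((n : ℝ)⁻¹ * φ k i) ^ 2) :=
          (ENNReal.ofReal_sum_of_nonneg fun k _ => by positivity).symm
      _ ≤ _ := by
          refine ENNReal.ofReal_le_ofReal ?_
          -- Summing over the basis at a fixed design point gives at most `R`, whatever the
          -- dimension `N`.
          rw [← Finset.mul_sum, Finset.sum_comm]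
          refine mul_le_mul_of_nonneg_left ?_ hC₂0.le
          calc ∑ i, ∑ k, ((n : ℝ)⁻¹ * φ k i) ^ 2 = ∑ i, ((n : ℝ)⁻¹) ^ 2 * ∑ k, φ k i ^ 2 := by
                simp only [mul_pow, Finset.mul_sum]
            _ ≤ ∑ _i : Fin n, ((n : ℝ)⁻¹) ^ 2 * R := by
                gcongr with i
                exact hφR i
            _ = R / n := by
                rw [Finset.sum_const, Finset.card_univ, Fintype.card_fin, nsmul_eq_mul]
                field_simp
  have hAR : 0 < A * (R / n) := by positivity
  calc _ ≤ P {ω | ENNReal.ofReal (A * (R / n)) ≤ ∑ k, V k ω} := by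
        refine measure_mono ?_
        rintro ω ⟨α, hα, hω⟩
        have hα0 : 0 < α := by linarith [hα.1]
        refine (ENNReal.ofReal_le_ofReal hω.le).trans ?_
        rw [ENNReal.ofReal_sum_of_nonneg fun k _ => sq_nonneg _]
        refine Finset.sum_le_sum fun k _ => ?_
        rw [hcent k ω α hα0, neg_sq]
        exact hVb k ω α hα
    _ ≤ (∫⁻ ω, ∑ k, V k ω ∂P) / ENNReal.ofReal (A * (R / n)) :=
        meas_ge_le_lintegral_div (Finset.measurable_fun_sum _ fun k _ => hVm k).aemeasurable
          (by simpa using hAR) ENNReal.ofReal_ne_top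
    _ ≤ ENNReal.ofReal (C₂ * (R / n)) / ENNReal.ofReal (A * (R / n)) := by gcongr
    _ = _ := by
        rw [← ENNReal.ofReal_div_of_pos hAR]
        congr 1
        field_simp

/-- Chebyshev-type bound for the quadratic term. -/
lemma exists_quadratic_term_bound (hB : ∃ B : ℝ, ∀ θ y, F.density θ y ≤ B) {α₀ : ℝ}
    (hα₀ : 0 < α₀) (T : ℝ) : ∃ C : ℝ, 0 < C ∧ ∀ (n : ℕ) (Y : Fin n → Ω → ℝ) (θ : Fin n → ℝ), 0 < n →
      (∀ i, Measurable (Y i)) → iIndepFun Y P → (∀ i, |θ i| ≤ T) →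
      ∀ (N : ℕ) (φ : Fin N → Fin n → ℝ) (R : ℝ), 0 < R →
      (∀ i, ∑ k, φ k i ^ 2 ≤ R) → ∀ κ : ℝ, 0 < κ →
      P {ω | κ ^ 2 < ∑ k, ∑ l, (∑ i, ((n : ℝ)⁻¹ * (φ k i * φ l i)) *
        (F.lossDeriv2 α₀ (Y i ω) (θ i) - ∫ ω', F.lossDeriv2 α₀ (Y i ω') (θ i) ∂P)) ^ 2} ≤
          ENNReal.ofReal (C * (R ^ 2 / n) / κ ^ 2) := by
  obtain ⟨W, hW0, hW⟩ := F.isBddLip_lossDeriv2 hB hα₀ α₀ T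
  refine ⟨(W + 1) ^ 2, by positivity, fun n Y θ hn hY hind hθ N φ R hR hφR κ hκ => ?_⟩
  have hn' : (0 : ℝ) < n := by exact_mod_cast hn
  have hm : ∀ i, Measurable fun y => F.lossDeriv2 α₀ y (θ i) := fun i => by
    unfold lossDeriv2
    exact (((F.measurable_pw α₀ 2 (θ i)).const_mul _).sub
      ((F.measurable_pw α₀ 0 (θ i)).const_mul _)).const_sub _ |>.const_mul _
  have key := fun c => lintegral_sq_sum_centered_le (P := P) hY hind
    (v := fun i y => F.lossDeriv2 α₀ y (θ i)) hm (C := W + 1)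
    (fun i y => ((hW α₀ ⟨le_rfl, le_rfl⟩ (θ i) (hθ i) y).1).trans (by linarith)) c
  have hVm : ∀ k l, Measurable fun ω => ENNReal.ofReal ((∑ i, ((n : ℝ)⁻¹ * (φ k i * φ l i)) *
        (F.lossDeriv2 α₀ (Y i ω) (θ i) - ∫ ω', F.lossDeriv2 α₀ (Y i ω') (θ i) ∂P)) ^ 2) := by
    intro k l
    exact ((Finset.measurable_fun_sum _ fun i _ =>
      (((hm i).comp (hY i)).sub_const _).const_mul _).pow_const 2).ennreal_ofReal
  have hsum : ∫⁻ ω, ∑ k, ∑ l, ENNReal.ofReal ((∑ i, ((n : ℝ)⁻¹ * (φ k i * φ l i)) *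
        (F.lossDeriv2 α₀ (Y i ω) (θ i) - ∫ ω', F.lossDeriv2 α₀ (Y i ω') (θ i) ∂P)) ^ 2) ∂P ≤
      ENNReal.ofReal ((W + 1) ^ 2 * (R ^ 2 / n)) := by
    rw [lintegral_finsetSum _ fun k _ => Finset.measurable_fun_sum _ fun l _ => hVm k l]
    calc _ = ∑ k, ∑ l, ∫⁻ ω, ENNReal.ofReal ((∑ i, ((n : ℝ)⁻¹ * (φ k i * φ l i)) *
          (F.lossDeriv2 α₀ (Y i ω) (θ i) - ∫ ω', F.lossDeriv2 α₀ (Y i ω') (θ i) ∂P)) ^ 2) ∂P :=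
          Finset.sum_congr rfl fun k _ => lintegral_finsetSum _ fun l _ => hVm k l
      _ ≤ ∑ k, ∑ l, ENNReal.ofReal ((W + 1) ^ 2 * ∑ i, ((n : ℝ)⁻¹ * (φ k i * φ l i)) ^ 2) :=
          Finset.sum_le_sum fun k _ => Finset.sum_le_sum fun l _ => key _
      _ = ENNReal.ofReal (∑ k, ∑ l, (W + 1) ^ 2 * ∑ i, ((n : ℝ)⁻¹ * (φ k i * φ l i)) ^ 2) := by
          rw [ENNReal.ofReal_sum_of_nonneg fun k _ => Finset.sum_nonneg fun l _ => by positivity]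
          refine Finset.sum_congr rfl fun k _ => ?_
          rw [ENNReal.ofReal_sum_of_nonneg fun l _ => by positivity]
      _ ≤ _ := by
          refine ENNReal.ofReal_le_ofReal ?_
          -- The squares `φ_k² φ_l²` sum over `k, l` to `(∑ φ_k²)² ≤ R²` at every design point.
          have e : ∑ k, ∑ l, (W + 1) ^ 2 * ∑ i, ((n : ℝ)⁻¹ * (φ k i * φ l i)) ^ 2 =
              (W + 1) ^ 2 * ∑ i, ((n : ℝ)⁻¹) ^ 2 * (∑ k, φ k i ^ 2) ^ 2 := by
            simp only [← Finset.mul_sum]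
            congr 1
            have h : ∀ i, ((n : ℝ)⁻¹) ^ 2 * (∑ k, φ k i ^ 2) ^ 2 =
                ∑ k, ∑ l, ((n : ℝ)⁻¹ * (φ k i * φ l i)) ^ 2 := fun i => by
              rw [pow_two (∑ k, φ k i ^ 2), Finset.sum_mul_sum, Finset.mul_sum]
              refine Finset.sum_congr rfl fun k _ => ?_
              rw [Finset.mul_sum]
              exact Finset.sum_congr rfl fun l _ => by ring
            symm
            rw [Finset.mul_sum, Finset.sum_congr rfl fun i _ => h i, Finset.sum_comm]
            exact Finset.sum_congr rfl fun k _ => Finset.sum_comm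
          rw [e]
          refine mul_le_mul_of_nonneg_left ?_ (by positivity)
          calc ∑ i, ((n : ℝ)⁻¹) ^ 2 * (∑ k, φ k i ^ 2) ^ 2 ≤ ∑ _i : Fin n, ((n : ℝ)⁻¹) ^ 2 * R ^ 2 := by
                gcongr with i
                exact hφR i
            _ = R ^ 2 / n := by
                rw [Finset.sum_const, Finset.card_univ, Fintype.card_fin, nsmul_eq_mul]
                field_simp
  have hκ2 : 0 < κ ^ 2 := by positivity
  calc _ ≤ P {ω | ENNReal.ofReal (κ ^ 2) ≤ ∑ k, ∑ l, ENNReal.ofReal ((∑ i,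
        ((n : ℝ)⁻¹ * (φ k i * φ l i)) * (F.lossDeriv2 α₀ (Y i ω) (θ i) -
          ∫ ω', F.lossDeriv2 α₀ (Y i ω') (θ i) ∂P)) ^ 2)} := by
        refine measure_mono fun ω hω => ?_
        refine (ENNReal.ofReal_le_ofReal (le_of_lt hω)).trans_eq ?_
        rw [ENNReal.ofReal_sum_of_nonneg fun k _ => Finset.sum_nonneg fun l _ => sq_nonneg _]
        refine Finset.sum_congr rfl fun k _ => ?_
        rw [ENNReal.ofReal_sum_of_nonneg fun l _ => sq_nonneg _]
    _ ≤ _ := meas_ge_le_lintegral_div (Finset.measurable_fun_sum _ fun k _ =>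
          Finset.measurable_fun_sum _ fun l _ => hVm k l).aemeasurable
          (by simpa using hκ2.ne') ENNReal.ofReal_ne_top
    _ ≤ ENNReal.ofReal ((W + 1) ^ 2 * (R ^ 2 / n)) / ENNReal.ofReal (κ ^ 2) := by gcongr
    _ = _ := by rw [← ENNReal.ofReal_div_of_pos hκ2]

end Stochastic

end ExpFamily

/-! ### Forms in an orthonormal family -/

section Forms

variable {N n : ℕ} (φ : Fin N → Fin n → ℝ) (β : EuclideanSpace ℝ (Fin N))

/-- Cauchy–Schwarz in the coordinates: a bound on one random vector serves all `β` at once, so no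
union over the sphere is needed. -/
lemma abs_sum_linear_form_le (z : Fin n → ℝ) (c L : ℝ) (hL : 0 ≤ L)
    (h : ∑ k, (c * ∑ i, z i * φ k i) ^ 2 ≤ L ^ 2) :
    |c * ∑ i, z i * ∑ k, β k * φ k i| ≤ L * ‖β‖ := by
  have e : c * ∑ i, z i * ∑ k, β k * φ k i = ∑ k, β k * (c * ∑ i, z i * φ k i) := by
    simp only [Finset.mul_sum]
    rw [Finset.sum_comm]
    refine Finset.sum_congr rfl fun k _ => Finset.sum_congr rfl fun i _ => ?_
    ring
  rw [e]
  refine abs_le_of_sq_le_sq ?_ (by positivity)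
  refine (Finset.sum_mul_sq_le_sq_mul_sq _ _ _).trans ?_
  rw [← EuclideanSpace.real_norm_sq_eq, mul_pow, mul_comm]
  gcongr

/-- The operator norm of a quadratic form is at most the Frobenius norm of its matrix. -/
lemma abs_sum_quadratic_form_le (z : Fin n → ℝ) (c L : ℝ) (hL : 0 ≤ L)
    (h : ∑ k, ∑ l, (∑ i, (c * (φ k i * φ l i)) * z i) ^ 2 ≤ L ^ 2) :
    |c * ∑ i, z i * (∑ k, β k * φ k i) ^ 2| ≤ L * ‖β‖ ^ 2 := by
  have e : c * ∑ i, z i * (∑ k, β k * φ k i) ^ 2 =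
      ∑ q : Fin N × Fin N, (β q.1 * β q.2) * (∑ i, (c * (φ q.1 i * φ q.2 i)) * z i) := by
    have h : ∀ i, z i * (∑ k, β k * φ k i) ^ 2 =
        ∑ q : Fin N × Fin N, β q.1 * β q.2 * (φ q.1 i * φ q.2 i * z i) := fun i => by
      rw [pow_two, Finset.sum_mul_sum, Fintype.sum_prod_type, Finset.mul_sum]
      refine Finset.sum_congr rfl fun k _ => ?_
      rw [Finset.mul_sum]
      exact Finset.sum_congr rfl fun l _ => by ring
    rw [Finset.sum_congr rfl fun i _ => h i, Finset.sum_comm, Finset.mul_sum]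
    refine Finset.sum_congr rfl fun q _ => ?_
    rw [Finset.mul_sum, Finset.mul_sum]
    exact Finset.sum_congr rfl fun i _ => by ring
  rw [e]
  refine abs_le_of_sq_le_sq ?_ (by positivity)
  refine (Finset.sum_mul_sq_le_sq_mul_sq _ _ _).trans ?_
  rw [Fintype.sum_prod_type, Fintype.sum_prod_type]
  have e2 : ∑ k, ∑ l, (β k * β l) ^ 2 = (‖β‖ ^ 2) ^ 2 := by
    rw [EuclideanSpace.real_norm_sq_eq, pow_two (∑ i, _), Finset.sum_mul_sum]
    simp only [mul_pow]
  simp only [e2]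
  rw [mul_pow L, mul_comm]
  gcongr

end Forms

/-! ### The objective on spheres around an approximating spline -/

/-- Here `S` and `Q` stand for the squared norms of `h` and of its `m`-th derivative, `I` for the
cross integral. Splitting `z = μ + (z - μ)`, the means contribute a multiple of `S` and the penalty
contributes `lam Q`, together at least `(c₂ + κ / 2) ρ²`; the fluctuation costs at most `κ ρ² / 2`,
and the rest is linear in `ρ`. -/
lemma le_average_increment {n : ℕ} (hn : 0 < n) {d u h z μ D : Fin n → ℝ}
    {C ε L κ c₁ U a A S Q I B lam ρ c₂ : ℝ} (hC : 0 ≤ C) (hκ : c₂ + κ / 2 ≤ (c₁ - ε) / 2 * a)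
    (hκ' : c₂ + κ / 2 ≤ 1) (hεc : ε ≤ c₁) (hA : 0 ≤ A) (hU : 0 ≤ U) (hρ : 0 ≤ ρ)
    (hD : ∀ i, d i * h i - C * (|u i| * |h i|) + (z i - ε) / 2 * h i ^ 2 ≤ D i)
    (hlin : |(n : ℝ)⁻¹ * ∑ i, d i * h i| ≤ L * ρ)
    (hquad : |(n : ℝ)⁻¹ * ∑ i, (z i - μ i) * h i ^ 2| ≤ κ * ρ ^ 2)
    (hμ : ∀ i, c₁ ≤ μ i) (hu : ∀ i, |u i| ≤ U)
    (ha : a * S ≤ (n : ℝ)⁻¹ * ∑ i, h i ^ 2) (hA' : (n : ℝ)⁻¹ * ∑ i, h i ^ 2 ≤ A * S)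
    (hS : 0 ≤ S) (hQ : 0 ≤ Q) (hlam : 0 ≤ lam) (hSQ : S + lam * Q = ρ ^ 2)
    (hbias : |lam * I| ≤ B * ρ) :
    c₂ * ρ ^ 2 - ρ * (L + C * U * √A + 2 * B) ≤ (n : ℝ)⁻¹ * ∑ i, D i + lam * (2 * I + Q) := by
  have hn' : (0 : ℝ) < n := by exact_mod_cast hn
  have hlQ : 0 ≤ lam * Q := mul_nonneg hlam hQ
  have hSρ : S ≤ ρ ^ 2 := by linarith
  have h1 : (n : ℝ)⁻¹ * ∑ i, |h i| ≤ √A * ρ := by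
    have hsq : ((n : ℝ)⁻¹ * ∑ i, |h i|) ^ 2 ≤ (n : ℝ)⁻¹ * ∑ i, h i ^ 2 := by
      have := Finset.sum_mul_sq_le_sq_mul_sq Finset.univ (fun _ : Fin n => (1 : ℝ)) (fun i => |h i|)
      simp only [one_mul, one_pow, Finset.sum_const, Finset.card_univ, Fintype.card_fin, nsmul_eq_mul,
        mul_one, sq_abs] at this
      calc ((n : ℝ)⁻¹ * ∑ i, |h i|) ^ 2 = (n : ℝ)⁻¹ ^ 2 * (∑ i, |h i|) ^ 2 := by ring
        _ ≤ (n : ℝ)⁻¹ ^ 2 * (n * ∑ i, h i ^ 2) := by gcongr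
        _ = _ := by field_simp
    refine le_of_sq_le_sq ?_ (by positivity)
    rw [mul_pow (√A), Real.sq_sqrt hA]
    exact (hsq.trans hA').trans (mul_le_mul_of_nonneg_left hSρ hA)
  have h2 : (n : ℝ)⁻¹ * ∑ i, C * (|u i| * |h i|) ≤ C * U * √A * ρ := by
    calc (n : ℝ)⁻¹ * ∑ i, C * (|u i| * |h i|) ≤ (n : ℝ)⁻¹ * ∑ i, C * (U * |h i|) := by
          gcongr with i
          exact hu i
      _ = C * U * ((n : ℝ)⁻¹ * ∑ i, |h i|) := by
          simp only [Finset.mul_sum]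
          exact Finset.sum_congr rfl fun i _ => by ring
      _ ≤ C * U * (√A * ρ) := by gcongr
      _ = _ := by ring
  have h3 : (c₁ - ε) / 2 * (a * S) ≤ (n : ℝ)⁻¹ * ∑ i, (μ i - ε) / 2 * h i ^ 2 := by
    calc (c₁ - ε) / 2 * (a * S) ≤ (c₁ - ε) / 2 * ((n : ℝ)⁻¹ * ∑ i, h i ^ 2) := by
          gcongr
      _ = (n : ℝ)⁻¹ * ∑ i, (c₁ - ε) / 2 * h i ^ 2 := by rw [← Finset.mul_sum]; ring
      _ ≤ _ := by
          gcongr with i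
          exact hμ i
  have h4 : (n : ℝ)⁻¹ * ∑ i, d i * h i - (n : ℝ)⁻¹ * ∑ i, C * (|u i| * |h i|) +
      ((n : ℝ)⁻¹ * ∑ i, (z i - μ i) * h i ^ 2) / 2 + (n : ℝ)⁻¹ * ∑ i, (μ i - ε) / 2 * h i ^ 2 ≤
      (n : ℝ)⁻¹ * ∑ i, D i := by
    calc _ = (n : ℝ)⁻¹ * ∑ i, (d i * h i - C * (|u i| * |h i|) + (z i - ε) / 2 * h i ^ 2) := by
          rw [mul_div_assoc, Finset.sum_div, ← mul_sub, ← Finset.sum_sub_distrib, ← mul_add,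
            ← Finset.sum_add_distrib, ← mul_add, ← Finset.sum_add_distrib]
          congr 1
          exact Finset.sum_congr rfl fun i _ => by ring
      _ ≤ _ := by
          gcongr with i
          exact hD i
  have h5 := (abs_le.1 hlin).1
  have h6 := (abs_le.1 hquad).1
  have h7 := (abs_le.1 hbias).1
  have h8 : (c₂ + κ / 2) * S ≤ (c₁ - ε) / 2 * (a * S) := by
    rw [← mul_assoc]
    exact mul_le_mul_of_nonneg_right hκ hS
  have h9 : (c₂ + κ / 2) * (lam * Q) ≤ lam * Q := by
    have := mul_le_mul_of_nonneg_right hκ' hlQ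
    linarith
  have h10 : (c₂ + κ / 2) * ρ ^ 2 ≤ (c₁ - ε) / 2 * (a * S) + lam * Q := by
    rw [← hSQ, mul_add]
    linarith
  linarith

lemma sqNorm_add_sub_le {p K : ℕ} {x : ℕ → ℝ} (hx : IsKnotSeq K x) {s h g : ℝ → ℝ} {U : ℝ}
    (hh : IsSpline p K x h) (hU : ∀ r ∈ Icc (0 : ℝ) 1, |s r - g r| ≤ U) :
    sqNorm (fun r => s r + h r - g r) ≤ 2 * sqNorm h + 2 * U ^ 2 := by
  have hint : IntervalIntegrable (fun r => 2 * h r ^ 2 + 2 * U ^ 2) volume 0 1 :=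
    ((hh.isPiecewisePoly.sq.intervalIntegrable hx).const_mul 2).add intervalIntegrable_const
  have e : 2 * sqNorm h + 2 * U ^ 2 = ∫ r in (0 : ℝ)..1, (2 * h r ^ 2 + 2 * U ^ 2) := by
    rw [intervalIntegral.integral_add ((hh.isPiecewisePoly.sq.intervalIntegrable hx).const_mul 2)
      intervalIntegrable_const, intervalIntegral.integral_const_mul]
    simp [sqNorm]
  rw [e, sqNorm, intervalIntegral.integral_of_le zero_le_one, intervalIntegral.integral_of_le zero_le_one]
  refine integral_mono_of_nonneg (Eventually.of_forall fun _ => sq_nonneg _)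
    ((intervalIntegrable_iff_integrableOn_Ioc_of_le zero_le_one).1 hint) ?_
  filter_upwards [ae_restrict_mem measurableSet_Ioc] with r hr
  have h1 := hU r (Ioc_subset_Icc_self hr)
  have h2 : (s r - g r) ^ 2 ≤ U ^ 2 := by
    rw [← sq_abs]
    exact pow_le_pow_left₀ (abs_nonneg _) h1 2
  nlinarith [sq_nonneg (s r - g r - h r)]

/-- Deterministic existence of a local minimizer close to `g`. -/
lemma ExpFamily.exists_localSplineMinimizer_near (F : ExpFamily)
    (hB : ∃ B : ℝ, ∀ θ y, F.density θ y ≤ B) {p K m n N : ℕ} {x : ℕ → ℝ} (hx : IsKnotSeq K x)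
    {M : ℝ} (hM : ∀ i ≤ K, ∀ k ≤ K, x (i + 1) - x i ≤ M * (x (k + 1) - x k)) {lam α α₀ : ℝ}
    (hlam : 0 ≤ lam) (hα : 0 < α) (hn : 0 < n) {t : Fin n → ℝ} (ht : ∀ i, t i ∈ Icc (0 : ℝ) 1)
    (y : Fin n → ℝ) {s g : ℝ → ℝ} (hs : IsSpline p K x s) {φ : Fin N → ℝ → ℝ}
    (hφ : ∀ k, IsSpline p K x (φ k))
    (hφs : ∀ h, IsSpline p K x h → ∃ β : EuclideanSpace ℝ (Fin N),
      ∀ t ∈ Icc (0 : ℝ) 1, h t = linComb φ β t)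
    (hφn : ∀ β, sqNorm (linComb φ β) + lam * sqNorm (iteratedDeriv m (linComb φ β)) = ‖β‖ ^ 2)
    {C ε L κ c₁ U a A B ρ c₂ η R : ℝ} {μ : Fin n → ℝ}
    (hC : 0 ≤ C) (hκ : c₂ + κ / 2 ≤ (c₁ - ε) / 2 * a)
    (hκ' : c₂ + κ / 2 ≤ 1) (hεc : ε ≤ c₁) (hA : 0 ≤ A) (hρ : 0 < ρ) (hL : 0 ≤ L) (hκ0 : 0 ≤ κ)
    (hη : 0 ≤ η)
    (hinc : ∀ i h, |h| ≤ η → F.lossDeriv α (y i) (g (t i)) * h -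
      C * (|s (t i) - g (t i)| * |h|) + (F.lossDeriv2 α₀ (y i) (g (t i)) - ε) / 2 * h ^ 2 ≤
        F.dpdLoss α (y i) (s (t i) + h) - F.dpdLoss α (y i) (s (t i)))
    (hU : ∀ r ∈ Icc (0 : ℝ) 1, |s r - g r| ≤ U)
    (hR : ∀ β, ∀ r ∈ Icc (0 : ℝ) 1, linComb φ β r ^ 2 ≤ R * ‖β‖ ^ 2) (hRη : R * ρ ^ 2 ≤ η ^ 2)
    (hlin : ∑ k, ((n : ℝ)⁻¹ * ∑ i, F.lossDeriv α (y i) (g (t i)) * φ k (t i)) ^ 2 ≤ L ^ 2)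
    (hquad : ∑ k, ∑ l, (∑ i, ((n : ℝ)⁻¹ * (φ k (t i) * φ l (t i))) *
      (F.lossDeriv2 α₀ (y i) (g (t i)) - μ i)) ^ 2 ≤ κ ^ 2)
    (hμ : ∀ i, c₁ ≤ μ i)
    (hemp : ∀ h, IsSpline p K x h → a * sqNorm h ≤ (n : ℝ)⁻¹ * ∑ i, h (t i) ^ 2 ∧
      (n : ℝ)⁻¹ * ∑ i, h (t i) ^ 2 ≤ A * sqNorm h)
    (hbias : ∀ β, |lam * ∫ r in (0 : ℝ)..1, iteratedDeriv m s r *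
      iteratedDeriv m (linComb φ β) r| ≤ B * ‖β‖)
    (hlt : L + C * U * √A + 2 * B < c₂ * ρ) :
    ∃ g', IsLocalSplineMinimizer p K x (objective F m n lam α t y) g' ∧
      sqNorm (fun r => g' r - g r) ≤ 2 * ρ ^ 2 + 2 * U ^ 2 := by
  have hU0 : 0 ≤ U := (abs_nonneg _).trans (hU 0 ⟨le_rfl, zero_le_one⟩)
  obtain ⟨β, hβ, hmin⟩ := F.exists_localSplineMinimizer hB hx hM hlam hα ht y hs hφ hφs hφn hρ
    (fun β hβ => by
      have hh := IsSpline.linComb hφ β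
      have h1 := le_average_increment hn (d := fun i => F.lossDeriv α (y i) (g (t i)))
        (u := fun i => s (t i) - g (t i)) (h := fun i => linComb φ β (t i))
        (z := fun i => F.lossDeriv2 α₀ (y i) (g (t i))) (μ := μ)
        (D := fun i => F.dpdLoss α (y i) (s (t i) + linComb φ β (t i)) -
          F.dpdLoss α (y i) (s (t i))) hC hκ hκ' hεc hA hU0 hρ.le
        (fun i => hinc i _ (abs_le_of_sq_le_sq (((hR β _ (ht i)).trans_eq (by rw [hβ])).trans hRη) hη))
        (by
          rw [← hβ]
          exact abs_sum_linear_form_le (fun k i => φ k (t i)) β _ _ L hL hlin)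
        (by
          rw [← hβ]
          exact abs_sum_quadratic_form_le (fun k i => φ k (t i)) β _ _ κ hκ0 hquad)
        hμ (fun i => hU _ (ht i)) (hemp _ hh).1 (hemp _ hh).2 (sqNorm_nonneg _)
        (sqNorm_nonneg (iteratedDeriv m (linComb φ β))) hlam (by rw [hφn, hβ])
        (by rw [← hβ]; exact hbias β)
      have h2 := sqNorm_iteratedDeriv_add_mul hx hs hh m
      have h3 : 0 < c₂ * ρ ^ 2 - ρ * (L + C * U * √A + 2 * B) := by
        have := mul_pos hρ (sub_pos.2 hlt)
        linarith
      rw [Finset.sum_sub_distrib, mul_sub] at h1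
      simp only [objective]
      rw [h2]
      linarith)
  refine ⟨_, hmin, (sqNorm_add_sub_le hx (IsSpline.linComb hφ β) hU).trans ?_⟩
  have h1 := hφn β
  have h2 := mul_nonneg hlam (sqNorm_nonneg (iteratedDeriv m (linComb φ β)))
  have h3 := pow_le_pow_left₀ (norm_nonneg _) hβ 2
  linarith

/-! ### Rates -/

/-- After Cauchy–Schwarz there are two ways to bound `‖h^{(m)}‖²`: by `K^{2m} ‖h‖²` through the
inverse inequality, or by the penalized norm divided by `lam`. They give the two entries of the
minimum. -/
lemma exists_penalty_cross_bound (p m : ℕ) (M : ℝ) : ∃ C : ℝ, 0 < C ∧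
    ∀ (K : ℕ) (x : ℕ → ℝ), 1 ≤ K → IsKnotSeq K x →
    (∀ i ≤ K, ∀ k ≤ K, x (i + 1) - x i ≤ M * (x (k + 1) - x k)) →
    ∀ lam : ℝ, 0 ≤ lam → ∀ s h, IsSpline p K x s → IsSpline p K x h →
      (lam * ∫ r in (0 : ℝ)..1, iteratedDeriv m s r * iteratedDeriv m h r) ^ 2 ≤
        C * sqNorm (iteratedDeriv m s) * min (lam ^ 2 * (K : ℝ) ^ (2 * m)) lam *
          (sqNorm h + lam * sqNorm (iteratedDeriv m h)) := by
  obtain ⟨C, hC, hCb⟩ := exists_spline_deriv_bound p m M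
  refine ⟨C * 2 ^ (2 * m) + 1, by positivity, fun K x hK hx hM lam hlam s h hs hh => ?_⟩
  have hK' : (1 : ℝ) ≤ K := by exact_mod_cast hK
  have h1 := abs_integral_iteratedDeriv_mul_le hx hs hh m
  set I := ∫ r in (0 : ℝ)..1, iteratedDeriv m s r * iteratedDeriv m h r
  set A := sqNorm (iteratedDeriv m s)
  set B := sqNorm (iteratedDeriv m h) with hBdef
  have hA0 : 0 ≤ A := sqNorm_nonneg _
  have hB0 : 0 ≤ B := sqNorm_nonneg _
  have hh0 : 0 ≤ sqNorm h := sqNorm_nonneg _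
  have hlB : 0 ≤ lam * B := mul_nonneg hlam hB0
  have h2 : I ^ 2 ≤ A * B := by
    rw [← sq_abs]
    refine (pow_le_pow_left₀ (abs_nonneg _) h1 2).trans_eq ?_
    rw [mul_pow (√A), Real.sq_sqrt hA0, Real.sq_sqrt hB0]
  have h3 : B ≤ C * 2 ^ (2 * m) * (K : ℝ) ^ (2 * m) * (sqNorm h + lam * B) := by
    calc B ≤ C * (K + 1) ^ (2 * m) * sqNorm h := hCb K x hx hM h hh
      _ ≤ C * (2 * K) ^ (2 * m) * (sqNorm h + lam * B) := by
          gcongr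
          · linarith
          · linarith
      _ = _ := by rw [mul_pow]; ring
  rw [mul_pow]
  have h4 : 0 ≤ C * 2 ^ (2 * m) := by positivity
  have h5 : 0 ≤ sqNorm h + lam * B := by positivity
  rcases min_cases (lam ^ 2 * (K : ℝ) ^ (2 * m)) lam with h6 | h6
  · rw [h6.1]
    calc lam ^ 2 * I ^ 2 ≤ lam ^ 2 * (A * (C * 2 ^ (2 * m) * (K : ℝ) ^ (2 * m) *
          (sqNorm h + lam * B))) := by
          gcongr
          exact h2.trans (mul_le_mul_of_nonneg_left h3 hA0)
      _ = C * 2 ^ (2 * m) * A * (lam ^ 2 * (K : ℝ) ^ (2 * m)) * (sqNorm h + lam * B) := by ring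
      _ ≤ _ := by
          gcongr
          linarith
  · rw [h6.1]
    calc lam ^ 2 * I ^ 2 ≤ lam ^ 2 * (A * B) := by gcongr
      _ = 1 * A * lam * (lam * B) := by ring
      _ ≤ _ := by
          gcongr
          · linarith
          · linarith

lemma tendsto_sq_div_of_rpow {K : ℕ → ℕ} {δ' : ℝ} (hδ' : 0 < δ')
    (h : Tendsto (fun n : ℕ => (n : ℝ) ^ (δ' - 1) * (K n : ℝ) ^ 2) atTop (𝓝 0)) :
    Tendsto (fun n : ℕ => (K n : ℝ) ^ 2 / n) atTop (𝓝 0) := by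
  refine squeeze_zero' (Eventually.of_forall fun n => by positivity) ?_ h
  filter_upwards [eventually_ge_atTop 1] with n hn
  have hn' : (1 : ℝ) ≤ n := by exact_mod_cast hn
  rw [div_eq_inv_mul, ← Real.rpow_neg_one]
  gcongr
  linarith

/-- The rate of convergence. -/
noncomputable def splineRate (m j n K : ℕ) (lam : ℝ) : ℝ :=
  (n : ℝ)⁻¹ * minNegPow (K : ℝ) lam (1 / (2 * m : ℝ)) + min (lam ^ 2 * (K : ℝ) ^ (2 * m)) lam +
    ((K : ℝ) ^ (2 * j))⁻¹

section Rate

variable {m j n K : ℕ} {lam : ℝ}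

lemma minNegPow_nonneg {a e : ℝ} (ha : 0 ≤ a) (hlam : 0 ≤ lam) : 0 ≤ minNegPow a lam e := by
  rw [minNegPow]
  split_ifs
  · exact ha
  · exact le_min ha (Real.rpow_nonneg hlam _)

lemma splineRate_terms (hlam : 0 ≤ lam) :
    0 ≤ (n : ℝ)⁻¹ * minNegPow (K : ℝ) lam (1 / (2 * m : ℝ)) ∧
      0 ≤ min (lam ^ 2 * (K : ℝ) ^ (2 * m)) lam ∧ 0 ≤ ((K : ℝ) ^ (2 * j))⁻¹ :=
  ⟨mul_nonneg (by positivity) (minNegPow_nonneg (by positivity) hlam),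
    le_min (by positivity) hlam, by positivity⟩

lemma splineRate_pos (hlam : 0 ≤ lam) (hK : 1 ≤ K) : 0 < splineRate m j n K lam := by
  obtain ⟨h1, h2, -⟩ := splineRate_terms (m := m) (j := j) (n := n) (K := K) hlam
  have hK' : (0 : ℝ) < K := by exact_mod_cast hK
  have : 0 < ((K : ℝ) ^ (2 * j))⁻¹ := by positivity
  rw [splineRate]
  linarith

/-- The squared supremum of splines on a sphere of radius `H √r` is at most a multiple of `K r`, so
this makes the local expansion of the loss valid. The last summand is at most `1 / K` because `j ≥
1`. -/
lemma tendsto_mul_splineRate {K : ℕ → ℕ} {lam : ℕ → ℝ} (hj : 1 ≤ j) (hlam : ∀ n, 0 ≤ lam n)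
    (hK : Tendsto K atTop atTop)
    (hK2 : Tendsto (fun n : ℕ => (K n : ℝ) ^ 2 / n) atTop (𝓝 0))
    (hlim : Tendsto (fun n => (K n : ℝ) * min (lam n ^ 2 * (K n : ℝ) ^ (2 * m)) (lam n))
      atTop (𝓝 0)) :
    Tendsto (fun n => (K n : ℝ) * splineRate m j n (K n) (lam n)) atTop (𝓝 0) := by
  have hKinv : Tendsto (fun n => ((K n : ℝ))⁻¹) atTop (𝓝 0) :=
    tendsto_inv_atTop_zero.comp (tendsto_natCast_atTop_atTop.comp hK)
  have h := (hK2.add hlim).add hKinv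
  simp only [add_zero] at h
  refine squeeze_zero' ?_ ?_ h
  · filter_upwards [hK.eventually_ge_atTop 1] with n hn
    exact mul_nonneg (Nat.cast_nonneg _) (splineRate_pos (hlam n) hn).le
  · filter_upwards [hK.eventually_ge_atTop 1] with n hn
    have hK' : (1 : ℝ) ≤ K n := by exact_mod_cast hn
    rw [splineRate, mul_add, mul_add]
    refine add_le_add (add_le_add ?_ le_rfl) ?_
    · calc (K n : ℝ) * ((n : ℝ)⁻¹ * minNegPow (K n : ℝ) (lam n) (1 / (2 * m : ℝ))) ≤
            (K n : ℝ) * ((n : ℝ)⁻¹ * K n) := by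
            gcongr
            exact minNegPow_le
        _ = _ := by ring
    · have hK0 : (0 : ℝ) < K n := by linarith
      calc (K n : ℝ) * ((K n : ℝ) ^ (2 * j))⁻¹ ≤ (K n : ℝ) * ((K n : ℝ) ^ 2)⁻¹ := by
            gcongr
            omega
        _ = _ := by field_simp

end Rate

lemma ExpFamily.le_integral_lossDeriv2 (F : ExpFamily) (hB : ∃ B : ℝ, ∀ θ y, F.density θ y ≤ B)
    {Ω : Type*} [MeasurableSpace Ω] {P : Measure Ω} {Y : Ω → ℝ} (hY : Measurable Y) {θ : ℝ}
    (hlaw : P.map Y = F.law θ) {α₀ c₀ : ℝ} (hα₀ : 0 < α₀)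
    (h : c₀ ≤ ∫ ω, F.density θ (Y ω) ^ α₀ * F.score θ (Y ω) ^ 2 ∂P) :
    (1 + α₀) * c₀ ≤ ∫ ω, F.lossDeriv2 α₀ (Y ω) θ ∂P := by
  have hm : Measurable fun y => F.lossDeriv2 α₀ y θ := by
    unfold lossDeriv2
    exact (((F.measurable_pw α₀ 2 θ).const_mul _).sub
      ((F.measurable_pw α₀ 0 θ).const_mul _)).const_sub _ |>.const_mul _
  rw [← integral_map hY.aemeasurable (f := fun y => F.lossDeriv2 α₀ y θ) hm.aestronglyMeasurable,
    hlaw, F.integral_law_lossDeriv2 hB hα₀, ← hlaw,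
    integral_map hY.aemeasurable (F.measurable_pw α₀ 2 θ).aestronglyMeasurable]
  simp only [F.density_rpow_mul_score_sq hα₀] at h
  exact mul_le_mul_of_nonneg_left h (by linarith)

set_option maxHeartbeats 1000000 in
/-- With probability at least `1 - ε` there is, eventually, a local minimizer within a multiple of
the rate. -/
lemma ExpFamily.exists_eventually_measure_compl_le
    {Ω : Type*} [MeasurableSpace Ω] (P : Measure Ω) [IsProbabilityMeasure P]
    (F : ExpFamily) (g₀ : ℝ → ℝ)
    (t : (n : ℕ) → Fin n → ℝ) (ht : ∀ n i, t n i ∈ Icc (0 : ℝ) 1)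
    (Y : (n : ℕ) → Fin n → Ω → ℝ) (hY : ∀ n i, Measurable (Y n i))
    (hindep : ∀ n, iIndepFun (Y n) P)
    (hlaw : ∀ n i, P.map (Y n i) = F.law (g₀ (t n i)))
    {m p j : ℕ} (hm : 1 ≤ m) (hmp : m < p) (hmj : m ≤ j) (hjp : j ≤ p)
    (hg₀ : ContDiffOn ℝ (j : WithTop ℕ∞) g₀ (Icc 0 1))
    {lam : ℕ → ℝ} (hlam : ∀ n, 0 ≤ lam n)
    {K : ℕ → ℕ} {x : ℕ → ℕ → ℝ} (hx : ∀ n, IsKnotSeq (K n) (x n))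
    {αhat : ℕ → Ω → ℝ} {α₀ : ℝ} (hα₀ : 0 < α₀)
    (hcons : TendstoInMeasure P αhat atTop (fun _ => α₀))
    (hB : ∃ B : ℝ, ∀ θ y, F.density θ y ≤ B) {c₀ : ℝ} (hc₀ : 0 < c₀)
    (hinfo : ∀ n i, c₀ ≤
      ∫ ω, F.density (g₀ (t n i)) (Y n i ω) ^ α₀ * F.score (g₀ (t n i)) (Y n i ω) ^ 2 ∂P)
    (hK : Tendsto K atTop atTop)
    (hK2 : Tendsto (fun n : ℕ => (K n : ℝ) ^ 2 / n) atTop (𝓝 0))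
    {M : ℝ} (hM : ∀ n, ∀ i ≤ K n, ∀ k ≤ K n,
      x n (i + 1) - x n i ≤ M * (x n (k + 1) - x n k))
    {q : ℝ → ℝ} (hq : Measurable q) {a A : ℝ} (ha : 0 < a)
    (hqb : ∀ s ∈ Icc (0 : ℝ) 1, a ≤ q s ∧ q s ≤ A) (hq1 : (∫ s in (0 : ℝ)..1, q s) = 1)
    (hdesign : ∀ ε > 0, ∀ᶠ n in atTop, ∀ s ∈ Icc (0 : ℝ) 1,
        |empiricalCDF (t n) s - ∫ r in (0 : ℝ)..s, q r| ≤ ε * (K n : ℝ)⁻¹)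
    (hlam_zero : Tendsto lam atTop (𝓝 0))
    (hlim : Tendsto (fun n => (K n : ℝ) * min (lam n ^ 2 * (K n : ℝ) ^ (2 * m)) (lam n))
      atTop (𝓝 0)) {ε : ℝ} (hε : 0 < ε) :
    ∃ D : ℝ, ∀ᶠ n in atTop, P {ω | ∃ g : ℝ → ℝ,
        IsLocalSplineMinimizer p (K n) (x n)
          (objective F m n (lam n) (αhat n ω) (t n) (fun i => Y n i ω)) g ∧
        sqNorm (fun s => g s - g₀ s) ≤ D * splineRate m j n (K n) (lam n)}ᶜ ≤
          ENNReal.ofReal ε := by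
  have hj : 1 ≤ j := hm.trans hmj
  obtain ⟨T, hT⟩ := isCompact_Icc.exists_bound_of_continuousOn hg₀.continuousOn
  have hT' : ∀ n i, |g₀ (t n i)| ≤ T := fun n i => hT _ (ht n i)
  obtain ⟨CR, hCR, hRb⟩ := exists_spline_eval_bound p m hm hmp M
  obtain ⟨CE, hCE, hEb⟩ := exists_spline_empirical_bound p M
  obtain ⟨CS, hCS, hSb⟩ := exists_spline_approx p j m (by omega) hj hjp hmj hmp M g₀ hg₀
  obtain ⟨CP, hCP, hPb⟩ := exists_penalty_cross_bound p m M
  obtain ⟨CI, hCI, hIb⟩ := F.exists_loss_increment_bound hα₀ T hB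
  obtain ⟨CL, hCL, hLb⟩ := F.exists_linear_term_bound P hB hα₀ T
  obtain ⟨CQ, hCQ, hQb⟩ := F.exists_quadratic_term_bound P hB hα₀ T
  obtain ⟨c₁, hc₁⟩ : ∃ c₁, c₁ = (1 + α₀) * c₀ := ⟨_, rfl⟩
  have hc₁0 : 0 < c₁ := by rw [hc₁]; positivity
  obtain ⟨η, hη, hηα, hinc⟩ := hIb (c₁ / 2) (by positivity)
  have hA : 0 < A := by
    have := hqb 0 ⟨le_rfl, zero_le_one⟩
    linarith
  -- Used both as the bound `κ` for the fluctuation and, halved, as the growth constant `c₂`, so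
  -- that `c₂ + κ / 2 = w`. With `c₁ / 2` for the error and `a / 2` for the empirical norm, the
  -- requirement is `w ≤ c₁ a / 8`, besides `w ≤ 1`.
  obtain ⟨w, hw⟩ : ∃ w, w = min (c₁ * a / 8) 1 := ⟨_, rfl⟩
  have hw0 : 0 < w := by rw [hw]; positivity
  have hw1 : w ≤ 1 := by rw [hw]; exact min_le_right _ _
  have hwc : w ≤ c₁ * a / 8 := by rw [hw]; exact min_le_left _ _
  obtain ⟨Ae, hAe⟩ : ∃ Ae, Ae = A + a / 2 := ⟨_, rfl⟩
  -- Makes the probability bound `CL / A₁` for the linear term equal to `ε / 3`.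
  obtain ⟨A₁, hA₁⟩ : ∃ A₁, A₁ = 3 * CL / ε := ⟨_, rfl⟩
  have hA₁0 : 0 < A₁ := by rw [hA₁]; positivity
  obtain ⟨G, hG⟩ : ∃ G, G = √(A₁ * CR) + CI * CS * √Ae + 2 * √(CP * CS) := ⟨_, rfl⟩
  have hG0 : 0 ≤ G := by rw [hG]; positivity
  -- With this radius `c₂ H = G + 1`, strictly more than the sum `G` of all linear coefficients.
  obtain ⟨H, hH⟩ : ∃ H, H = (G + 1) / (w / 2) := ⟨_, rfl⟩
  have hH0 : 0 < H := by rw [hH]; positivity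
  -- From `2 ρ² + 2 U²` with `ρ = H √r` and `U = CS √r`.
  refine ⟨2 * H ^ 2 + 2 * CS ^ 2, ?_⟩
  have hKr := tendsto_mul_splineRate (m := m) hj hlam hK hK2 hlim
  have ev1 : ∀ᶠ n in atTop, CR * H ^ 2 * (K n * splineRate m j n (K n) (lam n)) < η ^ 2 :=
    (by simpa using hKr.const_mul (CR * H ^ 2) : Tendsto _ atTop (𝓝 (0 : ℝ))).eventually_lt_const
      (by positivity)
  have ev2 : ∀ᶠ n in atTop, CS ^ 2 * (K n * splineRate m j n (K n) (lam n)) < η ^ 2 :=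
    (by simpa using hKr.const_mul (CS ^ 2) : Tendsto _ atTop (𝓝 (0 : ℝ))).eventually_lt_const
      (by positivity)
  have ev3 : ∀ᶠ n in atTop, CQ * CR ^ 2 / w ^ 2 * ((K n : ℝ) ^ 2 / n) < ε / 3 :=
    (by simpa using hK2.const_mul (CQ * CR ^ 2 / w ^ 2) :
      Tendsto _ atTop (𝓝 (0 : ℝ))).eventually_lt_const (by positivity)
  have ev4 : ∀ᶠ n in atTop, P {ω | ENNReal.ofReal η ≤ edist (αhat n ω) α₀} ≤ ENNReal.ofReal (ε / 3) :=
    (hcons _ (by simpa using hη)).eventually_le_const (by simpa using hε)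
  -- Since `K + 1 ≤ 2 K`, this precision changes the empirical norm constants by at most `a / 2`.
  have ev5 := hdesign (a / (4 * CE)) (by positivity)
  filter_upwards [ev1, ev2, ev3, ev4, ev5, hK.eventually_ge_atTop p, eventually_gt_atTop 0,
    hlam_zero.eventually_le_const one_pos] with n h1 h2 h3 h4 h5 hKp hn hlam1
  have hK1 : 1 ≤ K n := by omega
  have hKr1 : (1 : ℝ) ≤ K n := by exact_mod_cast hK1
  have hn' : (0 : ℝ) < n := by exact_mod_cast hn
  obtain ⟨r, hr⟩ : ∃ r, r = splineRate m j n (K n) (lam n) := ⟨_, rfl⟩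
  rw [← hr] at h1 h2 ⊢
  have hr0 : 0 < r := hr ▸ splineRate_pos (hlam n) hK1
  obtain ⟨hr1, hr2, hr3⟩ := splineRate_terms (m := m) (j := j) (n := n) (K := K n) (hlam n)
  have hrK : r ≤ K n * r := le_mul_of_one_le_left hr0.le hKr1
  obtain ⟨s, hs, hsU, hsm⟩ := hSb (K n) (x n) (hx n) (hM n) hKp
  obtain ⟨N, φ, hφ, hφs, hφn⟩ := exists_spline_orthonormal (by omega : 1 ≤ p) (hx n) m (hlam n)
  change ∀ β : EuclideanSpace ℝ (Fin N), sqNorm (linComb φ β) +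
    lam n * sqNorm (iteratedDeriv m (linComb φ β)) = ‖β‖ ^ 2 at hφn
  obtain ⟨R, hR⟩ : ∃ R, R = CR * minNegPow (K n : ℝ) (lam n) (1 / (2 * m : ℝ)) := ⟨_, rfl⟩
  have hmp0 := minNegPow_pos (e := 1 / (2 * m : ℝ)) (by linarith : (0 : ℝ) < K n) (hlam n)
  have hR0 : 0 < R := by rw [hR]; positivity
  have hRK : R ≤ CR * K n := by
    rw [hR]
    exact mul_le_mul_of_nonneg_left minNegPow_le hCR.le
  have hRn : R / n ≤ CR * r := by
    rw [hR, hr, splineRate, div_eq_inv_mul]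
    nlinarith
  have hRβ : ∀ β : EuclideanSpace ℝ (Fin N), ∀ u ∈ Icc (0 : ℝ) 1, linComb φ β u ^ 2 ≤ R * ‖β‖ ^ 2 := by
    intro β u hu
    rw [← hφn, hR]
    exact hRb (K n) (x n) hK1 (hx n) (hM n) (lam n) (hlam n) hlam1 _ (IsSpline.linComb hφ β) u hu
  have hRφ : ∀ i, ∑ k, φ k (t n i) ^ 2 ≤ R := fun i =>
    sum_sq_le_of_eval_bound hR0.le fun β => hRβ β _ (ht n i)
  have hU : ∀ u ∈ Icc (0 : ℝ) 1, |s u - g₀ u| ≤ CS * √r := by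
    intro u hu
    have e1 := hsU u hu
    have e2 : (1 : ℝ) ≤ √r * (K n + 1) ^ j := by
      have : (((K n : ℝ) ^ j)⁻¹) ^ 2 ≤ r := by
        rw [inv_pow, ← pow_mul, mul_comm j 2, hr, splineRate]
        linarith
      have e3 := Real.le_sqrt_of_sq_le this
      calc (1 : ℝ) = ((K n : ℝ) ^ j)⁻¹ * (K n : ℝ) ^ j := by
            rw [inv_mul_cancel₀ (by positivity)]
        _ ≤ √r * (K n + 1) ^ j := by
            gcongr
            linarith
    calc |s u - g₀ u| ≤ |s u - g₀ u| * (√r * (K n + 1) ^ j) := le_mul_of_one_le_right (abs_nonneg _) e2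
      _ = (|s u - g₀ u| * (K n + 1) ^ j) * √r := by ring
      _ ≤ CS * √r := by gcongr
  have hUη : CS * √r ≤ η := by
    refine le_of_sq_le_sq ?_ hη.le
    rw [mul_pow, Real.sq_sqrt hr0.le]
    refine le_trans ?_ h2.le
    gcongr
  -- The three exceptional events: linear term too large for some `α`, fluctuation of the quadratic
  -- term too large, tuning parameter too far from `α₀`.
  let E1 : Set Ω := {ω | ∃ α ∈ Icc (α₀ / 2) (3 * α₀ / 2), A₁ * (R / n) <
        ∑ k, ((n : ℝ)⁻¹ * ∑ i, F.lossDeriv α (Y n i ω) (g₀ (t n i)) * φ k (t n i)) ^ 2}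
  let E2 : Set Ω := {ω | w ^ 2 < ∑ k, ∑ l, (∑ i, ((n : ℝ)⁻¹ * (φ k (t n i) * φ l (t n i))) *
        (F.lossDeriv2 α₀ (Y n i ω) (g₀ (t n i)) -
          ∫ ω', F.lossDeriv2 α₀ (Y n i ω') (g₀ (t n i)) ∂P)) ^ 2}
  let E3 : Set Ω := {ω | ENNReal.ofReal η ≤ edist (αhat n ω) α₀}
  have hE1 : P E1 ≤ ENNReal.ofReal (ε / 3) := by
    refine (hLb n (Y n) (fun i => g₀ (t n i)) hn (hY n) (hindep n) (hlaw n) (hT' n) N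
      (fun k i => φ k (t n i)) R hR0 hRφ A₁ hA₁0).trans_eq ?_
    congr 1
    rw [hA₁]
    field_simp
  have hE2 : P E2 ≤ ENNReal.ofReal (ε / 3) := by
    refine (hQb n (Y n) (fun i => g₀ (t n i)) hn (hY n) (hindep n) (hT' n) N
      (fun k i => φ k (t n i)) R hR0 hRφ w hw0).trans (ENNReal.ofReal_le_ofReal ?_)
    refine le_trans ?_ h3.le
    calc CQ * (R ^ 2 / n) / w ^ 2 ≤ CQ * ((CR * K n) ^ 2 / n) / w ^ 2 := by gcongr
      _ = _ := by field_simp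
  -- Outside these events the argument is deterministic; only monotonicity and subadditivity of
  -- outer measure are needed afterwards. As `η < α₀ / 2`, the tuning parameter lies in the interval
  -- covered by `E1`.
  have hsub : {ω | ∃ g : ℝ → ℝ, IsLocalSplineMinimizer p (K n) (x n)
      (objective F m n (lam n) (αhat n ω) (t n) (fun i => Y n i ω)) g ∧
        sqNorm (fun s => g s - g₀ s) ≤ (2 * H ^ 2 + 2 * CS ^ 2) * r}ᶜ ⊆ E1 ∪ (E2 ∪ E3) := by
    intro ω hω
    by_contra hωE
    simp only [E1, E2, E3, mem_union, mem_ofPred_eq, not_or, not_lt, not_le, not_exists, not_and] at hωE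
    obtain ⟨hω1, hω2, hω3⟩ := hωE
    have hαη : |αhat n ω - α₀| ≤ η := by
      rw [edist_dist, ENNReal.ofReal_lt_ofReal_iff hη, Real.dist_eq] at hω3
      exact hω3.le
    obtain ⟨hαl, hαu⟩ := abs_le.1 hαη
    have hsq : (√r) ^ 2 = r := Real.sq_sqrt hr0.le
    have hsr0 : 0 < √r := Real.sqrt_pos.2 hr0
    obtain ⟨g, hg, hgn⟩ := F.exists_localSplineMinimizer_near hB (hx n) (hM n) (hlam n)
      (α := αhat n ω) (α₀ := α₀) (by linarith) hn (ht n) (fun i => Y n i ω) hs (g := g₀) hφ hφs hφn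
      (C := CI) (ε := c₁ / 2) (L := √(A₁ * CR) * √r) (κ := w) (c₁ := c₁) (U := CS * √r) (a := a / 2)
      (A := Ae) (B := √(CP * CS) * √r) (ρ := H * √r) (c₂ := w / 2) (η := η) (R := R)
      (μ := fun i => ∫ ω', F.lossDeriv2 α₀ (Y n i ω') (g₀ (t n i)) ∂P)
      hCI (by linarith) (by linarith) (by linarith) (by rw [hAe]; positivity) (by positivity)
      (by positivity) hw0.le hη.le
      (fun i h hh => by
        have := hinc (αhat n ω) hαη (g₀ (t n i)) (hT' n i) (s (t n i) - g₀ (t n i)) h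
          ((hU _ (ht n i)).trans hUη) hh (Y n i ω)
        rwa [add_sub_cancel] at this)
      hU hRβ
      (by
        rw [mul_pow, hsq]
        refine le_trans ?_ h1.le
        calc R * (H ^ 2 * r) ≤ CR * K n * (H ^ 2 * r) := by gcongr
          _ = _ := by ring)
      (by
        refine (hω1 (αhat n ω) ⟨by linarith, by linarith⟩).trans ?_
        rw [mul_pow, hsq, Real.sq_sqrt (by positivity), mul_assoc]
        gcongr)
      hω2
      (fun i => hc₁ ▸ F.le_integral_lossDeriv2 hB (hY n i) (hlaw n i) hα₀ (hinfo n i))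
      (fun h hh => by
        have e := hEb (K n) (x n) (hx n) (hM n) n hn (t n) (ht n) q hq a A ha hqb hq1 _ h5 h hh
        have e2 : a / (4 * CE) * (K n : ℝ)⁻¹ * (CE * (K n + 1)) ≤ a / 2 := by
          calc a / (4 * CE) * (K n : ℝ)⁻¹ * (CE * (K n + 1)) ≤
                a / (4 * CE) * (K n : ℝ)⁻¹ * (CE * (2 * K n)) := by
                gcongr
                linarith
            _ = _ := by field_simp; norm_num
        have e3 := sqNorm_nonneg h
        refine ⟨le_trans ?_ e.1, e.2.trans ?_⟩
        · exact mul_le_mul_of_nonneg_right (by linarith) e3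
        · exact mul_le_mul_of_nonneg_right (by rw [hAe]; linarith) e3)
      (fun β => by
        have e := hPb (K n) (x n) hK1 (hx n) (hM n) (lam n) (hlam n) s _ hs (IsSpline.linComb hφ β)
        rw [hφn] at e
        refine abs_le_of_sq_le_sq (e.trans ?_) (by positivity)
        rw [mul_pow, mul_pow, hsq, Real.sq_sqrt (by positivity)]
        gcongr
        rw [hr, splineRate]
        linarith)
      (by
        have : √(A₁ * CR) * √r + CI * (CS * √r) * √Ae + 2 * (√(CP * CS) * √r) = G * √r := by
          rw [hG]; ring
        rw [this, hH, ← mul_assoc, mul_div_cancel₀ _ (by positivity : w / 2 ≠ 0)]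
        gcongr
        linarith)
    refine hω ⟨g, hg, hgn.trans_eq ?_⟩
    rw [mul_pow, mul_pow, hsq]
    ring
  calc _ ≤ P (E1 ∪ (E2 ∪ E3)) := measure_mono hsub
    _ ≤ P E1 + (P E2 + P E3) := (measure_union_le _ _).trans (by gcongr; exact measure_union_le _ _)
    _ ≤ ENNReal.ofReal (ε / 3) + (ENNReal.ofReal (ε / 3) + ENNReal.ofReal (ε / 3)) := by gcongr
    _ = _ := by
        rw [← ENNReal.ofReal_add (by positivity) (by positivity),
          ← ENNReal.ofReal_add (by positivity) (by positivity)]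
        congr 1
        ring

theorem theorem2
    -- the model: data `(t n i, Y n i)`, `i < n`, with `Y n i` independent and of law `F_{g₀(t n i)}`
    {Ω : Type*} [MeasurableSpace Ω] (P : Measure Ω) [IsProbabilityMeasure P]
    (F : ExpFamily) (g₀ : ℝ → ℝ)
    (t : (n : ℕ) → Fin n → ℝ) (ht : ∀ n i, t n i ∈ Icc (0 : ℝ) 1)
    (Y : (n : ℕ) → Fin n → Ω → ℝ) (hY : ∀ n i, Measurable (Y n i))
    (hindep : ∀ n, iIndepFun (Y n) P)
    (hlaw : ∀ n i, P.map (Y n i) = F.law (g₀ (t n i)))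
    -- orders, smoothing parameters, knots, random tuning parameter
    (m p j : ℕ) (hm : 1 ≤ m) (hmp : m < p) (hmj : m ≤ j) (hjp : j ≤ p)
    (hg₀ : ContDiffOn ℝ (j : WithTop ℕ∞) g₀ (Icc 0 1))
    (lam : ℕ → ℝ) (hlam : ∀ n, 0 ≤ lam n)
    (K : ℕ → ℕ) (x : ℕ → ℕ → ℝ) (hx : ∀ n, IsKnotSeq (K n) (x n))
    (αhat : ℕ → Ω → ℝ)
    -- (A1) common support
    (𝒴 : Set ℝ) (hA1 : ∀ θ : ℝ, closure {y | 0 < F.density θ y} = 𝒴)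
    -- (A2) consistency of the tuning parameter
    (α₀ : ℝ) (hα₀ : 0 < α₀) (hA2 : TendstoInMeasure P αhat atTop (fun _ => α₀))
    -- (A3) bounded, twice differentiable densities and a bound on the derivative
    (δ : ℝ) (hδ : 0 < δ)
    (hA3_bdd : ∃ B : ℝ, ∀ θ y, F.density θ y ≤ B)
    (hA3_diff : ∀ s ∈ Icc (0 : ℝ) 1, ∀ u : ℝ, |u| < δ → ∀ y ∈ 𝒴,
      DifferentiableAt ℝ (fun θ => F.density θ y) (g₀ s + u) ∧
      DifferentiableAt ℝ (deriv fun θ => F.density θ y) (g₀ s + u))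
    (hA3 : ∃ M : ℝ, ∀ s ∈ Icc (0 : ℝ) 1, ∀ α u : ℝ, |α - α₀| < δ → |u| < δ → ∀ y ∈ 𝒴,
      |F.dPow α y (g₀ s + u) * Real.log (F.density (g₀ s + u) y)| ≤ M)
    -- (A4) equicontinuity at `u = 0` and uniform boundedness of the second derivatives
    (hA4_m : ∀ α : ℝ, |α - α₀| < δ →
      EquicontinuousAt (fun (s : Icc (0 : ℝ) 1) (u : ℝ) =>
        ∫ y in 𝒴, F.d2Pow (1 + α) y (g₀ s + u) ∂F.ν) 0)
    (hA4_n : ∀ α : ℝ, |α - α₀| < δ → ∀ y ∈ 𝒴,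
      EquicontinuousAt (fun (s : Icc (0 : ℝ) 1) (u : ℝ) => F.d2Pow α y (g₀ s + u)) 0)
    (hA4 : ∃ M' : ℝ, ∀ s ∈ Icc (0 : ℝ) 1, ∀ α u : ℝ, |α - α₀| < δ → |u| < δ → ∀ y ∈ 𝒴,
      |∫ z in 𝒴, F.d2Pow (1 + α) z (g₀ s + u) ∂F.ν| + |F.d2Pow α y (g₀ s + u)| ≤ M')
    -- (A5) moment bounds
    (hA5 : ∃ c₀ C₀ : ℝ, 0 < c₀ ∧ ∀ α : ℝ, |α - α₀| < δ → ∀ n i,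
      c₀ ≤ ∫ ω, F.density (g₀ (t n i)) (Y n i ω) ^ α * F.score (g₀ (t n i)) (Y n i ω) ^ 2 ∂P ∧
      ∫ ω, F.density (g₀ (t n i)) (Y n i ω) ^ α * F.score (g₀ (t n i)) (Y n i ω) ^ 2 ∂P ≤ C₀)
    -- (B6) growth of the number of knots
    (hB6_top : Tendsto K atTop atTop)
    (hB6 : ∃ δ' : ℝ, 0 < δ' ∧
      Tendsto (fun n : ℕ => (n : ℝ) ^ (δ' - 1) * (K n : ℝ) ^ 2) atTop (𝓝 0))
    -- (B7) placement of the knots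
    (hB7_diff : ∀ ε > 0, ∀ᶠ n in atTop, ∀ i < K n,
      |(x n (i + 2) - x n (i + 1)) - (x n (i + 1) - x n i)| ≤ ε * (K n : ℝ)⁻¹)
    (hB7_ratio : ∃ M : ℝ, ∀ n, ∀ i ≤ K n, ∀ k ≤ K n,
      x n (i + 1) - x n i ≤ M * (x n (k + 1) - x n k))
    -- (B8) the design points, with limiting density `q`
    (hB8 : ∃ q : ℝ → ℝ, Measurable q ∧
      (∃ a A : ℝ, 0 < a ∧ ∀ s ∈ Icc (0 : ℝ) 1, a ≤ q s ∧ q s ≤ A) ∧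
      (∫ s in (0 : ℝ)..1, q s) = 1 ∧
      ∀ ε > 0, ∀ᶠ n in atTop, ∀ s ∈ Icc (0 : ℝ) 1,
        |empiricalCDF (t n) s - ∫ r in (0 : ℝ)..s, q r| ≤ ε * (K n : ℝ)⁻¹)
    -- limit conditions
    (hlam_zero : Tendsto lam atTop (𝓝 0))
    (hlim₁ : Tendsto (fun n => (K n : ℝ) * min (lam n ^ 2 * (K n : ℝ) ^ (2 * m)) (lam n))
      atTop (𝓝 0))
    (hlim₂ : Tendsto (fun n : ℕ => (n : ℝ) * max (K n : ℝ)⁻¹ (lam n ^ (1 / (2 * m : ℝ))) *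
      Real.exp (-minNegPow ((K n : ℝ) ^ 2) (lam n) (1 / (m : ℝ)))) atTop (𝓝 0)) :
    Tendsto (fun D : ℝ => liminf (fun n : ℕ => innerProb P
      {ω | ∃ g : ℝ → ℝ,
        IsLocalSplineMinimizer p (K n) (x n)
          (objective F m n (lam n) (αhat n ω) (t n) (fun i => Y n i ω)) g ∧
        sqNorm (fun s => g s - g₀ s) ≤
          D * ((n : ℝ)⁻¹ * minNegPow (K n : ℝ) (lam n) (1 / (2 * m : ℝ))
            + min (lam n ^ 2 * (K n : ℝ) ^ (2 * m)) (lam n)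
            + ((K n : ℝ) ^ (2 * j))⁻¹)}) atTop) atTop (𝓝 1) := by
  obtain ⟨c₀, C₀, hc₀, hinfo⟩ := hA5
  obtain ⟨δ', hδ', hB6'⟩ := hB6
  obtain ⟨M, hM⟩ := hB7_ratio
  obtain ⟨q, hq, ⟨a, A, ha, hqb⟩, hq1, hdesign⟩ := hB8
  have key := fun (ε : ℝ) (hε : 0 < ε) => F.exists_eventually_measure_compl_le P g₀ t ht Y hY hindep
    hlaw hm hmp hmj hjp hg₀ hlam hx hα₀ hA2 hA3_bdd hc₀
    (fun n i => (hinfo α₀ (by simpa using hδ) n i).1) hB6_top (tendsto_sq_div_of_rpow hδ' hB6') hM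
    hq ha hqb hq1 hdesign hlam_zero hlim₁ hε
  refine tendsto_order.2 ⟨fun b hb => ?_, fun b hb => Eventually.of_forall fun D => ?_⟩
  -- The exceptional probability allowed is `1 - b'`, with `b < b' < 1`; a larger `D` only enlarges
  -- the event.
  · obtain ⟨b', hbb', hb'⟩ := exists_between hb
    obtain ⟨D₀, hD₀⟩ := key (1 - b').toReal
      (ENNReal.toReal_pos (tsub_pos_of_lt hb').ne' (by simp))
    rw [ENNReal.ofReal_toReal (by simp)] at hD₀
    filter_upwards [eventually_ge_atTop D₀] with D hD
    refine hbb'.trans_le (le_liminf_of_le (by isBoundedDefault) ?_)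
    filter_upwards [hD₀, hB6_top.eventually_ge_atTop 1] with n hn hK1
    rw [innerProb, ← ENNReal.sub_sub_cancel ENNReal.one_ne_top hb'.le]
    refine tsub_le_tsub_left ((measure_mono (compl_subset_compl.2 fun ω hω => ?_)).trans hn) 1
    obtain ⟨g, hg, hgn⟩ := hω
    exact ⟨g, hg, hgn.trans (mul_le_mul_of_nonneg_right hD
      (splineRate_pos (m := m) (j := j) (n := n) (hlam n) hK1).le)⟩
  -- Inner probabilities never exceed `1`, hence neither does the lower limit.
  · refine lt_of_le_of_lt (liminf_le_of_le (by isBoundedDefault) fun c hc => ?_) hb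
    obtain ⟨n, hn⟩ := hc.exists
    exact hn.trans tsub_le_self
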